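/- Let $n\ge 2$. Let $\Gamma\subset\mathbb{R}^n$ be a symmetric open convex cone containing $(1,\dots,1)$, and let $f\in C^\infty(\Gamma)\cap C^0(\bar\Gamma)$ be symmetric, positive, homogeneous of degree one, strictly monotone ($\partial f/\partial\kappa_i>0$ on $\Gamma$ for all $i$) and concave on $\Gamma$, with $f|_{\partial\Gamma}=0$ and $f(1,\dots,1)=n$. For a hypersurface with Weingarten operator $A$ (with respect to a unit normal $\nu$, with the sign for which round spheres with outward normal have positive curvature) and principal curvatures $\kappa_1\le\dots\le\kappa_n$ put $F=F(A)=f(\kappa_1,\dots,\kappa_n)$, and let $u=\langle x,\nu\rangle$ be its support function. Call $M\subset\mathbb{R}^{n+1}$ starshaped with radial function $\rho$ if $M=\{\rho(y)\,y: y\in\mathbb{S}^n\}$ with $\rho:\mathbb{S}^n\to(0,\infty)$ smooth. Let $M_0\subset\mathbb{R}^{n+1}$ be starshaped. Then there exist a constant $c>0$ and a compact set $K\subset\Gamma$, depending only on $M_0$ (and on $n,\Gamma,f$), such that the following holds. Let $0<T\le\infty$ and let $x\in C^\infty([0,T)\times\mathbb{S}^n,\mathbb{R}^{n+1})$ be a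 solution of $$\dot x=\Bigl(\frac{1}{F(A)}-\frac{u}{n}\Bigr)\nu ,$$ where every $x(t,\cdot)$ is an immersion whose principal curvatures lie in $\Gamma$ at every point, $x(0,\cdot)$ is an embedding with image $M_0$, and $\nu$ is the smooth unit normal field along $x$ on $[0,T)\times\mathbb{S}^n$ that points outward at $t=0$, i.e. $\langle x(0,\cdot),\nu(0,\cdot)\rangle>0$. Then for all $t\in[0,T)$ the set $x(t,\mathbb{S}^n)$ is starshaped, its radial function $\rho(t,\cdot)$ satisfies $$\min_{\mathbb{S}^n}\rho(0,\cdot)\le\rho(t,\cdot)\le\max_{\mathbb{S}^n}\rho(0,\cdot),$$ and for all $t\in[0,T)$ and at every point of $\mathbb{S}^n$ $$c^{-1}\le u\le c,\qquad c^{-1}\le F\le c,\qquad |A|^2\le c,\qquad (\kappa_1,\dots,\kappa_n)\in K .$$ Moreover $|\rho(t,\cdot)|\le c$, $|\bar\nabla\rho(t,\cdot)|\le c$ and $|\bar\nabla^2\rho(t,\cdot)|\le c$ on $\mathbb{S}^n$ for all $t\in[0,T)$, where $\bar\nabla$ is the Levi-Civita connection of the round metric and the norms are those of (bi)linear forms.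 -/

import Mathlib

open scoped Manifold ContDiff RealInnerProductSpace

noncomputable section

/-- The ambient Euclidean space `ℝⁿ⁺¹`. -/
abbrev Ambient (n : ℕ) : Type := EuclideanSpace ℝ (Fin (n + 1))

/-- The unit sphere `𝕊ⁿ` in `ℝⁿ⁺¹`, with Mathlib's smooth structure. -/
abbrev UnitSphere (n : ℕ) : Type := Metric.sphere (0 : Ambient n) 1

/-- The standing assumptions on the curvature function: `Γ` is a symmetric open convex cone in `ℝⁿ`
containing `(1,…,1)`, and `f ∈ C^∞(Γ) ∩ C⁰(closure Γ)` is symmetric, positive, homogeneous of degree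
one, strictly monotone and concave on `Γ`, vanishes on `∂Γ` and satisfies `f(1,…,1) = n`. -/
structure IsAdmissibleCurvatureFunction {n : ℕ} (Γ : Set (Fin n → ℝ)) (f : (Fin n → ℝ) → ℝ) :
    Prop where
  isOpen_cone : IsOpen Γ
  convex_cone : Convex ℝ Γ
  smul_mem : ∀ κ ∈ Γ, ∀ l : ℝ, 0 < l → l • κ ∈ Γ
  perm_mem : ∀ κ ∈ Γ, ∀ p : Equiv.Perm (Fin n), κ ∘ p ∈ Γ
  one_mem : (fun _ => 1) ∈ Γ
  smooth : ContDiffOn ℝ ∞ f Γ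
  continuous_closure : ContinuousOn f (closure Γ)
  symmetric : ∀ κ ∈ Γ, ∀ p : Equiv.Perm (Fin n), f (κ ∘ p) = f κ
  pos : ∀ κ ∈ Γ, 0 < f κ
  homogeneous : ∀ κ ∈ Γ, ∀ l : ℝ, 0 < l → f (l • κ) = l * f κ
  strictly_monotone : ∀ κ ∈ Γ, ∀ i : Fin n, 0 < fderiv ℝ f κ (Pi.single i 1)
  concave : ConcaveOn ℝ Γ f
  zero_boundary : ∀ κ ∈ frontier Γ, f κ = 0
  normalized : f (fun _ => 1) = n

/-- The differential at `ξ` of a map `y : 𝕊ⁿ → ℝⁿ⁺¹`, evaluated on the `i`-th vector of the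
coordinate frame of the tangent space `T_ξ 𝕊ⁿ` given by the preferred chart at `ξ`. -/
def frameDeriv {n : ℕ} (y : UnitSphere n → Ambient n) (ξ : UnitSphere n) (i : Fin n) : Ambient n :=
  mfderiv (𝓡 n) 𝓘(ℝ, Ambient n) y ξ (EuclideanSpace.single i (1 : ℝ) : EuclideanSpace ℝ (Fin n))

/-- Components `g_ij = ⟨∂_i x, ∂_j x⟩` of the induced metric. -/
def inducedMetric {n : ℕ} (x : UnitSphere n → Ambient n) (ξ : UnitSphere n) :
    Matrix (Fin n) (Fin n) ℝ :=
  Matrix.of fun i j => ⟪frameDeriv x ξ i, frameDeriv x ξ j⟫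

/-- Components `h_ij = ⟨∂_i ν, ∂_j x⟩` of the second fundamental form with respect to the unit
normal `ν`. This is `-⟨∂_i ∂_j x, ν⟩`, so round spheres have positive second fundamental form with
respect to their outward normal. -/
def secondFundamentalForm {n : ℕ} (x ν : UnitSphere n → Ambient n) (ξ : UnitSphere n) :
    Matrix (Fin n) (Fin n) ℝ :=
  Matrix.of fun i j => ⟪frameDeriv ν ξ i, frameDeriv x ξ j⟫

/-- The Weingarten operator `A = g⁻¹ h`, i.e. `g (A X, Y) = h (X, Y)`, as a matrix in the
coordinate frame. -/
def weingarten {n : ℕ} (x ν : UnitSphere n → Ambient n) (ξ : UnitSphere n) :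
    Matrix (Fin n) (Fin n) ℝ :=
  (inducedMetric x ξ)⁻¹ * secondFundamentalForm x ν ξ

/-- The squared norm `|A|² = g^{ik} g^{jl} h_ij h_kl` with respect to the induced metric. -/
def weingartenNormSq {n : ℕ} (x ν : UnitSphere n → Ambient n) (ξ : UnitSphere n) : ℝ :=
  ((inducedMetric x ξ)⁻¹ * secondFundamentalForm x ν ξ *
    (inducedMetric x ξ)⁻¹ * (secondFundamentalForm x ν ξ).transpose).trace

/-- The eigenvalue map: the real eigenvalues, counted with multiplicity, in increasing order.
(Entries without a real root to fill them are `0`; this does not occur for Weingarten operators.) -/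
def eigenvalueTuple {n : ℕ} (A : Matrix (Fin n) (Fin n) ℝ) : Fin n → ℝ :=
  fun i => (A.charpoly.roots.sort (· ≤ ·)).getD i 0

/-- The principal curvatures `κ₁ ≤ … ≤ κₙ`. -/
def principalCurvatures {n : ℕ} (x ν : UnitSphere n → Ambient n) (ξ : UnitSphere n) : Fin n → ℝ :=
  eigenvalueTuple (weingarten x ν ξ)

/-- The curvature function `F(A) = f(EV(A))` evaluated on the hypersurface. -/
def curvatureF {n : ℕ} (f : (Fin n → ℝ) → ℝ) (x ν : UnitSphere n → Ambient n)
    (ξ : UnitSphere n) : ℝ :=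
  f (principalCurvatures x ν ξ)

/-- The support function `u = ⟨x, ν⟩`. -/
def supportFunction {n : ℕ} (x ν : UnitSphere n → Ambient n) (ξ : UnitSphere n) : ℝ :=
  ⟪x ξ, ν ξ⟫

/-- `r` is the (smooth, positive) radial function of `M`: `M = {r(y) y : y ∈ 𝕊ⁿ}`. -/
structure IsRadialFunction {n : ℕ} (r : UnitSphere n → ℝ) (M : Set (Ambient n)) : Prop where
  smooth : ContMDiff (𝓡 n) 𝓘(ℝ, ℝ) ∞ r
  pos : ∀ y, 0 < r y
  graph : M = Set.range fun y : UnitSphere n => r y • (y : Ambient n)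

/-- `M` is a smooth closed hypersurface which is starshaped around the origin, i.e. a graph over
the sphere in polar coordinates. -/
def IsStarshaped {n : ℕ} (M : Set (Ambient n)) : Prop :=
  ∃ r : UnitSphere n → ℝ, IsRadialFunction r M

/-- The time interval `[0, T)`, where `T ≤ ∞`. -/
def timeInterval (T : EReal) : Set ℝ := {t | 0 ≤ t ∧ (t : EReal) < T}

/-- `x : [0, T) × 𝕊ⁿ → ℝⁿ⁺¹` is a smooth solution of the flow `ẋ = (1 / F(A) - u / n) ν` by
immersed hypersurfaces with principal curvatures in `Γ`, starting from an embedding `x(0, ·)` of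
`M₀`, and `ν` is its smooth unit normal field that points outward at time `0`. -/
structure IsFlowSolution {n : ℕ} (Γ : Set (Fin n → ℝ)) (f : (Fin n → ℝ) → ℝ) (M₀ : Set (Ambient n))
    (T : EReal) (x ν : ℝ → UnitSphere n → Ambient n) : Prop where
  time_pos : 0 < T
  smooth : ContMDiffOn (𝓘(ℝ, ℝ).prod (𝓡 n)) 𝓘(ℝ, Ambient n) ∞
    (fun p : ℝ × UnitSphere n => x p.1 p.2) (timeInterval T ×ˢ Set.univ)
  immersion : ∀ t ∈ timeInterval T, ∀ ξ,
    Function.Injective (mfderiv (𝓡 n) 𝓘(ℝ, Ambient n) (x t) ξ)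
  normal_smooth : ContMDiffOn (𝓘(ℝ, ℝ).prod (𝓡 n)) 𝓘(ℝ, Ambient n) ∞
    (fun p : ℝ × UnitSphere n => ν p.1 p.2) (timeInterval T ×ˢ Set.univ)
  normal_unit : ∀ t ∈ timeInterval T, ∀ ξ, ‖ν t ξ‖ = 1
  normal_orthogonal : ∀ t ∈ timeInterval T, ∀ ξ, ∀ i : Fin n, ⟪frameDeriv (x t) ξ i, ν t ξ⟫ = 0
  normal_outward : ∀ ξ, 0 < ⟪x 0 ξ, ν 0 ξ⟫
  initial_injective : Function.Injective (x 0)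
  initial_range : Set.range (x 0) = M₀
  admissible : ∀ t ∈ timeInterval T, ∀ ξ, principalCurvatures (x t) (ν t) ξ ∈ Γ
  flow : ∀ t ∈ timeInterval T, ∀ ξ,
    HasDerivWithinAt (fun s => x s ξ)
      ((1 / curvatureF f (x t) (ν t) ξ - supportFunction (x t) (ν t) ξ / n) • ν t ξ)
      (timeInterval T) t

/-- The extension of `r : 𝕊ⁿ → ℝ` to `ℝⁿ⁺¹ \ {0}` that is homogeneous of degree zero,
`z ↦ r (z / |z|)`. -/
def homogeneousExtension {n : ℕ} (r : UnitSphere n → ℝ) (z : Ambient n) : ℝ :=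
  open Classical in
  if h : ‖z‖⁻¹ • z ∈ Metric.sphere (0 : Ambient n) 1 then r ⟨‖z‖⁻¹ • z, h⟩ else 0

/-- `|r| ≤ c`, `|∇r| ≤ c` and `|∇²r| ≤ c` on the round sphere. Tangent vectors at `y` are the
vectors orthogonal to `y`; on these, the first and second derivatives at `y` of the extension that
is homogeneous of degree zero are the covariant derivatives `∇r` and `∇²r` of the round metric. -/
def HasC2Bound {n : ℕ} (r : UnitSphere n → ℝ) (c : ℝ) : Prop :=
  ∀ y : UnitSphere n, |r y| ≤ c ∧
    (∀ v : Ambient n, ⟪v, (y : Ambient n)⟫ = 0 →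
      |fderiv ℝ (homogeneousExtension r) y v| ≤ c * ‖v‖) ∧
    (∀ v w : Ambient n, ⟪v, (y : Ambient n)⟫ = 0 → ⟪w, (y : Ambient n)⟫ = 0 →
      |fderiv ℝ (fderiv ℝ (homogeneousExtension r)) y v w| ≤ c * ‖v‖ * ‖w‖)

end

/-! Describe the hypersurface at time t as the level set φ(t,·) = 1 of a positive function on ℝⁿ⁺¹ \
{0} that is homogeneous of degree one, so that φ(t,z) = |z| / ρ(t, z/|z|). On this level set |Dφ| =
1/u, and D²φ restricted to ker Dφ has eigenvalues κ/u. The flow becomes ∂φ/∂t = φ/n − |Dφ|² /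
f(eigenvalues of D²φ on ker Dφ), see `IsStarshapedFlow.isGaugeFlow`. The right-hand side is
homogeneous of degree one in φ, invariant under rotations, and monotone in D²φ. Hence the maximum
over the sphere of the quotient of two solutions cannot increase: `IsGaugeFlow.le_of_le`.

All estimates of lower order are instances of this comparison. Comparing φ with the stationary
solution |z| bounds ρ. Comparing φ with a rotated copy of itself bounds Dφ, hence u from below
(`IsGaugeFlow.norm_fderiv_le`). Comparing φ with a time translate of itself preserves the initial
bounds for ∂ₜ log φ = 1/n − 1/(uF), hence bounds F (`IsGaugeFlow.deriv_le`, `IsGaugeFlow.le_deriv`).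

The curvature bound is a maximum principle for κ_max/u (`IsGaugeFlow.curvatureQuotientLE`). At a
spatial maximum z with maximal principal direction e, the equation is expanded to second order along
the line z + s e. By Schur's theorem and concavity, f of the eigenvalues lies below the
linearization of f at z applied to the diagonal of D²φ in any orthonormal tangent frame, so the
equation turns into an inequality in the single variable s with equality at s = 0. Its second order
condition, the first and second order conditions of the maximum, and F/n ≤ κ_max give the sign of
the time derivative (`IsGauge.curvature_speed_nonpos`); the gradient terms form a perfect square.
The upper bound for κ and 0 < F ≤ Σ κᵢ give |κ| ≤ c, and since f vanishes on ∂Γ the bound F ≥ 1/c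
keeps κ in a compact subset of Γ.

It remains to pass between the parametrization and φ. While u > 0, the cone over x(t,·) is a
homogeneous local diffeomorphism of ℝⁿ⁺¹ \ {0}; it is surjective, and injectivity is an open and
closed condition in t (`IsRadialFamily.injOn`). Positivity of u persists because before a first zero
the estimates already give u ≥ 1/c (`IsFlowSolution.supportFunction_pos`). The constants depend on
M₀ only, because φ(0,·) determines the initial speed through the equation. -/

namespace IsAdmissibleCurvatureFunction

/-! ### Concave symmetric curvature functions. -/

variable {n : ℕ} {Γ : Set (Fin n → ℝ)} {f : (Fin n → ℝ) → ℝ}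

lemma hasFDerivAt (hf : IsAdmissibleCurvatureFunction Γ f) {κ : Fin n → ℝ} (hκ : κ ∈ Γ) :
    HasFDerivAt f (fderiv ℝ f κ) κ :=
  ((hf.smooth.contDiffAt (hf.isOpen_cone.mem_nhds hκ)).differentiableAt (by simp)).hasFDerivAt

lemma fderiv_apply_self (hf : IsAdmissibleCurvatureFunction Γ f) {κ : Fin n → ℝ} (hκ : κ ∈ Γ) :
    fderiv ℝ f κ κ = f κ := by
  have h1 : HasDerivAt (fun l : ℝ => l • κ) κ 1 := by
    simpa using (hasDerivAt_id (1 : ℝ)).smul_const κ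
  have h2 : HasDerivAt (fun l : ℝ => f (l • κ)) (fderiv ℝ f κ κ) 1 :=
    HasFDerivAt.comp_hasDerivAt (1 : ℝ) (by simpa using hf.hasFDerivAt hκ) h1
  have h3 : HasDerivAt (fun l : ℝ => l * f κ) (f κ) 1 := by
    simpa using (hasDerivAt_id (1 : ℝ)).mul_const (f κ)
  refine h2.unique (h3.congr_of_eventuallyEq ?_)
  filter_upwards [lt_mem_nhds (zero_lt_one' ℝ)] with l hl using hf.homogeneous κ hκ l hl

/-- A concave function which is homogeneous of degree one lies below its linearizations. -/
lemma le_fderiv (hf : IsAdmissibleCurvatureFunction Γ f) {κ d : Fin n → ℝ} (hκ : κ ∈ Γ)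
    (hd : d ∈ Γ) : f d ≤ fderiv ℝ f κ d := by
  have hc : ConcaveOn ℝ (AffineMap.lineMap κ d ⁻¹' Γ) (f ∘ (AffineMap.lineMap κ d : ℝ →ᵃ[ℝ] _)) :=
    hf.concave.comp_affineMap _
  have h1 : HasDerivAt (AffineMap.lineMap κ d : ℝ → Fin n → ℝ) (d - κ) 0 :=
    AffineMap.hasDerivAt_lineMap
  have h2 : HasDerivAt (f ∘ (AffineMap.lineMap κ d : ℝ →ᵃ[ℝ] _)) (fderiv ℝ f κ (d - κ)) 0 :=
    HasFDerivAt.comp_hasDerivAt (0 : ℝ) (by simpa using hf.hasFDerivAt hκ) h1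
  have h3 := hc.slope_le_of_hasDerivAt (x := 0) (y := 1) (by simpa using hκ) (by simpa using hd)
    one_pos h2
  simp only [slope_def_field, Function.comp_apply, AffineMap.lineMap_apply_one,
    AffineMap.lineMap_apply_zero, map_sub, hf.fderiv_apply_self hκ] at h3
  linarith

lemma fderiv_eq_sum (κ d : Fin n → ℝ) :
    fderiv ℝ f κ d = ∑ i, fderiv ℝ f κ (Pi.single i 1) * d i := by
  conv_lhs => rw [← Finset.univ_sum_single d]
  rw [map_sum]
  refine Finset.sum_congr rfl fun i _ => ?_
  have : (Pi.single i (d i) : Fin n → ℝ) = d i • Pi.single i (1 : ℝ) := by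
    rw [← Pi.single_smul]; simp
  rw [this, map_smul, smul_eq_mul, mul_comm]

lemma sum_fderiv_mul (hf : IsAdmissibleCurvatureFunction Γ f) {κ : Fin n → ℝ} (hκ : κ ∈ Γ) :
    ∑ i, fderiv ℝ f κ (Pi.single i 1) * κ i = f κ := by
  rw [← fderiv_eq_sum, hf.fderiv_apply_self hκ]

lemma le_sum_fderiv (hf : IsAdmissibleCurvatureFunction Γ f) {κ d : Fin n → ℝ} (hκ : κ ∈ Γ)
    (hd : d ∈ Γ) : f d ≤ ∑ i, fderiv ℝ f κ (Pi.single i 1) * d i := by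
  rw [← fderiv_eq_sum]; exact hf.le_fderiv hκ hd

/-- The linearization at μ suffices: f κ ≤ Σ fᵢ(μ) κᵢ ≤ Σ fᵢ(μ) μᵢ = f μ, the last equality being
Euler's relation. -/
lemma mono (hf : IsAdmissibleCurvatureFunction Γ f) {κ μ : Fin n → ℝ} (hκ : κ ∈ Γ)
    (hμ : μ ∈ Γ) (h : ∀ i, κ i ≤ μ i) : f κ ≤ f μ := by
  rw [← hf.sum_fderiv_mul hμ]
  refine (hf.le_sum_fderiv hμ hκ).trans (Finset.sum_le_sum fun i _ => ?_)
  exact mul_le_mul_of_nonneg_left (h i) (hf.strictly_monotone μ hμ i).le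

/-- By Birkhoff's theorem `S` is a convex combination of permutation matrices, so `S.mulVec κ` is a
convex combination of permutations of κ, on all of which f takes the same value. -/
lemma mulVec_doublyStochastic (hf : IsAdmissibleCurvatureFunction Γ f)
    {S : Matrix (Fin n) (Fin n) ℝ} (hS : S ∈ doublyStochastic ℝ (Fin n)) {κ : Fin n → ℝ}
    (hκ : κ ∈ Γ) : S.mulVec κ ∈ Γ ∧ f κ ≤ f (S.mulVec κ) := by
  obtain ⟨w, hw0, hw1, rfl⟩ := exists_eq_sum_perm_of_mem_doublyStochastic hS
  have h : (∑ σ, w σ • Equiv.Perm.permMatrix ℝ σ).mulVec κ = ∑ σ : Equiv.Perm (Fin n), w σ • (κ ∘ σ) := by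
    simp [Matrix.sum_mulVec, Matrix.smul_mulVec, Matrix.permMatrix_mulVec]
  rw [h]
  refine ⟨hf.convex_cone.sum_mem (fun σ _ => hw0 σ) hw1 fun σ _ => hf.perm_mem κ hκ σ, ?_⟩
  have := hf.concave.le_map_sum (t := Finset.univ) (w := w) (p := fun σ : Equiv.Perm (Fin n) => κ ∘ σ)
    (fun σ _ => hw0 σ) hw1 fun σ _ => hf.perm_mem κ hκ σ
  refine le_trans (le_of_eq ?_) this
  simp_rw [hf.symmetric κ hκ, smul_eq_mul, ← Finset.sum_mul, hw1, one_mul]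

lemma zero_notMem (hf : IsAdmissibleCurvatureFunction Γ f) : (0 : Fin n → ℝ) ∉ Γ := by
  intro h
  have h1 := hf.homogeneous 0 h 2 two_pos
  have h2 := hf.pos 0 h
  rw [smul_zero] at h1
  linarith

lemma const_pos (hf : IsAdmissibleCurvatureFunction Γ f) {m : ℝ} (hm : (fun _ => m) ∈ Γ) :
    0 < m := by
  by_contra h
  push Not at h
  rcases h.eq_or_lt with h | h
  · exact hf.zero_notMem (by rw [h] at hm; exact hm)
  -- A negative constant vector rescales to (−1,…,−1), whose midpoint with (1,…,1) is the excluded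
  -- origin.
  · have h1 := hf.smul_mem _ hm (-m)⁻¹ (by rw [inv_pos]; linarith)
    have h2 := hf.convex_cone h1 hf.one_mem (a := 1 / 2) (b := 1 / 2) (by norm_num) (by norm_num)
      (by norm_num)
    refine hf.zero_notMem ?_
    convert h2 using 1
    ext i
    have : m ≠ 0 := h.ne
    simp
    field_simp
    norm_num

lemma const_mem (hf : IsAdmissibleCurvatureFunction Γ f) {m : ℝ} (hm : 0 < m) :
    (fun _ => m) ∈ Γ := by
  simpa [Pi.smul_def] using hf.smul_mem _ hf.one_mem m hm

lemma apply_const (hf : IsAdmissibleCurvatureFunction Γ f) {m : ℝ} (hm : 0 < m) :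
    f (fun _ => m) = m * n := by
  have := hf.homogeneous _ hf.one_mem m hm
  rw [hf.normalized] at this
  rw [← this]
  simp [Pi.smul_def]

/-- Averaging all entries is doubly stochastic, and f is normalized on constant vectors. This is F ≤
H; it bounds κ_max from below by F/n and turns upper curvature bounds into lower ones. -/
lemma le_sum (hf : IsAdmissibleCurvatureFunction Γ f) (hn : 0 < n) {κ : Fin n → ℝ} (hκ : κ ∈ Γ) :
    f κ ≤ ∑ i, κ i := by
  have hn' : (n : ℝ) ≠ 0 := by positivity
  have hS : (Matrix.of fun _ _ => (n : ℝ)⁻¹) ∈ doublyStochastic ℝ (Fin n) := by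
    rw [mem_doublyStochastic_iff_sum]
    refine ⟨fun _ _ => by simp, fun _ => ?_, fun _ => ?_⟩ <;> simp [hn']
  obtain ⟨h1, h2⟩ := hf.mulVec_doublyStochastic hS hκ
  have h3 : (Matrix.of fun _ _ : Fin n => (n : ℝ)⁻¹).mulVec κ = fun _ => (n : ℝ)⁻¹ * ∑ i, κ i := by
    ext i
    simp [Matrix.mulVec, dotProduct, Finset.mul_sum]
  rw [h3] at h1 h2
  rw [hf.apply_const (hf.const_pos h1)] at h2
  convert h2 using 1
  field_simp

end IsAdmissibleCurvatureFunction

/-! ### Symmetric forms on a hyperplane and their eigenvalues. -/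

section Frames

variable {n : ℕ} {E : Type*} [NormedAddCommGroup E] [InnerProductSpace ℝ E]

lemma eq_sum_inner_of_orthonormal [FiniteDimensional ℝ E] (hE : Module.finrank ℝ E = n + 1)
    {e : Fin n → E} (he : Orthonormal ℝ e) {p : E →L[ℝ] ℝ} (hp : p ≠ 0) (hpe : ∀ i, p (e i) = 0)
    {v : E} (hv : p v = 0) : v = ∑ i, ⟪e i, v⟫ • e i := by
  have hker : Module.finrank ℝ (LinearMap.ker p.toLinearMap) = n := by
    have h1 := p.toLinearMap.finrank_range_add_finrank_ker
    have h2 : LinearMap.range p.toLinearMap = ⊤ := by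
      refine LinearMap.range_eq_top.2 (LinearMap.surjective ?_)
      intro h
      exact hp (ContinuousLinearMap.coe_injective h)
    rw [h2, finrank_top, hE] at h1
    simp at h1
    omega
  have hle : Submodule.span ℝ (Set.range e) ≤ LinearMap.ker p.toLinearMap := by
    rw [Submodule.span_le]
    rintro _ ⟨i, rfl⟩
    exact hpe i
  have heq : Submodule.span ℝ (Set.range e) = LinearMap.ker p.toLinearMap := by
    refine Submodule.eq_of_le_of_finrank_eq hle ?_
    rw [hker, finrank_span_eq_card he.linearIndependent, Fintype.card_fin]
  have hv' : v ∈ Submodule.span ℝ (Set.range e) := by rw [heq]; exact hv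
  obtain ⟨c, rfl⟩ := (Submodule.mem_span_range_iff_exists_fun ℝ).1 hv'
  refine Finset.sum_congr rfl fun i _ => ?_
  rw [he.inner_right_fintype]

lemma sum_sq_inner_of_orthonormal [FiniteDimensional ℝ E] (hE : Module.finrank ℝ E = n + 1)
    {e : Fin n → E} (he : Orthonormal ℝ e) {p : E →L[ℝ] ℝ} (hp : p ≠ 0) (hpe : ∀ i, p (e i) = 0)
    {v : E} (hv : p v = 0) : ∑ i, ⟪e i, v⟫ ^ 2 = ‖v‖ ^ 2 := by
  have h := eq_sum_inner_of_orthonormal hE he hp hpe hv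
  rw [← real_inner_self_eq_norm_sq]
  conv_rhs => rw [h]
  rw [sum_inner]
  refine Finset.sum_congr rfl fun i _ => ?_
  rw [real_inner_smul_left, ← h, sq]

/-- `e` is an orthonormal basis of the kernel of `p` which diagonalizes the bilinear form `B` with
eigenvalues `κ`. -/
structure IsEigenframe (p : E →L[ℝ] ℝ) (B : E →L[ℝ] E →L[ℝ] ℝ) (κ : Fin n → ℝ) (e : Fin n → E) :
    Prop where
  orthonormal : Orthonormal ℝ e
  tangent : ∀ i, p (e i) = 0
  diagonal : ∀ i j, B (e i) (e j) = if i = j then κ i else 0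

lemma IsEigenframe.apply [FiniteDimensional ℝ E] (hE : Module.finrank ℝ E = n + 1)
    {p : E →L[ℝ] ℝ} {B : E →L[ℝ] E →L[ℝ] ℝ} {κ : Fin n → ℝ} {e : Fin n → E}
    (h : IsEigenframe p B κ e) (hp : p ≠ 0) {v w : E} (hv : p v = 0) (hw : p w = 0) :
    B v w = ∑ i, κ i * (⟪e i, v⟫ * ⟪e i, w⟫) := by
  conv_lhs => rw [eq_sum_inner_of_orthonormal hE h.orthonormal hp h.tangent hv,
    eq_sum_inner_of_orthonormal hE h.orthonormal hp h.tangent hw]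
  simp only [map_sum, map_smul, FunLike.coe_sum, Finset.sum_apply,
    smul_apply, smul_eq_mul, h.diagonal]
  simp only [mul_ite, mul_zero, Finset.sum_ite_eq', Finset.mem_univ, if_true]
  refine Finset.sum_congr rfl fun i _ => by ring

/-- Schur's observation: the diagonal of B in another orthonormal frame is the image of the
eigenvalues under the doubly stochastic matrix ⟪eⱼ, e'ᵢ⟫². Thus curvature functions can be estimated
in frames that do not diagonalize B. -/
lemma IsEigenframe.map_diag [FiniteDimensional ℝ E] (hE : Module.finrank ℝ E = n + 1)
    {Γ : Set (Fin n → ℝ)} {f : (Fin n → ℝ) → ℝ} (hf : IsAdmissibleCurvatureFunction Γ f)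
    {p : E →L[ℝ] ℝ} {B : E →L[ℝ] E →L[ℝ] ℝ} {κ : Fin n → ℝ} {e e' : Fin n → E}
    (h : IsEigenframe p B κ e) (hp : p ≠ 0) (hκ : κ ∈ Γ) (he' : Orthonormal ℝ e')
    (hpe' : ∀ i, p (e' i) = 0) :
    (fun i => B (e' i) (e' i)) ∈ Γ ∧ f κ ≤ f (fun i => B (e' i) (e' i)) := by
  have hS : (Matrix.of fun i j => ⟪e j, e' i⟫ ^ 2) ∈ doublyStochastic ℝ (Fin n) := by
    rw [mem_doublyStochastic_iff_sum]
    refine ⟨fun _ _ => sq_nonneg _, fun i => ?_, fun j => ?_⟩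
    · simp only [Matrix.of_apply]
      rw [sum_sq_inner_of_orthonormal hE h.orthonormal hp h.tangent (hpe' i), he'.1 i, one_pow]
    · simp only [Matrix.of_apply]
      rw [Finset.sum_congr rfl fun i _ => by rw [real_inner_comm],
        sum_sq_inner_of_orthonormal hE he' hp hpe' (h.tangent j), h.orthonormal.1 j, one_pow]
  have h2 : (Matrix.of fun i j => ⟪e j, e' i⟫ ^ 2).mulVec κ = fun i => B (e' i) (e' i) := by
    ext i
    rw [h.apply hE hp (hpe' i) (hpe' i)]
    simp only [Matrix.mulVec, dotProduct, Matrix.of_apply]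
    refine Finset.sum_congr rfl fun i _ => by ring
  rw [← h2]
  exact hf.mulVec_doublyStochastic hS hκ

/-- Monotonicity of the curvature function with respect to the order of bilinear forms. -/
lemma IsEigenframe.mono [FiniteDimensional ℝ E] (hE : Module.finrank ℝ E = n + 1)
    {Γ : Set (Fin n → ℝ)} {f : (Fin n → ℝ) → ℝ} (hf : IsAdmissibleCurvatureFunction Γ f)
    {p : E →L[ℝ] ℝ} {B B' : E →L[ℝ] E →L[ℝ] ℝ} {κ κ' : Fin n → ℝ} {e e' : Fin n → E}
    (h : IsEigenframe p B κ e) (h' : IsEigenframe p B' κ' e') (hp : p ≠ 0) (hκ : κ ∈ Γ)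
    (hκ' : κ' ∈ Γ) (hB : ∀ v, p v = 0 → B v v ≤ B' v v) : f κ ≤ f κ' := by
  obtain ⟨h1, h2⟩ := h.map_diag hE hf hp hκ h'.orthonormal h'.tangent
  refine h2.trans (hf.mono h1 hκ' fun i => ?_)
  have := hB _ (h'.tangent i)
  rwa [h'.diagonal i i, if_pos rfl] at this

lemma IsEigenframe.smul {p : E →L[ℝ] ℝ} {B : E →L[ℝ] E →L[ℝ] ℝ} {κ : Fin n → ℝ} {e : Fin n → E}
    (h : IsEigenframe p B κ e) (a b : ℝ) : IsEigenframe (a • p) (b • B) (b • κ) e where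
  orthonormal := h.orthonormal
  tangent i := by simp [h.tangent i]
  diagonal i j := by simp [h.diagonal i j]

end Frames

/-! ### Second order expansions in one variable. -/

section Jets

open Filter Topology Asymptotics

/-- `g s = a + b s + c s² + o(s²)` as `s → 0`. -/
def HasJet (g : ℝ → ℝ) (a b c : ℝ) : Prop :=
  (fun s => g s - (a + b * s + c * s ^ 2)) =o[𝓝 0] fun s : ℝ => s ^ 2

namespace HasJet

variable {g h : ℝ → ℝ} {a b c a' b' c' : ℝ}

lemma isBigO_one_of_tendsto {g : ℝ → ℝ} {a : ℝ} (h : Tendsto g (𝓝 0) (𝓝 a)) :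
    g =O[𝓝 0] fun _ : ℝ => (1 : ℝ) := h.isBigO_one ℝ

lemma const (a : ℝ) : HasJet (fun _ => a) a 0 0 := by
  simp [HasJet]

lemma id : HasJet (fun s => s) 0 1 0 := by
  simp [HasJet]

lemma congr (hg : HasJet g a b c) (ha : a = a') (hb : b = b') (hc : c = c') :
    HasJet g a' b' c' := by
  subst ha hb hc; exact hg

lemma congr_fun (hg : HasJet g a b c) (hgh : ∀ s, h s = g s) : HasJet h a b c := by
  rwa [funext hgh]

lemma add (hg : HasJet g a b c) (hh : HasJet h a' b' c') :
    HasJet (fun s => g s + h s) (a + a') (b + b') (c + c') := by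
  refine (IsLittleO.add hg hh).congr_left fun s => ?_
  ring

lemma const_mul (r : ℝ) (hg : HasJet g a b c) :
    HasJet (fun s => r * g s) (r * a) (r * b) (r * c) := by
  refine (IsLittleO.const_mul_left hg r).congr_left fun s => ?_
  ring

lemma sub (hg : HasJet g a b c) (hh : HasJet h a' b' c') :
    HasJet (fun s => g s - h s) (a - a') (b - b') (c - c') := by
  refine (IsLittleO.sub hg hh).congr_left fun s => ?_
  ring

lemma sum {ι : Type*} (S : Finset ι) {g : ι → ℝ → ℝ} {a b c : ι → ℝ}
    (hg : ∀ i ∈ S, HasJet (g i) (a i) (b i) (c i)) :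
    HasJet (fun s => ∑ i ∈ S, g i s) (∑ i ∈ S, a i) (∑ i ∈ S, b i) (∑ i ∈ S, c i) := by
  refine (IsLittleO.fun_sum hg).congr_left fun s => ?_
  simp only [Finset.sum_sub_distrib, Finset.sum_add_distrib, Finset.sum_mul]

lemma apply_zero (hg : HasJet g a b c) : g 0 = a := by
  have h1 := IsLittleO.isBigO hg
  have h2 := h1.eq_zero_imp.self_of_nhds
  simp only [ne_eq, OfNat.ofNat_ne_zero, not_false_eq_true, zero_pow, mul_zero, add_zero,
    forall_const] at h2
  linarith

lemma hasDerivAt (hg : HasJet g a b c) : HasDerivAt g b 0 := by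
  rw [hasDerivAt_iff_isLittleO]
  have h1 : (fun s : ℝ => s ^ 2) =o[𝓝 0] fun s : ℝ => s := by
    simpa using isLittleO_pow_id (𝕜 := ℝ) (n := 2) (by norm_num)
  have h2 : (fun s => g s - (a + b * s + c * s ^ 2)) =o[𝓝 0] fun s : ℝ => s := hg.trans h1
  simp only [sub_zero]
  refine (h2.add (h1.const_mul_left c)).congr_left fun s => ?_
  rw [hg.apply_zero, smul_eq_mul]; ring

lemma tendsto (hg : HasJet g a b c) : Tendsto g (𝓝 0) (𝓝 a) := by
  have := hg.hasDerivAt.continuousAt.tendsto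
  rwa [hg.apply_zero] at this

lemma mul (hg : HasJet g a b c) (hh : HasJet h a' b' c') :
    HasJet (fun s => g s * h s) (a * a') (a * b' + b * a') (a * c' + b * b' + c * a') := by
  have h1 := IsLittleO.mul_isBigO hg (isBigO_one_of_tendsto hh.tendsto)
  have hp : Tendsto (fun s : ℝ => a + b * s + c * s ^ 2) (𝓝 0) (𝓝 (a + b * 0 + c * 0 ^ 2)) := by
    apply Continuous.tendsto; fun_prop
  have h2 := IsBigO.mul_isLittleO (isBigO_one_of_tendsto hp) hh
  have h3 : (fun s : ℝ => s ^ 3) =o[𝓝 0] fun s : ℝ => s ^ 2 :=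
    isLittleO_pow_pow (by norm_num)
  have hq : Tendsto (fun s : ℝ => b * c' + c * b' + c * c' * s) (𝓝 0)
      (𝓝 (b * c' + c * b' + c * c' * 0)) := by
    apply Continuous.tendsto; fun_prop
  have h4 := IsBigO.mul_isLittleO (isBigO_one_of_tendsto hq) h3
  simp only [one_mul, mul_one] at h1 h2 h4
  refine ((h1.add h2).add h4).congr_left fun s => ?_
  ring

lemma congr_of_isLittleO (hg : HasJet g a b c)
    (hh : (fun s => h s - g s) =o[𝓝 0] fun s : ℝ => s ^ 2) : HasJet h a b c := by
  refine (IsLittleO.add hh hg).congr_left fun s => ?_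
  ring

lemma isLittleO (hg : HasJet g 0 0 0) : g =o[𝓝 0] fun s : ℝ => s ^ 2 := by
  simpa [HasJet] using hg

/-- The second derivative test, as a necessary condition. -/
lemma of_nonneg (hg : HasJet g 0 b c) (h : ∀ᶠ s in 𝓝 0, 0 ≤ g s) : b = 0 ∧ 0 ≤ c := by
  have h0 := hg.apply_zero
  have hb : b = 0 := by
    refine IsLocalMin.hasDerivAt_eq_zero (f := g) (a := 0) ?_ hg.hasDerivAt
    filter_upwards [h] with s hs
    rwa [h0]
  refine ⟨hb, ?_⟩
  by_contra hc
  push Not at hc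
  have h1 := (IsLittleO.def hg (c := -c / 2) (by linarith)).and h
  have h2 : ∃ᶠ s : ℝ in 𝓝 0, s ≠ 0 :=
    (frequently_mem_iff_neBot (s := {0}ᶜ)).2 (inferInstanceAs (NeBot (𝓝[≠] (0 : ℝ))))
  obtain ⟨s, hs, h3, h4⟩ := (h2.and_eventually h1).exists
  have hs2 : 0 < s ^ 2 := by positivity
  rw [hb] at h3
  simp only [Real.norm_eq_abs, abs_of_pos hs2] at h3
  have := le_abs_self (g s - (0 + 0 * s + c * s ^ 2))
  nlinarith

/-- Taylor's formula of order two. -/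
lemma of_hasDerivAt {g g' : ℝ → ℝ} {c : ℝ} (hg : ∀ᶠ s in 𝓝 0, HasDerivAt g (g' s) s)
    (hg' : HasDerivAt g' c 0) : HasJet g (g 0) (g' 0) (c / 2) := by
  rw [HasJet, isLittleO_iff]
  intro ε hε
  rw [hasDerivAt_iff_isLittleO] at hg'
  have h1 := hg.and (hg'.def hε)
  obtain ⟨δ, hδ, h2⟩ := Metric.eventually_nhds_iff_ball.1 h1
  filter_upwards [Metric.ball_mem_nhds (0 : ℝ) hδ] with s hs
  have hs' : |s| < δ := by simpa using hs
  -- Mean value inequality for the remainder on the ball of radius |s|: its derivative there is at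
  -- most ε|s|.
  have hd : ∀ r ∈ Metric.closedBall (0 : ℝ) |s|, HasDerivWithinAt
      (fun s => g s - (g 0 + g' 0 * s + c / 2 * s ^ 2)) (g' r - (g' 0 + c * r))
      (Metric.closedBall (0 : ℝ) |s|) r := by
    intro r hr
    have hr' : r ∈ Metric.ball (0 : ℝ) δ := Metric.closedBall_subset_ball hs' hr
    have := ((h2 r hr').1.sub ((((hasDerivAt_id r).const_mul (g' 0)).const_add (g 0)).add
      ((hasDerivAt_pow 2 r).const_mul (c / 2)))).hasDerivWithinAt
      (s := Metric.closedBall (0 : ℝ) |s|)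
    refine HasDerivWithinAt.congr_deriv this ?_
    simp only [mul_one, Nat.cast_ofNat, Nat.add_one_sub_one, pow_one]
    ring
  have hb : ∀ r ∈ Metric.closedBall (0 : ℝ) |s|, ‖g' r - (g' 0 + c * r)‖ ≤ ε * |s| := by
    intro r hr
    have hr' : r ∈ Metric.ball (0 : ℝ) δ := Metric.closedBall_subset_ball hs' hr
    have h3 := (h2 r hr').2
    have hr2 : |r| ≤ |s| := by simpa using hr
    simp only [sub_zero, smul_eq_mul, Real.norm_eq_abs] at h3
    rw [Real.norm_eq_abs]
    calc |g' r - (g' 0 + c * r)| = |g' r - g' 0 - r * c| := by ring_nf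
      _ ≤ ε * |r| := h3
      _ ≤ ε * |s| := by gcongr
  have := (convex_closedBall (0 : ℝ) |s|).norm_image_sub_le_of_norm_hasDerivWithin_le hd hb
    (x := 0) (y := s) (by simp) (by simp)
  simp only [mul_zero, add_zero, ne_eq, OfNat.ofNat_ne_zero, not_false_eq_true, zero_pow, sub_self,
    sub_zero, Real.norm_eq_abs] at this
  rw [Real.norm_eq_abs, Real.norm_eq_abs, abs_pow]
  linarith

end HasJet

/-- The directional derivative of `u` in the direction `v`. -/
noncomputable def dirDeriv {V : Type*} [NormedAddCommGroup V] [NormedSpace ℝ V] (v : V) (u : V → ℝ) :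
    V → ℝ := fun p => fderiv ℝ u p v

section DirDeriv

variable {V : Type*} [NormedAddCommGroup V] [NormedSpace ℝ V] {Ω : Set V} {u : V → ℝ}

lemma ContDiffOn.dirDeriv (hu : ContDiffOn ℝ ∞ u Ω) (hΩ : IsOpen Ω) (v : V) :
    ContDiffOn ℝ ∞ (dirDeriv v u) Ω :=
  (hu.fderiv_of_isOpen hΩ (by simp)).clm_apply contDiffOn_const

lemma dirDeriv_congr (hΩ : IsOpen Ω) {u' : V → ℝ} (h : Set.EqOn u u' Ω) (v : V) :
    Set.EqOn (dirDeriv v u) (dirDeriv v u') Ω := by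
  intro p hp
  have : u =ᶠ[𝓝 p] u' := h.eventuallyEq_of_mem (hΩ.mem_nhds hp)
  simp only [dirDeriv, this.fderiv_eq]

lemma dirDeriv_comm (hu : ContDiffOn ℝ ∞ u Ω) (hΩ : IsOpen Ω) (v w : V) :
    Set.EqOn (dirDeriv v (dirDeriv w u)) (dirDeriv w (dirDeriv v u)) Ω := by
  intro p hp
  have hc : ContDiffAt ℝ ∞ u p := hu.contDiffAt (hΩ.mem_nhds hp)
  have hd : DifferentiableAt ℝ (fderiv ℝ u) p :=
    ((hu.fderiv_of_isOpen (m := ∞) hΩ (by simp)).contDiffAt (hΩ.mem_nhds hp)).differentiableAt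
      (by simp)
  have hs := hc.isSymmSndFDerivAt (by simp; exact WithTop.coe_le_coe.2 le_top)
  have key : ∀ v w : V, dirDeriv v (dirDeriv w u) p = fderiv ℝ (fderiv ℝ u) p v w := by
    intro v w
    have : HasFDerivAt (dirDeriv w u) _ p := hd.hasFDerivAt.clm_apply (hasFDerivAt_const w p)
    simp [dirDeriv, this.fderiv]
  rw [key, key, hs.eq]

lemma hasJet_line (hu : ContDiffOn ℝ ∞ u Ω) (hΩ : IsOpen Ω) {p : V} (hp : p ∈ Ω) (v : V) :
    HasJet (fun s => u (p + s • v)) (u p) (dirDeriv v u p) (dirDeriv v (dirDeriv v u) p / 2) := by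
  have hline : ∀ s : ℝ, HasDerivAt (fun s : ℝ => p + s • v) v s := fun s => by
    simpa using ((hasDerivAt_id s).smul_const v).const_add p
  have hmem : ∀ᶠ s : ℝ in 𝓝 0, p + s • v ∈ Ω := by
    have : ContinuousAt (fun s : ℝ => p + s • v) 0 := (hline 0).continuousAt
    exact this.eventually_mem (by simpa using hΩ.mem_nhds hp)
  have key : ∀ w : V → ℝ, ContDiffOn ℝ ∞ w Ω → ∀ s : ℝ, p + s • v ∈ Ω →
      HasDerivAt (fun s : ℝ => w (p + s • v)) (dirDeriv v w (p + s • v)) s := by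
    intro w hw s hs
    have h1 : DifferentiableAt ℝ w (p + s • v) :=
      (hw.contDiffAt (hΩ.mem_nhds hs)).differentiableAt (by simp)
    exact h1.hasFDerivAt.comp_hasDerivAt s (hline s)
  have h := HasJet.of_hasDerivAt (g := fun s => u (p + s • v))
    (g' := fun s => dirDeriv v u (p + s • v)) (c := dirDeriv v (dirDeriv v u) p)
    (by filter_upwards [hmem] with s hs using key u hu s hs)
    (by simpa using key _ (hu.dirDeriv hΩ v) 0 (by simpa using hp))
  simpa using h

end DirDeriv

end Jets

/-! ### Functions homogeneous of degree one. -/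

section Gauge

open Filter Topology

variable {E : Type*} [NormedAddCommGroup E] [InnerProductSpace ℝ E]

/-- A positive function on `E ∖ {0}`, smooth and homogeneous of degree one. -/
structure IsGauge (g : E → ℝ) : Prop where
  pos : ∀ z, z ≠ 0 → 0 < g z
  homogeneous : ∀ z, z ≠ 0 → ∀ l : ℝ, 0 < l → g (l • z) = l * g z
  smooth : ContDiffOn ℝ ∞ g {0}ᶜ

namespace IsGauge

variable {g g' : E → ℝ} {z : E}

lemma contDiffAt (hg : IsGauge g) (hz : z ≠ 0) : ContDiffAt ℝ ∞ g z :=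
  hg.smooth.contDiffAt (isOpen_compl_singleton.mem_nhds hz)

lemma differentiableAt (hg : IsGauge g) (hz : z ≠ 0) : DifferentiableAt ℝ g z :=
  (hg.contDiffAt hz).differentiableAt (by simp)

lemma contDiffOn_fderiv (hg : IsGauge g) : ContDiffOn ℝ ∞ (fderiv ℝ g) {0}ᶜ :=
  hg.smooth.fderiv_of_isOpen isOpen_compl_singleton (by simp)

lemma differentiableAt_fderiv (hg : IsGauge g) (hz : z ≠ 0) : DifferentiableAt ℝ (fderiv ℝ g) z :=
  (hg.contDiffOn_fderiv.contDiffAt (isOpen_compl_singleton.mem_nhds hz)).differentiableAt (by simp)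

lemma symm (hg : IsGauge g) (hz : z ≠ 0) (v w : E) :
    fderiv ℝ (fderiv ℝ g) z v w = fderiv ℝ (fderiv ℝ g) z w v :=
  ((hg.contDiffAt hz).isSymmSndFDerivAt (by simp; exact WithTop.coe_le_coe.2 le_top)).eq v w

lemma fderiv_smul (hg : IsGauge g) (hz : z ≠ 0) {l : ℝ} (hl : 0 < l) :
    fderiv ℝ g (l • z) = fderiv ℝ g z := by
  have h1 : (fun y => g (l • y)) =ᶠ[𝓝 z] fun y => l * g y := by
    filter_upwards [isOpen_compl_singleton.mem_nhds hz] with y hy using hg.homogeneous y hy l hl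
  have h2 := h1.fderiv_eq (𝕜 := ℝ)
  rw [fderiv_comp_smul, fderiv_const_mul (hg.differentiableAt hz)] at h2
  exact smul_right_injective _ hl.ne' h2

lemma fderiv_fderiv_smul (hg : IsGauge g) (hz : z ≠ 0) {l : ℝ} (hl : 0 < l) :
    fderiv ℝ (fderiv ℝ g) (l • z) = l⁻¹ • fderiv ℝ (fderiv ℝ g) z := by
  have h1 : (fun y => fderiv ℝ g (l • y)) =ᶠ[𝓝 z] fun y => fderiv ℝ g y := by
    filter_upwards [isOpen_compl_singleton.mem_nhds hz] with y hy using hg.fderiv_smul hy hl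
  have h2 := h1.fderiv_eq (𝕜 := ℝ)
  rw [fderiv_comp_smul] at h2
  rw [← h2, smul_smul, inv_mul_cancel₀ hl.ne', one_smul]

lemma hasDerivAt_ray (z : E) : HasDerivAt (fun l : ℝ => l • z) z 1 := by
  simpa using (hasDerivAt_id (1 : ℝ)).smul_const z

lemma fderiv_self (hg : IsGauge g) (hz : z ≠ 0) : fderiv ℝ g z z = g z := by
  have h2 : HasDerivAt (fun l : ℝ => g (l • z)) (fderiv ℝ g z z) 1 :=
    HasFDerivAt.comp_hasDerivAt (1 : ℝ) (by simpa using (hg.differentiableAt hz).hasFDerivAt)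
      (hasDerivAt_ray z)
  have h3 : HasDerivAt (fun l : ℝ => l * g z) (g z) 1 := by
    simpa using (hasDerivAt_id (1 : ℝ)).mul_const (g z)
  refine h2.unique (h3.congr_of_eventuallyEq ?_)
  filter_upwards [lt_mem_nhds (zero_lt_one' ℝ)] with l hl using hg.homogeneous z hz l hl

lemma fderiv_ne_zero (hg : IsGauge g) (hz : z ≠ 0) : fderiv ℝ g z ≠ 0 := by
  intro h
  have h1 := hg.fderiv_self hz
  have h2 := hg.pos z hz
  rw [h, zero_apply] at h1
  linarith

/-- Dg is constant along rays. Hence D²g is determined by its restriction to ker Dg, the tangent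
space of the level set. -/
lemma fderiv_fderiv_self (hg : IsGauge g) (hz : z ≠ 0) (v : E) :
    fderiv ℝ (fderiv ℝ g) z z v = 0 := by
  have h2 : HasDerivAt (fun l : ℝ => fderiv ℝ g (l • z)) (fderiv ℝ (fderiv ℝ g) z z) 1 :=
    HasFDerivAt.comp_hasDerivAt (1 : ℝ) (by simpa using (hg.differentiableAt_fderiv hz).hasFDerivAt)
      (hasDerivAt_ray z)
  have h3 : HasDerivAt (fun l : ℝ => fderiv ℝ g (l • z)) 0 1 := by
    refine (hasDerivAt_const (1 : ℝ) (fderiv ℝ g z)).congr_of_eventuallyEq ?_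
    filter_upwards [lt_mem_nhds (zero_lt_one' ℝ)] with l hl using hg.fderiv_smul hz hl
  rw [h2.unique h3]
  simp

lemma fderiv_fderiv_self' (hg : IsGauge g) (hz : z ≠ 0) (v : E) :
    fderiv ℝ (fderiv ℝ g) z v z = 0 := by
  rw [hg.symm hz, hg.fderiv_fderiv_self hz]

lemma const_mul (hg : IsGauge g) {μ : ℝ} (hμ : 0 < μ) : IsGauge fun y => μ * g y where
  pos y hy := mul_pos hμ (hg.pos y hy)
  homogeneous y hy l hl := by rw [hg.homogeneous y hy l hl]; ring
  smooth := contDiffOn_const.mul hg.smooth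

lemma fderiv_const_mul (hg : IsGauge g) (hz : z ≠ 0) (μ : ℝ) :
    fderiv ℝ (fun y => μ * g y) z = μ • fderiv ℝ g z :=
  _root_.fderiv_const_mul (hg.differentiableAt hz) μ

lemma fderiv_fderiv_const_mul (hg : IsGauge g) (hz : z ≠ 0) (μ : ℝ) :
    fderiv ℝ (fderiv ℝ (fun y => μ * g y)) z = μ • fderiv ℝ (fderiv ℝ g) z := by
  have h1 : fderiv ℝ (fun y => μ * g y) =ᶠ[𝓝 z] fun y => μ • fderiv ℝ g y := by
    filter_upwards [isOpen_compl_singleton.mem_nhds hz] with y hy using hg.fderiv_const_mul hy μ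
  rw [h1.fderiv_eq]
  exact fderiv_fun_const_smul (hg.differentiableAt_fderiv hz) μ

lemma dirDeriv_dirDeriv (hg : IsGauge g) (hz : z ≠ 0) (v w : E) :
    dirDeriv v (dirDeriv w g) z = fderiv ℝ (fderiv ℝ g) z v w := by
  have : HasFDerivAt (dirDeriv w g) _ z :=
    (hg.differentiableAt_fderiv hz).hasFDerivAt.clm_apply (hasFDerivAt_const w z)
  simp [dirDeriv, this.fderiv]

lemma hasJet (hg : IsGauge g) (hz : z ≠ 0) (v : E) : HasJet (fun s => g (z + s • v)) (g z)
    (fderiv ℝ g z v) (fderiv ℝ (fderiv ℝ g) z v v / 2) := by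
  rw [← hg.dirDeriv_dirDeriv hz]
  exact hasJet_line hg.smooth isOpen_compl_singleton hz v

/-- First and second order conditions where a gauge touches another one from below. -/
lemma fderiv_of_touching (hg : IsGauge g) (hg' : IsGauge g') (hz : z ≠ 0)
    (hle : ∀ y, y ≠ 0 → g y ≤ g' y) (heq : g z = g' z) :
    fderiv ℝ g z = fderiv ℝ g' z ∧
      ∀ v, fderiv ℝ (fderiv ℝ g) z v v ≤ fderiv ℝ (fderiv ℝ g') z v v := by
  -- On each line through z the difference g' − g is nonnegative near z and vanishes at z.
  have key : ∀ v, fderiv ℝ g' z v - fderiv ℝ g z v = 0 ∧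
      0 ≤ fderiv ℝ (fderiv ℝ g') z v v / 2 - fderiv ℝ (fderiv ℝ g) z v v / 2 := by
    intro v
    refine (((hg'.hasJet hz v).sub (hg.hasJet hz v)).congr (by rw [heq, sub_self]) rfl
      rfl).of_nonneg ?_
    have hc : ContinuousAt (fun s : ℝ => z + s • v) 0 := by fun_prop
    filter_upwards [hc.eventually_ne (by simpa using hz)] with s hs
    exact sub_nonneg.2 (hle _ hs)
  refine ⟨?_, fun v => by linarith [(key v).2]⟩
  ext v
  linarith [(key v).1]

lemma comp_isometry (hg : IsGauge g) (R : E ≃ₗᵢ[ℝ] E) : IsGauge fun y => g (R y) where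
  pos y hy := hg.pos _ (by simpa using hy)
  homogeneous y hy l hl := by
    simpa using hg.homogeneous (R y) (by simpa using hy) l hl
  smooth := hg.smooth.comp R.contDiff.contDiffOn fun y hy => by simpa using hy

lemma fderiv_comp_isometry (g : E → ℝ) (R : E ≃ₗᵢ[ℝ] E) (y : E) :
    fderiv ℝ (fun y => g (R y)) y =
      (fderiv ℝ g (R y)).comp (R.toContinuousLinearEquiv : E →L[ℝ] E) :=
  R.toContinuousLinearEquiv.comp_right_fderiv (f := g) (x := y)

lemma fderiv_fderiv_comp_isometry (hg : IsGauge g) (R : E ≃ₗᵢ[ℝ] E) (hz : z ≠ 0) (v w : E) :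
    fderiv ℝ (fderiv ℝ (fun y => g (R y))) z v w = fderiv ℝ (fderiv ℝ g) (R z) (R v) (R w) := by
  have hz' : R z ≠ 0 := by simpa using hz
  rw [← (hg.comp_isometry R).dirDeriv_dirDeriv hz]
  have h1 : dirDeriv w (fun y => g (R y)) = fun y => fderiv ℝ g (R y) (R w) := by
    ext y
    simp only [dirDeriv, fderiv_comp_isometry]
    rfl
  have h2 : HasFDerivAt (fun y => fderiv ℝ g (R y)) _ z :=
    (hg.differentiableAt_fderiv hz').hasFDerivAt.comp z
      (R.toContinuousLinearEquiv : E →L[ℝ] E).hasFDerivAt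
  rw [h1, dirDeriv, (h2.clm_apply (hasFDerivAt_const (R w) z)).fderiv]
  simp

end IsGauge

lemma hasFDerivAt_norm_of_ne {z : E} (hz : z ≠ 0) :
    HasFDerivAt (norm : E → ℝ) (‖z‖⁻¹ • innerSL ℝ z) z := by
  have h := (hasStrictFDerivAt_norm_sq z).hasFDerivAt.sqrt (by simpa using hz)
  refine (h.congr_of_eventuallyEq (Eventually.of_forall fun y => ?_)).congr_fderiv ?_
  · exact (Real.sqrt_sq (norm_nonneg y)).symm
  · ext v
    simp [Real.sqrt_sq (norm_nonneg z)]
    field_simp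

lemma fderiv_norm_of_ne {z : E} (hz : z ≠ 0) (v : E) :
    fderiv ℝ (norm : E → ℝ) z v = ‖z‖⁻¹ * ⟪z, v⟫ := by
  simp [(hasFDerivAt_norm_of_ne hz).fderiv]

lemma isGauge_norm : IsGauge (norm : E → ℝ) where
  pos z hz := norm_pos_iff.2 hz
  homogeneous z _ l hl := by rw [norm_smul, Real.norm_of_nonneg hl.le]
  smooth := fun _ hz => (contDiffAt_norm ℝ hz).contDiffWithinAt

lemma fderiv_fderiv_norm {z : E} (hz : z ≠ 0) (v w : E) :
    fderiv ℝ (fderiv ℝ (norm : E → ℝ)) z v w =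
      ‖z‖⁻¹ * ⟪v, w⟫ - ‖z‖⁻¹ ^ 3 * (⟪z, v⟫ * ⟪z, w⟫) := by
  have hn : ‖z‖ ≠ 0 := by simpa using hz
  rw [← isGauge_norm.dirDeriv_dirDeriv hz]
  have h1 : dirDeriv w (norm : E → ℝ) =ᶠ[𝓝 z] fun y => ‖y‖⁻¹ * ⟪y, w⟫ := by
    filter_upwards [isOpen_compl_singleton.mem_nhds hz] with y hy using fderiv_norm_of_ne hy w
  have h2 : HasFDerivAt (fun y : E => ⟪y, w⟫) (innerSL ℝ w) z := by
    refine ((innerSL ℝ w).hasFDerivAt (x := z)).congr_of_eventuallyEq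
      (Eventually.of_forall fun y => ?_)
    simp [real_inner_comm]
  have h3 := ((hasDerivAt_inv hn).comp_hasFDerivAt z (hasFDerivAt_norm_of_ne hz)).mul h2
  have h4 : fderiv ℝ (fun y : E => ‖y‖⁻¹ * ⟪y, w⟫) z = _ := h3.fderiv
  rw [dirDeriv, h1.fderiv_eq, h4]
  simp [real_inner_comm]
  field_simp
  ring

end Gauge

/-! ### The level set flow and its comparison principle. -/

section GaugeFlow

open Filter Topology Set

variable {n : ℕ} {E : Type*} [NormedAddCommGroup E] [InnerProductSpace ℝ E]
  {Γ : Set (Fin n → ℝ)} {f : (Fin n → ℝ) → ℝ}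

/-- The level set formulation of the flow: the hypersurfaces are the level sets `φ t = 1`. -/
structure IsGaugeFlow (Γ : Set (Fin n → ℝ)) (f : (Fin n → ℝ) → ℝ) (τ : ℝ) (φ : ℝ → E → ℝ) :
    Prop where
  gauge : ∀ t ∈ Ico 0 τ, IsGauge (φ t)
  continuousOn : ContinuousOn (fun p : ℝ × E => φ p.1 p.2) (Ico 0 τ ×ˢ {0}ᶜ)
  smooth : ContDiffOn ℝ ∞ (fun p : ℝ × E => φ p.1 p.2) (Ioo 0 τ ×ˢ {0}ᶜ)
  evolution : ∀ t ∈ Ioo 0 τ, ∀ z, z ≠ 0 → ∃ κ ∈ Γ, ∃ e : Fin n → E,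
    IsEigenframe (fderiv ℝ (φ t) z) (fderiv ℝ (fderiv ℝ (φ t)) z) κ e ∧
    deriv (fun s => φ s z) t = φ t z / n - ‖fderiv ℝ (φ t) z‖ ^ 2 / f κ

lemma nonneg_of_hasDerivAt_of_le_left {g : ℝ → ℝ} {g' t : ℝ} (hg : HasDerivAt g g' t)
    (h : ∀ᶠ s in 𝓝[<] t, g s ≤ g t) : 0 ≤ g' := by
  have h1 : Tendsto (slope g t) (𝓝[<] t) (𝓝 g') :=
    (hasDerivAt_iff_tendsto_slope.1 hg).mono_left (nhdsWithin_mono _ fun s hs => ne_of_lt hs)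
  refine ge_of_tendsto h1 ?_
  filter_upwards [h, self_mem_nhdsWithin] with s hs hst
  rw [slope_def_field]
  exact div_nonneg_of_nonpos (by linarith) (by linarith [mem_Iio.1 hst])

lemma nonneg_of_hasDerivAt_of_le_right {g : ℝ → ℝ} {g' t : ℝ} (hg : HasDerivAt g g' t)
    (h : ∀ᶠ s in 𝓝[>] t, g t ≤ g s) : 0 ≤ g' := by
  have h1 : Tendsto (slope g t) (𝓝[>] t) (𝓝 g') :=
    (hasDerivAt_iff_tendsto_slope.1 hg).mono_left (nhdsWithin_mono _ fun s hs => ne_of_gt hs)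
  refine ge_of_tendsto h1 ?_
  filter_upwards [h, self_mem_nhdsWithin] with s hs hst
  rw [slope_def_field]
  exact div_nonneg (by linarith) (by linarith [mem_Ioi.1 hst])

lemma IsGauge.ratio_le_of_sphere {g g' : E → ℝ} (hg : IsGauge g) (hg' : IsGauge g') {C : ℝ}
    (h : ∀ z ∈ Metric.sphere (0 : E) 1, g z ≤ C * g' z) {z : E} (hz : z ≠ 0) : g z ≤ C * g' z := by
  have hn : 0 < ‖z‖ := norm_pos_iff.2 hz
  have h1 : ‖z‖⁻¹ • z ∈ Metric.sphere (0 : E) 1 := by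
    simp [norm_smul, hn.ne']
  have h2 := h _ h1
  rw [hg.homogeneous z hz _ (inv_pos.2 hn), hg'.homogeneous z hz _ (inv_pos.2 hn)] at h2
  have h3 : ‖z‖⁻¹ * g z ≤ ‖z‖⁻¹ * (C * g' z) := by linarith
  exact le_of_mul_le_mul_left h3 (inv_pos.2 hn)

namespace IsGaugeFlow

variable {τ : ℝ} {φ φ' : ℝ → E → ℝ}

lemma hasDerivAt (h : IsGaugeFlow Γ f τ φ) {t : ℝ} (ht : t ∈ Ioo 0 τ) {z : E} (hz : z ≠ 0) :
    HasDerivAt (fun s => φ s z) (deriv (fun s => φ s z) t) t := by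
  have h1 : DifferentiableAt ℝ (fun p : ℝ × E => φ p.1 p.2) (t, z) :=
    (h.smooth.contDiffAt ((isOpen_Ioo.prod isOpen_compl_singleton).mem_nhds
      (show (t, z) ∈ Ioo 0 τ ×ˢ ({0}ᶜ : Set E) from ⟨ht, hz⟩))).differentiableAt (by simp)
  have h2 : DifferentiableAt ℝ (fun s : ℝ => (s, z)) t := by fun_prop
  exact (DifferentiableAt.comp t h1 h2).hasDerivAt

lemma continuousOn_time (h : IsGaugeFlow Γ f τ φ) {z : E} (hz : z ≠ 0) :
    ContinuousOn (fun s => φ s z) (Ico 0 τ) :=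
  h.continuousOn.comp (f := fun s : ℝ => (s, z)) (by fun_prop) fun _ hs => ⟨hs, hz⟩

/-- At a spatial maximum of the ratio of two solutions, it does not increase. -/
lemma deriv_le_of_touching [FiniteDimensional ℝ E] (hE : Module.finrank ℝ E = n + 1)
    (hf : IsAdmissibleCurvatureFunction Γ f) (h : IsGaugeFlow Γ f τ φ)
    (h' : IsGaugeFlow Γ f τ φ') {t : ℝ} (ht : t ∈ Ioo 0 τ) {z : E} (hz : z ≠ 0) {μ : ℝ}
    (hμ : 0 < μ) (hle : ∀ y, y ≠ 0 → φ t y ≤ μ * φ' t y) (heq : φ t z = μ * φ' t z) :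
    deriv (fun s => φ s z) t ≤ μ * deriv (fun s => φ' s z) t := by
  have ht' := Ioo_subset_Ico_self ht
  obtain ⟨κ, hκ, e, he, hd⟩ := h.evolution t ht z hz
  obtain ⟨κ', hκ', e', he', hd'⟩ := h'.evolution t ht z hz
  obtain ⟨hp, hB⟩ := (h.gauge t ht').fderiv_of_touching ((h'.gauge t ht').const_mul hμ) hz hle heq
  rw [(h'.gauge t ht').fderiv_const_mul hz] at hp
  rw [(h'.gauge t ht').fderiv_fderiv_const_mul hz] at hB
  have hκ'' : μ • κ' ∈ Γ := hf.smul_mem _ hκ' _ hμ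
  have he'' := he'.smul μ μ
  rw [← hp] at he''
  -- Both level sets have the same tangent space at z and their Hessians are ordered, so f κ ≤ μ f
  -- κ'. A larger curvature function means a larger −|Dφ|²/f.
  have hF := he.mono hE hf he'' ((h.gauge t ht').fderiv_ne_zero hz) hκ hκ'' fun v _ => hB v
  rw [hf.homogeneous _ hκ' _ hμ] at hF
  have hpos := hf.pos _ hκ
  have hpos' := hf.pos _ hκ'
  rw [hd, hd', hp, heq, norm_smul, Real.norm_of_nonneg hμ.le]
  have : (μ * ‖fderiv ℝ (φ' t) z‖) ^ 2 / (μ * f κ') ≤ (μ * ‖fderiv ℝ (φ' t) z‖) ^ 2 / f κ := by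
    gcongr
  have h3 : (μ * ‖fderiv ℝ (φ' t) z‖) ^ 2 / (μ * f κ') = μ * (‖fderiv ℝ (φ' t) z‖ ^ 2 / f κ') := by
    field_simp
  rw [h3] at this
  rw [mul_sub, mul_div_assoc]
  linarith

/-- The comparison principle. -/
theorem le_of_le [FiniteDimensional ℝ E] (hE : Module.finrank ℝ E = n + 1)
    (hf : IsAdmissibleCurvatureFunction Γ f) (h : IsGaugeFlow Γ f τ φ)
    (h' : IsGaugeFlow Γ f τ φ') {C : ℝ} (h0 : ∀ z, z ≠ 0 → φ 0 z ≤ C * φ' 0 z) {t : ℝ}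
    (ht : t ∈ Ico 0 τ) {z : E} (hz : z ≠ 0) : φ t z ≤ C * φ' t z := by
  refine (h.gauge t ht).ratio_le_of_sphere (h'.gauge t ht) (fun z hz => ?_) hz
  have hz0 : ∀ z ∈ Metric.sphere (0 : E) 1, z ≠ 0 := fun z hz => ne_zero_of_mem_unit_sphere ⟨z, hz⟩
  by_contra hlt
  push Not at hlt
  have hpos' : ∀ s ∈ Ico 0 τ, ∀ z ∈ Metric.sphere (0 : E) 1, 0 < φ' s z :=
    fun s hs z hz => (h'.gauge s hs).pos z (hz0 z hz)
  rw [← lt_div_iff₀ (hpos' t ht z hz)] at hlt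
  -- The term ε t makes the contradiction at the maximum strict; the factor t + 1 in the denominator
  -- covers t = 0.
  obtain ⟨ε, hε, hlt⟩ : ∃ ε > 0, C < φ t z / φ' t z - ε * t := by
    refine ⟨(φ t z / φ' t z - C) / (2 * (t + 1)), div_pos (by linarith) (by linarith [ht.1]), ?_⟩
    have ht0 := ht.1
    have : (φ t z / φ' t z - C) / (2 * (t + 1)) * t < φ t z / φ' t z - C := by
      rw [div_mul_eq_mul_div, div_lt_iff₀ (by linarith)]
      nlinarith
    linarith
  have hsub : Icc 0 t ×ˢ Metric.sphere (0 : E) 1 ⊆ Ico 0 τ ×ˢ ({0}ᶜ : Set E) :=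
    fun p hp => ⟨⟨hp.1.1, hp.1.2.trans_lt ht.2⟩, hz0 _ hp.2⟩
  have hcont : ContinuousOn (fun p : ℝ × E => φ p.1 p.2 / φ' p.1 p.2 - ε * p.1)
      (Icc 0 t ×ˢ Metric.sphere (0 : E) 1) := by
    refine ContinuousOn.sub (ContinuousOn.div (h.continuousOn.mono hsub)
      (h'.continuousOn.mono hsub) fun p hp => ?_) (by fun_prop)
    exact (hpos' _ (hsub hp).1 _ hp.2).ne'
  obtain ⟨⟨s, y⟩, ⟨hs, hy⟩, hmax⟩ := (isCompact_Icc.prod (isCompact_sphere (0 : E) 1)).exists_isMaxOn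
    ⟨(t, z), ⟨⟨ht.1, le_rfl⟩, hz⟩⟩ hcont
  simp only at hs hy
  have hy0 := hz0 y hy
  have hval : C < φ s y / φ' s y - ε * s := hlt.trans_le (hmax ⟨⟨ht.1, le_rfl⟩, hz⟩)
  have hs0 : 0 < s := by
    rcases hs.1.eq_or_lt with rfl | h1
    · have := h0 y hy0
      rw [mul_zero, sub_zero, lt_div_iff₀ (hpos' _ ⟨le_rfl, ht.1.trans_lt ht.2⟩ y hy)] at hval
      linarith
    · exact h1
  have hsτ : s ∈ Ioo 0 τ := ⟨hs0, hs.2.trans_lt ht.2⟩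
  have hsτ' := Ioo_subset_Ico_self hsτ
  set μ := φ s y / φ' s y with hμ
  have hμpos : 0 < μ := div_pos ((h.gauge s hsτ').pos y hy0) (hpos' s hsτ' y hy)
  have heq : φ s y = μ * φ' s y := by
    rw [hμ, div_mul_cancel₀ _ (hpos' s hsτ' y hy).ne']
  have hle : ∀ x, x ≠ 0 → φ s x ≤ μ * φ' s x := fun x hx => by
    refine (h.gauge s hsτ').ratio_le_of_sphere (h'.gauge s hsτ') (fun x hx => ?_) hx
    have h1 : φ s x / φ' s x - ε * s ≤ φ s y / φ' s y - ε * s :=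
      hmax (show (s, x) ∈ Icc 0 t ×ˢ Metric.sphere (0 : E) 1 from ⟨hs, hx⟩)
    rw [← div_le_iff₀ (hpos' s hsτ' x hx)]
    linarith
  have hder := h.deriv_le_of_touching hE hf h' hsτ hy0 hμpos hle heq
  -- Maximality at earlier times makes this function nonpositive for r < s, and it vanishes at r =
  -- s. Its derivative is therefore nonnegative, while `hder` makes it at most −ε φ'.
  have hq : HasDerivAt (fun r => φ r y - (μ + ε * (r - s)) * φ' r y) _ s :=
    (h.hasDerivAt hsτ hy0).sub
      (((((hasDerivAt_id s).sub_const s).const_mul ε).const_add μ).mul (h'.hasDerivAt hsτ hy0))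
  have h2 := nonneg_of_hasDerivAt_of_le_left hq ?_
  · have := mul_pos hε (hpos' s hsτ' y hy)
    simp only [id, sub_self, mul_zero, add_zero, mul_one] at h2
    linarith
  · filter_upwards [Ioo_mem_nhdsLT hs0] with r hr
    have hr' : r ∈ Icc 0 t := ⟨hr.1.le, hr.2.le.trans hs.2⟩
    have h1 : φ r y / φ' r y - ε * r ≤ φ s y / φ' s y - ε * s :=
      hmax (show (r, y) ∈ Icc 0 t ×ˢ Metric.sphere (0 : E) 1 from ⟨hr', hy⟩)
    have h3 : φ r y / φ' r y ≤ μ + ε * (r - s) := by linarith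
    rw [div_le_iff₀ (hpos' r ⟨hr'.1, hr'.2.trans_lt ht.2⟩ y hy)] at h3
    simp only [sub_self, mul_zero, add_zero]
    linarith

/-- A round sphere centered at the origin is stationary. -/
lemma isGaugeFlow_norm [FiniteDimensional ℝ E] (hE : Module.finrank ℝ E = n + 1) (hn : 0 < n)
    (hf : IsAdmissibleCurvatureFunction Γ f) (τ : ℝ) :
    IsGaugeFlow Γ f τ fun _ : ℝ => (norm : E → ℝ) where
  gauge _ _ := isGauge_norm
  continuousOn := by fun_prop
  smooth := isGauge_norm.smooth.comp contDiff_snd.contDiffOn fun p hp => hp.2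
  evolution t _ z hz := by
    have hz' : 0 < ‖z‖ := norm_pos_iff.2 hz
    have hdim : Module.finrank ℝ (ℝ ∙ z)ᗮ = n := by
      have : Fact (Module.finrank ℝ E = n + 1) := ⟨hE⟩
      exact Submodule.finrank_orthogonal_span_singleton hz
    let b := (stdOrthonormalBasis ℝ (ℝ ∙ z)ᗮ).reindex (finCongr hdim)
    have horth : ∀ i, ⟪z, (b i : E)⟫ = 0 := fun i =>
      Submodule.mem_orthogonal_singleton_iff_inner_right.1 (b i).2
    have hb : Orthonormal ℝ fun i => (b i : E) := b.orthonormal.comp_linearIsometry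
      (Submodule.subtypeₗᵢ _)
    have hm : 0 < ‖z‖⁻¹ := inv_pos.2 hz'
    refine ⟨fun _ => ‖z‖⁻¹, hf.const_mem hm, fun i => b i, ⟨hb, fun i => ?_, fun i j => ?_⟩, ?_⟩
    · rw [fderiv_norm_of_ne hz, horth, mul_zero]
    · rw [fderiv_fderiv_norm hz, horth, zero_mul, mul_zero, sub_zero,
        orthonormal_iff_ite.1 hb i j]
      simp
    · have hnorm : ‖fderiv ℝ (norm : E → ℝ) z‖ = 1 := by
        rw [(hasFDerivAt_norm_of_ne hz).fderiv, norm_smul, innerSL_apply_norm, norm_inv, norm_norm,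
          inv_mul_cancel₀ hz'.ne']
      have hn' : (n : ℝ) ≠ 0 := by positivity
      rw [deriv_const, hnorm, hf.apply_const hm]
      field_simp
      simp

/-- The equation involves only the Euclidean structure and f of eigenvalues. Rotated copies of a
solution are the competitors in the gradient estimate. -/
lemma comp_isometry (h : IsGaugeFlow Γ f τ φ) (R : E ≃ₗᵢ[ℝ] E) :
    IsGaugeFlow Γ f τ fun t y => φ t (R y) where
  gauge t ht := (h.gauge t ht).comp_isometry R
  continuousOn := h.continuousOn.comp (f := fun p : ℝ × E => (p.1, R p.2)) (by fun_prop)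
    fun p hp => ⟨hp.1, by simpa using hp.2⟩
  smooth := h.smooth.comp (f := fun p : ℝ × E => (p.1, R p.2))
    (contDiff_fst.prodMk (R.contDiff.comp contDiff_snd)).contDiffOn
    fun p hp => ⟨hp.1, by simpa using hp.2⟩
  evolution t ht z hz := by
    have hz' : R z ≠ 0 := by simpa using hz
    obtain ⟨κ, hκ, e, he, hd⟩ := h.evolution t ht (R z) hz'
    refine ⟨κ, hκ, fun i => R.symm (e i), ⟨?_, fun i => ?_, fun i j => ?_⟩, ?_⟩
    · exact he.orthonormal.comp_linearIsometryEquiv R.symm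
    · rw [IsGauge.fderiv_comp_isometry]
      simpa using he.tangent i
    · rw [(h.gauge t (Ioo_subset_Ico_self ht)).fderiv_fderiv_comp_isometry R hz]
      simpa using he.diagonal i j
    · rw [hd, IsGauge.fderiv_comp_isometry]
      congr 3
      exact (ContinuousLinearMap.opNorm_comp_linearIsometryEquiv _ R).symm

lemma shift (h : IsGaugeFlow Γ f τ φ) {a : ℝ} (ha : 0 ≤ a) :
    IsGaugeFlow Γ f (τ - a) fun t => φ (t + a) where
  gauge t ht := h.gauge _ ⟨by linarith [ht.1], by linarith [ht.2]⟩
  continuousOn := h.continuousOn.comp (f := fun p : ℝ × E => (p.1 + a, p.2)) (by fun_prop)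
    fun p hp => ⟨⟨by linarith [hp.1.1], by linarith [hp.1.2]⟩, hp.2⟩
  smooth := h.smooth.comp (f := fun p : ℝ × E => (p.1 + a, p.2))
    ((contDiff_fst.add contDiff_const).prodMk contDiff_snd).contDiffOn
    fun p hp => ⟨⟨by linarith [hp.1.1], by linarith [hp.1.2]⟩, hp.2⟩
  evolution t ht z hz := by
    obtain ⟨κ, hκ, e, he, hd⟩ := h.evolution (t + a) ⟨by linarith [ht.1], by linarith [ht.2]⟩ z hz
    refine ⟨κ, hκ, e, he, ?_⟩
    rw [← hd]
    exact deriv_comp_add_const (fun s => φ s z) a t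

lemma restrict (h : IsGaugeFlow Γ f τ φ) {σ : ℝ} (hσ : σ ≤ τ) : IsGaugeFlow Γ f σ φ where
  gauge t ht := h.gauge t ⟨ht.1, ht.2.trans_le hσ⟩
  continuousOn := h.continuousOn.mono (prod_mono (Ico_subset_Ico_right hσ) subset_rfl)
  smooth := h.smooth.mono (prod_mono (Ioo_subset_Ioo_right hσ) subset_rfl)
  evolution t ht := h.evolution t ⟨ht.1, ht.2.trans_le hσ⟩

end IsGaugeFlow
end GaugeFlow

/-! ### Gradient and speed bounds from comparison. -/

section FirstOrderBounds

open Filter Topology Set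

variable {n : ℕ} {E : Type*} [NormedAddCommGroup E] [InnerProductSpace ℝ E]
  {Γ : Set (Fin n → ℝ)} {f : (Fin n → ℝ) → ℝ}

lemma reflection_orthogonal_unit {a : E} (ha : ‖a‖ = 1) (x : E) :
    (ℝ ∙ a)ᗮ.reflection x = x - (2 * ⟪a, x⟫) • a := by
  rw [Submodule.reflection_orthogonal_apply, Submodule.reflection_singleton_apply, ha]
  simp [two_mul, add_smul, two_smul]

lemma norm_reflection_sub_le {a b : E} (ha : ‖a‖ = 1) (hb : ‖b‖ = 1) (x : E) :
    ‖(ℝ ∙ b)ᗮ.reflection ((ℝ ∙ a)ᗮ.reflection x) - x‖ ≤ 4 * ‖b - a‖ * ‖x‖ := by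
  set y := (ℝ ∙ a)ᗮ.reflection x with hy
  have hx : x = (ℝ ∙ a)ᗮ.reflection y := by rw [hy, Submodule.reflection_reflection]
  have hxy : ‖y‖ = ‖x‖ := by rw [hy, LinearIsometryEquiv.norm_map]
  rw [← hxy]
  conv_lhs => rw [hx]
  rw [reflection_orthogonal_unit ha, reflection_orthogonal_unit hb]
  have h1 : y - (2 * ⟪b, y⟫) • b - (y - (2 * ⟪a, y⟫) • a) =
      (2 * ⟪a, y⟫) • (a - b) + (2 * ⟪a - b, y⟫) • b := by
    rw [inner_sub_left]; module
  rw [h1]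
  refine (norm_add_le _ _).trans ?_
  rw [norm_smul, norm_smul, hb, norm_sub_rev a b, Real.norm_eq_abs, Real.norm_eq_abs, abs_mul,
    abs_mul, abs_two]
  have h2 : |⟪a, y⟫| ≤ ‖y‖ := by simpa [ha] using abs_real_inner_le_norm a y
  have h3 : |⟪a - b, y⟫| ≤ ‖b - a‖ * ‖y‖ := by
    rw [norm_sub_rev]; exact abs_real_inner_le_norm (a - b) y
  nlinarith [norm_nonneg (b - a)]

namespace IsGauge

/-- The condition on y' keeps both points in a ball around y that avoids the origin, where g need
not be differentiable. -/
lemma le_add_of_fderiv_le {g : E → ℝ} (hg : IsGauge g) {L : ℝ}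
    (hL : ∀ z, z ≠ 0 → ‖fderiv ℝ g z‖ ≤ L) {y y' : E} (h : ‖y' - y‖ < ‖y‖) :
    g y' ≤ g y + L * ‖y' - y‖ := by
  have hy : 0 < ‖y‖ := (norm_nonneg _).trans_lt h
  have h0 : ∀ x ∈ Metric.ball y ‖y‖, x ≠ 0 := by
    rintro x hx rfl
    simp at hx
  have := (convex_ball y ‖y‖).norm_image_sub_le_of_norm_hasFDerivWithin_le
    (f := g) (f' := fderiv ℝ g) (C := L)
    (fun x hx => (hg.differentiableAt (h0 x hx)).hasFDerivAt.hasFDerivWithinAt)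
    (fun x hx => hL x (h0 x hx)) (Metric.mem_ball_self hy) (y := y') (by simpa [dist_eq_norm] using h)
  linarith [(abs_le.1 ((Real.norm_eq_abs _).symm.le.trans this)).2]

end IsGauge

namespace IsGaugeFlow

variable {τ : ℝ} {φ : ℝ → E → ℝ}

/-- A rotation R by the angle 2θ moves points y by at most 4θ‖y‖, so φ(0,R·) ≤ (1 + 4Lθ/m) φ(0,·).
The comparison principle carries this to time t; differentiating at θ = 0 along the circle from z
towards v gives the bound. -/
lemma fderiv_le_of_initial [FiniteDimensional ℝ E] (hE : Module.finrank ℝ E = n + 1)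
    (hf : IsAdmissibleCurvatureFunction Γ f) (h : IsGaugeFlow Γ f τ φ) {L m : ℝ} (hm : 0 < m)
    (hL0 : 0 ≤ L)
    (hL : ∀ z, z ≠ 0 → ‖fderiv ℝ (φ 0) z‖ ≤ L) (hm' : ∀ z, z ≠ 0 → m * ‖z‖ ≤ φ 0 z) {t : ℝ}
    (ht : t ∈ Ico 0 τ) {z v : E} (hz : ‖z‖ = 1) (hv : ‖v‖ = 1) (hzv : ⟪z, v⟫ = 0) :
    fderiv ℝ (φ t) z v ≤ 2 * L / m * φ t z := by
  have hz0 : z ≠ 0 := by rintro rfl; simp at hz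
  have h0 : (0 : ℝ) ∈ Ico 0 τ := ⟨le_rfl, ht.1.trans_lt ht.2⟩
  have key : ∀ θ ∈ Ioo (0 : ℝ) (1 / 4),
      φ t (Real.cos (2 * θ) • z + Real.sin (2 * θ) • v) ≤ (1 + 4 * L * θ / m) * φ t z := by
    intro θ hθ
    set b := Real.cos θ • v - Real.sin θ • z with hb
    have hvz : ⟪v, z⟫ = 0 := by rw [real_inner_comm]; exact hzv
    have hzz : ⟪z, z⟫ = 1 := by rw [real_inner_self_eq_norm_sq, hz, one_pow]
    have hvv : ⟪v, v⟫ = 1 := by rw [real_inner_self_eq_norm_sq, hv, one_pow]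
    have hcs := Real.cos_sq_add_sin_sq θ
    have hb1 : ‖b‖ = 1 := by
      rw [← sq_eq_sq₀ (norm_nonneg _) zero_le_one, ← real_inner_self_eq_norm_sq]
      simp only [hb, inner_sub_left, inner_sub_right, real_inner_smul_left, real_inner_smul_right,
        hzz, hvv, hzv, hvz]
      linear_combination hcs
    have hbv : ‖b - v‖ ≤ θ := by
      refine abs_le_of_sq_le_sq' ?_ hθ.1.le |>.2
      rw [← real_inner_self_eq_norm_sq]
      simp only [hb, inner_sub_left, inner_sub_right, real_inner_smul_left, real_inner_smul_right,
        hzz, hvv, hzv, hvz]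
      nlinarith [Real.one_sub_sq_div_two_le_cos (x := θ)]
    -- The product of two reflections in hyperplanes whose normals form the angle θ is a rotation by
    -- 2θ in their plane.
    let R : E ≃ₗᵢ[ℝ] E := (ℝ ∙ v)ᗮ.reflection.trans (ℝ ∙ b)ᗮ.reflection
    have hRz : R z = Real.cos (2 * θ) • z + Real.sin (2 * θ) • v := by
      have h1 : R z = (ℝ ∙ b)ᗮ.reflection ((ℝ ∙ v)ᗮ.reflection z) := rfl
      rw [h1, reflection_orthogonal_unit hv, reflection_orthogonal_unit hb1, hvz, mul_zero,
        zero_smul, sub_zero]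
      have h2 : ⟪b, z⟫ = - Real.sin θ := by
        simp only [hb, inner_sub_left, real_inner_smul_left, hzz, hvz]
        ring
      rw [h2, hb, Real.cos_two_mul, Real.sin_two_mul, smul_sub, smul_smul, smul_smul]
      have h3 : 2 * Real.cos θ ^ 2 - 1 = 1 - 2 * Real.sin θ * Real.sin θ := by nlinarith
      rw [h3]
      module
    rw [← hRz]
    refine (h.comp_isometry R).le_of_le hE hf h (fun y hy => ?_) ht hz0
    have h1 : ‖R y - y‖ ≤ 4 * θ * ‖y‖ := by
      refine (norm_reflection_sub_le hv hb1 y).trans ?_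
      gcongr
    have hy' : 0 < ‖y‖ := norm_pos_iff.2 hy
    -- Here θ < 1/4 is used: it gives ‖R y − y‖ < ‖y‖.
    have h2 := (h.gauge 0 h0).le_add_of_fderiv_le hL (y := y) (y' := R y) (by nlinarith [hθ.2])
    have h3 : L * ‖R y - y‖ ≤ 4 * L * θ / m * (m * ‖y‖) := by
      rw [← mul_assoc, div_mul_cancel₀ _ hm.ne']
      nlinarith
    have h4 : 4 * L * θ / m * (m * ‖y‖) ≤ 4 * L * θ / m * φ 0 y :=
      mul_le_mul_of_nonneg_left (hm' y hy)
        (div_nonneg (mul_nonneg (by linarith) hθ.1.le) hm.le)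
    linarith
  have hd : HasDerivAt (fun θ : ℝ => Real.cos (2 * θ) • z + Real.sin (2 * θ) • v)
      ((2 : ℝ) • v) 0 := by
    have h1 := ((Real.hasDerivAt_cos (2 * 0)).comp (0 : ℝ) ((hasDerivAt_id (0 : ℝ)).const_mul 2)).smul_const z
    have h2 := ((Real.hasDerivAt_sin (2 * 0)).comp (0 : ℝ) ((hasDerivAt_id (0 : ℝ)).const_mul 2)).smul_const v
    refine (h1.add h2).congr_deriv ?_
    simp
  have hd2 : HasDerivAt (fun θ : ℝ => φ t (Real.cos (2 * θ) • z + Real.sin (2 * θ) • v))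
      (fderiv ℝ (φ t) z ((2 : ℝ) • v)) 0 :=
    HasFDerivAt.comp_hasDerivAt (0 : ℝ)
      (by simpa using ((h.gauge t ht).differentiableAt hz0).hasFDerivAt) hd
  have hd3 : HasDerivAt (fun θ : ℝ => (1 + 4 * L * θ / m) * φ t z) (4 * L / m * φ t z) 0 := by
    have := ((((hasDerivAt_id (0 : ℝ)).const_mul (4 * L)).div_const m).const_add 1).mul_const (φ t z)
    simpa using this
  have := nonneg_of_hasDerivAt_of_le_right (hd3.sub hd2) (by
    filter_upwards [Ioo_mem_nhdsGT (show (0 : ℝ) < 1 / 4 by norm_num)] with θ hθ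
    simpa using key θ hθ)
  rw [map_smul, smul_eq_mul] at this
  have h4 : 4 * L / m * φ t z = 2 * (2 * L / m * φ t z) := by ring
  linarith

/-- The gradient estimate. -/
theorem norm_fderiv_le [FiniteDimensional ℝ E] (hE : Module.finrank ℝ E = n + 1)
    (hf : IsAdmissibleCurvatureFunction Γ f) (h : IsGaugeFlow Γ f τ φ) {L m : ℝ} (hm : 0 < m)
    (hL0 : 0 ≤ L)
    (hL : ∀ z, z ≠ 0 → ‖fderiv ℝ (φ 0) z‖ ≤ L) (hm' : ∀ z, z ≠ 0 → m * ‖z‖ ≤ φ 0 z) {t : ℝ}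
    (ht : t ∈ Ico 0 τ) {z : E} (hz : ‖z‖ = 1) :
    ‖fderiv ℝ (φ t) z‖ ≤ (1 + 2 * L / m) * φ t z := by
  have hz0 : z ≠ 0 := by rintro rfl; simp at hz
  have hφ := (h.gauge t ht).pos z hz0
  have hC : 0 ≤ 2 * L / m := by positivity
  have key : ∀ v, ⟪z, v⟫ = 0 → fderiv ℝ (φ t) z v ≤ 2 * L / m * φ t z * ‖v‖ := by
    intro v hv
    rcases eq_or_ne v 0 with rfl | hv0
    · simp
    have hn : 0 < ‖v‖ := norm_pos_iff.2 hv0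
    have := h.fderiv_le_of_initial hE hf hm hL0 hL hm' ht (v := ‖v‖⁻¹ • v) hz
      (by simp [norm_smul, hn.ne']) (by rw [real_inner_smul_right, hv, mul_zero])
    rw [map_smul, smul_eq_mul, inv_mul_eq_div, div_le_iff₀ hn] at this
    exact this
  refine ContinuousLinearMap.opNorm_le_bound _ (by positivity) fun v => ?_
  -- Split v into its radial and tangential parts. By Euler's relation the radial part contributes
  -- the 1, the tangential part contributes 2L/m.
  have key2 : ∀ v : E, fderiv ℝ (φ t) z v ≤ (1 + 2 * L / m) * φ t z * ‖v‖ := by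
    intro v
    have hzz : ⟪z, z⟫ = 1 := by rw [real_inner_self_eq_norm_sq, hz, one_pow]
    have h1 := key (v - ⟪z, v⟫ • z) (by
      rw [inner_sub_right, real_inner_smul_right, hzz, mul_one, sub_self])
    have h2 : ‖v - ⟪z, v⟫ • z‖ ≤ ‖v‖ := by
      refine abs_le_of_sq_le_sq' ?_ (norm_nonneg v) |>.2
      rw [@norm_sub_sq_real, real_inner_smul_right, norm_smul, hz, real_inner_comm, mul_one,
        Real.norm_eq_abs, sq_abs]
      nlinarith [sq_nonneg ⟪z, v⟫]
    have h3 : ⟪z, v⟫ ≤ ‖v‖ := by simpa [hz] using real_inner_le_norm z v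
    rw [map_sub, map_smul, (h.gauge t ht).fderiv_self hz0, smul_eq_mul] at h1
    have h4 := mul_le_mul_of_nonneg_left h2 (mul_nonneg hC hφ.le)
    have h5 := mul_le_mul_of_nonneg_right h3 hφ.le
    linarith
  rw [Real.norm_eq_abs, abs_le]
  have h6 := key2 (-v)
  rw [map_neg, norm_neg] at h6
  exact ⟨by linarith, key2 v⟩

lemma eventually_forall_sphere [FiniteDimensional ℝ E] (hτ : 0 < τ) {r : ℝ × E → ℝ}
    (hr : ContinuousOn r (Ico 0 τ ×ˢ Metric.sphere 0 1)) {b : ℝ}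
    (hb : ∀ z ∈ Metric.sphere (0 : E) 1, r (0, z) < b) :
    ∀ᶠ t in 𝓝 0, ∀ z ∈ Metric.sphere (0 : E) 1, t ∈ Ico 0 τ → r (t, z) < b := by
  have h := IsCompact.eventually_forall_of_forall_eventually (x₀ := (0 : ℝ))
    (isCompact_sphere (0 : E) 1)
    (P := fun t z => (t, z) ∈ Ico 0 τ ×ˢ Metric.sphere (0 : E) 1 → r (t, z) < b) fun z hz => ?_
  · filter_upwards [h] with t ht z hz htτ using ht z hz ⟨htτ, hz⟩
  · exact eventually_nhdsWithin_iff.1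
      ((hr (0, z) ⟨⟨le_rfl, hτ⟩, hz⟩).eventually_lt_const (hb z hz))

lemma hasDerivAt_exp_mul (b x : ℝ) : HasDerivAt (fun s : ℝ => Real.exp (b * s) * x) (b * x) 0 := by
  have h1 : HasDerivAt (fun s : ℝ => Real.exp (b * s)) (Real.exp (b * 0) * (b * 1)) 0 :=
    ((hasDerivAt_id (0 : ℝ)).const_mul b).exp
  simpa using h1.mul_const x

/-- An initial upper bound for the logarithmic time derivative is preserved. -/
theorem deriv_le [FiniteDimensional ℝ E] (hE : Module.finrank ℝ E = n + 1)
    (hf : IsAdmissibleCurvatureFunction Γ f) (h : IsGaugeFlow Γ f τ φ) {r : ℝ × E → ℝ}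
    (hr : ContinuousOn r (Ico 0 τ ×ˢ Metric.sphere 0 1))
    (hd : ∀ t ∈ Ioo 0 τ, ∀ z ∈ Metric.sphere (0 : E) 1,
      deriv (fun s => φ s z) t = φ t z * r (t, z)) {b : ℝ}
    (hb : ∀ z ∈ Metric.sphere (0 : E) 1, r (0, z) ≤ b) {t : ℝ} (ht : t ∈ Ioo 0 τ) {z : E}
    (hz : z ≠ 0) : deriv (fun s => φ s z) t ≤ φ t z * b := by
  have hz0 : ∀ z ∈ Metric.sphere (0 : E) 1, z ≠ 0 := fun z hz => ne_zero_of_mem_unit_sphere ⟨z, hz⟩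
  have hφ := (h.gauge t (Ioo_subset_Ico_self ht)).pos z hz
  suffices H : ∀ ε > 0, deriv (fun s => φ s z) t ≤ (b + ε) * φ t z by
    refine le_of_forall_pos_le_add fun ε hε => ?_
    have := H (ε / φ t z) (div_pos hε hφ)
    rw [add_mul, div_mul_cancel₀ _ hφ.ne'] at this
    linarith
  intro ε hε
  -- φ is only assumed continuous at time 0, so the initial bound enters through the continuous
  -- function r; it holds for a short time with b + ε.
  have hev := eventually_forall_sphere (ht.1.trans ht.2) hr (b := b + ε)
    fun z hz => by linarith [hb z hz]
  obtain ⟨δ, hδ, hev⟩ := Metric.eventually_nhds_iff_ball.1 hev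
  -- Integrating the logarithmic derivative over [0, s] bounds φ(s,·)/φ(0,·) by exp((b + ε)s). As
  -- φ(· + s,·) and φ are both solutions, comparison transfers this bound to φ(t + s,·)/φ(t,·); then
  -- s → 0.
  have hsmall : ∀ s ∈ Ioo 0 (min δ (τ - t)), φ (t + s) z ≤ Real.exp ((b + ε) * s) * φ t z := by
    intro s hs
    have hsδ : s < δ := hs.2.trans_le (min_le_left _ _)
    have hsτ : s < τ - t := hs.2.trans_le (min_le_right _ _)
    have hIcc : Icc 0 s ⊆ Ico 0 τ := fun x hx => ⟨hx.1, by linarith [hx.2, ht.1]⟩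
    have h0 : ∀ y ∈ Metric.sphere (0 : E) 1, φ s y ≤ Real.exp ((b + ε) * s) * φ 0 y := by
      intro y hy
      have hanti : AntitoneOn (fun x => Real.exp (-(b + ε) * x) * φ x y) (Icc 0 s) := by
        have hder : ∀ x ∈ Ioo 0 s, HasDerivAt (fun x => Real.exp (-(b + ε) * x) * φ x y)
            (Real.exp (-(b + ε) * x) * (-(b + ε) * 1) * φ x y +
              Real.exp (-(b + ε) * x) * deriv (fun s => φ s y) x) x := fun x hx =>
          (((hasDerivAt_id x).const_mul (-(b + ε))).exp).mul
            (h.hasDerivAt ⟨hx.1, (hIcc ⟨hx.1.le, hx.2.le⟩).2⟩ (hz0 y hy))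
        refine antitoneOn_of_deriv_nonpos (convex_Icc 0 s) ?_ ?_ ?_
        · exact ContinuousOn.mul (by fun_prop) ((h.continuousOn_time (hz0 y hy)).mono hIcc)
        · rw [interior_Icc]
          exact fun x hx => (hder x hx).differentiableAt.differentiableWithinAt
        · rw [interior_Icc]
          intro x hx
          have hx' : x ∈ Ioo 0 τ := ⟨hx.1, (hIcc ⟨hx.1.le, hx.2.le⟩).2⟩
          have hxr := hev x (by
            rw [Metric.mem_ball, dist_zero_right, Real.norm_eq_abs, abs_lt]
            constructor <;> linarith [hx.1, hx.2]) y hy (Ioo_subset_Ico_self hx')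
          rw [(hder x hx).deriv, hd x hx' y hy]
          have h1 := (h.gauge x (Ioo_subset_Ico_self hx')).pos y (hz0 y hy)
          have h2 := Real.exp_pos (-(b + ε) * x)
          nlinarith [mul_pos h2 h1]
      have := hanti (left_mem_Icc.2 hs.1.le) (right_mem_Icc.2 hs.1.le) hs.1.le
      simp only [mul_zero, Real.exp_zero, one_mul] at this
      rw [neg_mul, Real.exp_neg, inv_mul_le_iff₀ (Real.exp_pos _)] at this
      exact this
    have hs0 : (0 : ℝ) ≤ s := hs.1.le
    have h1 := (h.shift hs0).le_of_le hE hf (h.restrict (σ := τ - s) (by linarith))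
      (C := Real.exp ((b + ε) * s)) (fun y hy => by
        rw [zero_add]
        exact (h.gauge s (hIcc ⟨hs0, le_rfl⟩)).ratio_le_of_sphere
          (h.gauge 0 (hIcc ⟨le_rfl, hs0⟩)) h0 hy) (t := t) ⟨ht.1.le, by linarith⟩ hz
    exact h1
  have hd1 : HasDerivAt (fun s => φ (t + s) z) (deriv (fun s => φ s z) t) 0 :=
    HasDerivAt.comp_const_add (f := fun s => φ s z) t 0 (by
      rw [add_zero]; exact h.hasDerivAt ht hz)
  have := nonneg_of_hasDerivAt_of_le_right ((hasDerivAt_exp_mul (b + ε) (φ t z)).sub hd1) (by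
    filter_upwards [Ioo_mem_nhdsGT (show 0 < min δ (τ - t) from lt_min hδ (by linarith [ht.2]))]
      with s hs
    simpa using hsmall s hs)
  linarith

/-- An initial lower bound for the logarithmic time derivative is preserved. -/
theorem le_deriv [FiniteDimensional ℝ E] (hE : Module.finrank ℝ E = n + 1)
    (hf : IsAdmissibleCurvatureFunction Γ f) (h : IsGaugeFlow Γ f τ φ) {r : ℝ × E → ℝ}
    (hr : ContinuousOn r (Ico 0 τ ×ˢ Metric.sphere 0 1))
    (hd : ∀ t ∈ Ioo 0 τ, ∀ z ∈ Metric.sphere (0 : E) 1,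
      deriv (fun s => φ s z) t = φ t z * r (t, z)) {a : ℝ}
    (ha : ∀ z ∈ Metric.sphere (0 : E) 1, a ≤ r (0, z)) {t : ℝ} (ht : t ∈ Ioo 0 τ) {z : E}
    (hz : z ≠ 0) : φ t z * a ≤ deriv (fun s => φ s z) t := by
  have hz0 : ∀ z ∈ Metric.sphere (0 : E) 1, z ≠ 0 := fun z hz => ne_zero_of_mem_unit_sphere ⟨z, hz⟩
  have hφ := (h.gauge t (Ioo_subset_Ico_self ht)).pos z hz
  suffices H : ∀ ε > 0, (a - ε) * φ t z ≤ deriv (fun s => φ s z) t by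
    refine le_of_forall_pos_le_add fun ε hε => ?_
    have := H (ε / φ t z) (div_pos hε hφ)
    rw [sub_mul, div_mul_cancel₀ _ hφ.ne'] at this
    linarith
  intro ε hε
  have hev := eventually_forall_sphere (ht.1.trans ht.2) hr.neg (b := -(a - ε))
    fun z hz => by simp only [Pi.neg_apply]; linarith [ha z hz]
  obtain ⟨δ, hδ, hev⟩ := Metric.eventually_nhds_iff_ball.1 hev
  -- The same comparison with the solution and its time translate exchanged.
  have hsmall : ∀ s ∈ Ioo 0 (min δ (τ - t)), φ t z ≤ Real.exp (-(a - ε) * s) * φ (t + s) z := by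
    intro s hs
    have hsδ : s < δ := hs.2.trans_le (min_le_left _ _)
    have hsτ : s < τ - t := hs.2.trans_le (min_le_right _ _)
    have hIcc : Icc 0 s ⊆ Ico 0 τ := fun x hx => ⟨hx.1, by linarith [hx.2, ht.1]⟩
    have h0 : ∀ y ∈ Metric.sphere (0 : E) 1, φ 0 y ≤ Real.exp (-(a - ε) * s) * φ s y := by
      intro y hy
      have hmono : MonotoneOn (fun x => Real.exp (-(a - ε) * x) * φ x y) (Icc 0 s) := by
        have hder : ∀ x ∈ Ioo 0 s, HasDerivAt (fun x => Real.exp (-(a - ε) * x) * φ x y)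
            (Real.exp (-(a - ε) * x) * (-(a - ε) * 1) * φ x y +
              Real.exp (-(a - ε) * x) * deriv (fun s => φ s y) x) x := fun x hx =>
          (((hasDerivAt_id x).const_mul (-(a - ε))).exp).mul
            (h.hasDerivAt ⟨hx.1, (hIcc ⟨hx.1.le, hx.2.le⟩).2⟩ (hz0 y hy))
        refine monotoneOn_of_deriv_nonneg (convex_Icc 0 s) ?_ ?_ ?_
        · exact ContinuousOn.mul (by fun_prop) ((h.continuousOn_time (hz0 y hy)).mono hIcc)
        · rw [interior_Icc]
          exact fun x hx => (hder x hx).differentiableAt.differentiableWithinAt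
        · rw [interior_Icc]
          intro x hx
          have hx' : x ∈ Ioo 0 τ := ⟨hx.1, (hIcc ⟨hx.1.le, hx.2.le⟩).2⟩
          have hxr := hev x (by
            rw [Metric.mem_ball, dist_zero_right, Real.norm_eq_abs, abs_lt]
            constructor <;> linarith [hx.1, hx.2]) y hy (Ioo_subset_Ico_self hx')
          rw [(hder x hx).deriv, hd x hx' y hy]
          simp only [Pi.neg_apply] at hxr
          have h1 := (h.gauge x (Ioo_subset_Ico_self hx')).pos y (hz0 y hy)
          have h2 := Real.exp_pos (-(a - ε) * x)
          nlinarith [mul_pos h2 h1]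
      have := hmono (left_mem_Icc.2 hs.1.le) (right_mem_Icc.2 hs.1.le) hs.1.le
      simpa only [mul_zero, Real.exp_zero, one_mul] using this
    have hs0 : (0 : ℝ) ≤ s := hs.1.le
    exact (h.restrict (σ := τ - s) (by linarith)).le_of_le hE hf (h.shift hs0)
      (C := Real.exp (-(a - ε) * s)) (fun y hy => by
        rw [zero_add]
        exact (h.gauge 0 (hIcc ⟨le_rfl, hs0⟩)).ratio_le_of_sphere
          (h.gauge s (hIcc ⟨hs0, le_rfl⟩)) h0 hy) (t := t) ⟨ht.1.le, by linarith⟩ hz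
  have hd1 : HasDerivAt (fun s => φ (t + s) z) (deriv (fun s => φ s z) t) 0 :=
    HasDerivAt.comp_const_add (f := fun s => φ s z) t 0 (by
      rw [add_zero]; exact h.hasDerivAt ht hz)
  have hd2 : HasDerivAt (fun s => Real.exp (-(a - ε) * s)) (-(a - ε)) 0 := by
    simpa using hasDerivAt_exp_mul (-(a - ε)) 1
  have := nonneg_of_hasDerivAt_of_le_right ((hd2.mul hd1).sub_const (φ t z)) (by
    filter_upwards [Ioo_mem_nhdsGT (show 0 < min δ (τ - t) from lt_min hδ (by linarith [ht.2]))]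
      with s hs
    simpa using hsmall s hs)
  simp only [mul_zero, Real.exp_zero, one_mul, add_zero] at this
  linarith

end IsGaugeFlow

end FirstOrderBounds

/-! ### Commuting derivatives in space-time and rotating frames. -/

section SpaceTime

open Filter Topology Set

variable {E : Type*} [NormedAddCommGroup E] [InnerProductSpace ℝ E] {Ω : Set (ℝ × E)}
  {u : ℝ × E → ℝ}

lemma hasDerivAt_space (hu : ContDiffOn ℝ ∞ u Ω) (hΩ : IsOpen Ω) {t : ℝ} {z : E}
    (hp : (t, z) ∈ Ω) (v : E) :
    dirDeriv (0, v) u (t, z) = dirDeriv v (fun y => u (t, y)) z := by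
  have h1 : DifferentiableAt ℝ u (t, z) :=
    (hu.contDiffAt (hΩ.mem_nhds hp)).differentiableAt (by simp)
  have h2 : HasFDerivAt (fun y : E => (t, y)) (ContinuousLinearMap.inr ℝ ℝ E) z :=
    hasFDerivAt_prodMk_right t z
  have h3 : HasFDerivAt (fun y => u (t, y)) _ z := h1.hasFDerivAt.comp z h2
  simp [dirDeriv, h3.fderiv]

lemma hasDerivAt_time (hu : ContDiffOn ℝ ∞ u Ω) (hΩ : IsOpen Ω) {t : ℝ} {z : E}
    (hp : (t, z) ∈ Ω) : HasDerivAt (fun s => u (s, z)) (dirDeriv (1, 0) u (t, z)) t := by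
  have h1 : DifferentiableAt ℝ u (t, z) :=
    (hu.contDiffAt (hΩ.mem_nhds hp)).differentiableAt (by simp)
  have h2 : HasDerivAt (fun s : ℝ => (s, z)) ((1 : ℝ), (0 : E)) t :=
    (hasDerivAt_id t).prodMk (hasDerivAt_const t z)
  exact HasFDerivAt.comp_hasDerivAt t h1.hasFDerivAt h2

lemma dirDeriv_comm_three {V : Type*} [NormedAddCommGroup V] [NormedSpace ℝ V] {Ω : Set V}
    {u : V → ℝ} (hu : ContDiffOn ℝ ∞ u Ω) (hΩ : IsOpen Ω) (a b : V) :
    EqOn (dirDeriv a (dirDeriv b (dirDeriv b u))) (dirDeriv b (dirDeriv b (dirDeriv a u))) Ω :=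
  (dirDeriv_comm (hu.dirDeriv hΩ b) hΩ a b).trans
    (dirDeriv_congr hΩ (dirDeriv_comm hu hΩ a b) b)

/-- The expansion of D²g(b,b) along a produces the left side, the conditions at a maximum of
D²g(a,a) control the right side. -/
lemma dirDeriv_comm_four {V : Type*} [NormedAddCommGroup V] [NormedSpace ℝ V] {Ω : Set V}
    {u : V → ℝ} (hu : ContDiffOn ℝ ∞ u Ω) (hΩ : IsOpen Ω) (a b : V) :
    EqOn (dirDeriv a (dirDeriv a (dirDeriv b (dirDeriv b u))))
      (dirDeriv b (dirDeriv b (dirDeriv a (dirDeriv a u)))) Ω :=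
  (dirDeriv_congr hΩ (dirDeriv_comm_three hu hΩ a b) a).trans
    (dirDeriv_comm_three (hu.dirDeriv hΩ a) hΩ a b)

/-- Rotating an orthonormal frame of `ν₀ᗮ` into `νᗮ`. -/
lemma orthonormal_rotate {ι : Type*} {ν₀ ν : E} (h0 : ‖ν₀‖ = 1) (h1 : ‖ν‖ = 1)
    (hc : 1 + ⟪ν₀, ν⟫ ≠ 0) {e : ι → E} (he : Orthonormal ℝ e) (hν : ∀ i, ⟪ν₀, e i⟫ = 0) :
    Orthonormal ℝ (fun i => e i - (⟪ν, e i⟫ / (1 + ⟪ν₀, ν⟫)) • (ν₀ + ν)) ∧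
      ∀ i, ⟪ν, e i - (⟪ν, e i⟫ / (1 + ⟪ν₀, ν⟫)) • (ν₀ + ν)⟫ = 0 := by
  classical
  have h00 : ⟪ν₀, ν₀⟫ = 1 := by rw [real_inner_self_eq_norm_sq, h0, one_pow]
  have h11 : ⟪ν, ν⟫ = 1 := by rw [real_inner_self_eq_norm_sq, h1, one_pow]
  refine ⟨?_, fun i => ?_⟩
  · rw [orthonormal_iff_ite] at he ⊢
    intro i j
    rw [← he i j]
    simp only [inner_sub_left, inner_sub_right, inner_add_left, inner_add_right,
      real_inner_smul_left, real_inner_smul_right, h00, h11, hν, real_inner_comm ν₀ (e _),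
      real_inner_comm ν (e _), real_inner_comm ν₀ ν]
    field_simp
    ring
  · simp only [inner_sub_right, inner_add_right, real_inner_smul_right, h11, real_inner_comm ν₀ ν]
    field_simp
    ring

lemma eq_sum_add_of_orthonormal {n : ℕ} [FiniteDimensional ℝ E] (hE : Module.finrank ℝ E = n + 1)
    {e : Fin n → E} (he : Orthonormal ℝ e) {ν₀ : E} (h0 : ‖ν₀‖ = 1) (hν : ∀ i, ⟪ν₀, e i⟫ = 0)
    (v : E) : v = ∑ i, ⟪e i, v⟫ • e i + ⟪ν₀, v⟫ • ν₀ := by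
  have hp : innerSL ℝ ν₀ ≠ 0 := by
    intro h
    have := congrArg (fun p : E →L[ℝ] ℝ => p ν₀) h
    simp at this
    simp [this] at h0
  have h1 := eq_sum_inner_of_orthonormal hE he hp (by simpa using hν)
    (v := v - ⟪ν₀, v⟫ • ν₀) (by simp [inner_sub_right, real_inner_smul_right, h0])
  simp only [inner_sub_right, real_inner_smul_right, real_inner_comm ν₀ (e _), hν, mul_zero,
    sub_zero] at h1
  exact sub_eq_iff_eq_add.1 h1

lemma norm_sq_eq_sum_add {n : ℕ} [FiniteDimensional ℝ E] (hE : Module.finrank ℝ E = n + 1)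
    {e : Fin n → E} (he : Orthonormal ℝ e) {ν₀ : E} (h0 : ‖ν₀‖ = 1) (hν : ∀ i, ⟪ν₀, e i⟫ = 0)
    (v : E) : ‖v‖ ^ 2 = ∑ i, ⟪e i, v⟫ ^ 2 + ⟪ν₀, v⟫ ^ 2 := by
  rw [← real_inner_self_eq_norm_sq]
  conv_lhs => enter [2]; rw [eq_sum_add_of_orthonormal hE he h0 hν v]
  simp [inner_add_right, inner_sum, real_inner_smul_right, real_inner_comm, sq]

end SpaceTime

/-! ### The algebra of the curvature estimate. -/

section CurvatureAlgebra

/-- Here F = f(κ), a = |Dg|², lam is the largest eigenvalue, zk = ⟪z, e_k⟫, ψᵢ are the derivatives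
of order i of the speed along e_k, R0 = 1/n − ψ0, and A0, Y, X are sums over i ≠ k, weighted by
fᵢ(κ), of eigenvalues and of third and fourth derivatives. `h1` and `h2` are the first and second
order conditions of the one-variable inequality, `hX` is the second order condition of the spatial
maximum. The conclusion is the sign of the time derivative of the gap at the maximum. -/
lemma curvature_inequality {n F lam a Y X A0 R0 ψ0 ψ1 ψ2 zk : ℝ} (hF : 0 < F) (ha : 0 < a)
    (hlam : 0 < lam) (hn : F / n ≤ lam) (hR : R0 = a / F) (hψ0 : ψ0 = 1 / n - R0)
    (hX : X ≤ -lam * A0 - 2 * lam * zk * Y)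
    (h1 : R0 * Y - ψ1 * F + 2 * lam * a * zk = 0)
    (h2 : 0 ≤ R0 * (X / 2 + lam * A0 / 2) - ψ1 * Y + (lam / (2 * n) - ψ2 / 2) * F -
      (lam ^ 2 + a * (3 * lam ^ 2 * zk ^ 2 - lam / 2))) :
    lam * ψ0 + ψ2 + 2 * lam * zk * ψ1 ≤ 0 := by
  have hR0 : 0 < R0 := by rw [hR]; positivity
  have hRF : R0 * F = a := by rw [hR]; field_simp
  have h3 : R0 * (X / 2 + lam * A0 / 2) ≤ R0 * (-lam * zk * Y) :=
    mul_le_mul_of_nonneg_left (by linarith) hR0.le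
  have hψ1 : ψ1 * F = R0 * Y + 2 * lam * a * zk := by linarith
  have h4 : F * (ψ1 * Y + lam ^ 2 * zk ^ 2 * a) = R0 * (Y + lam * zk * F) ^ 2 := by
    linear_combination Y * hψ1 + (-2 * lam * zk * Y - lam ^ 2 * zk ^ 2 * F) * hRF
  have h5 : 0 ≤ ψ1 * Y + lam ^ 2 * zk ^ 2 * a := by
    have : 0 ≤ F * (ψ1 * Y + lam ^ 2 * zk ^ 2 * a) := by rw [h4]; positivity
    exact nonneg_of_mul_nonneg_right this hF
  have h6 : lam / (2 * n) * F = lam * (F / n) / 2 := by ring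
  have h7 : F * (lam * ψ0 + ψ2 + 2 * lam * zk * ψ1) ≤ 0 := by
    have h8 : F * (lam * ψ0) = lam * (F / n) - lam * a := by
      rw [hψ0, ← hRF]; ring
    have h9 : F * (2 * lam * zk * ψ1) = 2 * lam * zk * (R0 * Y + 2 * lam * a * zk) := by
      rw [← hψ1]; ring
    have h10 : lam * (F / n) ≤ lam * lam := mul_le_mul_of_nonneg_left hn hlam.le
    nlinarith
  by_contra h
  push Not at h
  have := mul_pos hF h
  linarith

end CurvatureAlgebra

/-! ### Expansions at a maximum of the curvature quotient. -/

section CurvatureStep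

open Filter Topology Set

variable {n : ℕ} {E : Type*} [NormedAddCommGroup E] [InnerProductSpace ℝ E]
  {Γ : Set (Fin n → ℝ)} {f : (Fin n → ℝ) → ℝ}

lemma tendsto_clm_apply {F G : Type*} [NormedAddCommGroup F] [NormedSpace ℝ F]
    [NormedAddCommGroup G] [NormedSpace ℝ G] {X : Type*} {l : Filter X} {B : X → F →L[ℝ] G}
    {B₀ : F →L[ℝ] G} {v : X → F} {v₀ : F} (hB : Tendsto B l (𝓝 B₀)) (hv : Tendsto v l (𝓝 v₀)) :
    Tendsto (fun s => B s (v s)) l (𝓝 (B₀ v₀)) :=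
  (isBoundedBilinearMap_apply.continuous.tendsto (B₀, v₀)).comp (hB.prodMk_nhds hv)

namespace IsGauge

variable {g : E → ℝ} {z : E}

lemma eventually_ne_line (hz : z ≠ 0) (v : E) : ∀ᶠ s : ℝ in 𝓝 0, z + s • v ≠ 0 := by
  have hc : ContinuousAt (fun s : ℝ => z + s • v) 0 := by fun_prop
  exact hc.eventually_ne (by simpa using hz)

lemma hasJet_dirDeriv (hg : IsGauge g) (hz : z ≠ 0) (v w : E) :
    HasJet (fun s => fderiv ℝ g (z + s • v) w) (fderiv ℝ g z w) (fderiv ℝ (fderiv ℝ g) z v w)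
      (dirDeriv v (dirDeriv v (dirDeriv w g)) z / 2) := by
  rw [← hg.dirDeriv_dirDeriv hz]
  exact hasJet_line (hg.smooth.dirDeriv isOpen_compl_singleton w) isOpen_compl_singleton hz v

lemma hasJet_dirDeriv_dirDeriv (hg : IsGauge g) (hz : z ≠ 0) (v w : E) :
    HasJet (fun s => dirDeriv w (dirDeriv w g) (z + s • v)) (fderiv ℝ (fderiv ℝ g) z w w)
      (dirDeriv v (dirDeriv w (dirDeriv w g)) z)
      (dirDeriv v (dirDeriv v (dirDeriv w (dirDeriv w g))) z / 2) := by
  rw [← hg.dirDeriv_dirDeriv hz]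
  exact hasJet_line ((hg.smooth.dirDeriv isOpen_compl_singleton w).dirDeriv isOpen_compl_singleton w)
    isOpen_compl_singleton hz v

lemma hasJet_inner_line (z v w : E) : HasJet (fun s => ⟪z + s • v, w⟫) ⟪z, w⟫ ⟪v, w⟫ 0 := by
  refine (((HasJet.const ⟪z, w⟫).add (HasJet.id.const_mul ⟪v, w⟫)).congr (by ring) (by ring)
    (by ring)).congr_fun fun s => ?_
  rw [inner_add_left, real_inner_smul_left]; ring

/-- The difference of the two sides of the curvature bound. -/
lemma hasJet_gap (hg : IsGauge g) (hz : z ≠ 0) (hz1 : g z = 1) {lam : ℝ} {v w : E} (hv : ‖v‖ = 1)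
    (hw : fderiv ℝ g z w = 0) (hv0 : fderiv ℝ g z v = 0)
    (hlam : fderiv ℝ (fderiv ℝ g) z v v = lam) :
    HasJet (fun s => lam * ‖g (z + s • w) • v - fderiv ℝ g (z + s • w) v • (z + s • w)‖ ^ 2 -
        g (z + s • w) ^ 3 * dirDeriv v (dirDeriv v g) (z + s • w))
      0 (-2 * lam * fderiv ℝ (fderiv ℝ g) z w v * ⟪z, v⟫ - dirDeriv w (dirDeriv v (dirDeriv v g)) z)
      (lam * (fderiv ℝ (fderiv ℝ g) z w w - 2 * (fderiv ℝ (fderiv ℝ g) z w v * ⟪w, v⟫ +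
        dirDeriv w (dirDeriv w (dirDeriv v g)) z / 2 * ⟪z, v⟫) +
        fderiv ℝ (fderiv ℝ g) z w v ^ 2 * ‖z‖ ^ 2) -
        (3 / 2 * fderiv ℝ (fderiv ℝ g) z w w * lam +
          dirDeriv w (dirDeriv w (dirDeriv v (dirDeriv v g))) z / 2)) := by
  have j0 := hg.hasJet hz w
  rw [hz1, hw] at j0
  have j1 := hg.hasJet_dirDeriv hz w v
  rw [hv0] at j1
  have j2 := hg.hasJet_dirDeriv_dirDeriv hz w v
  rw [hlam] at j2
  have j3 := hasJet_inner_line z w v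
  have j4 : HasJet (fun s => ‖z + s • w‖ ^ 2) (‖z‖ ^ 2) (2 * ⟪z, w⟫) (‖w‖ ^ 2) := by
    refine (((HasJet.const (‖z‖ ^ 2)).add (HasJet.id.const_mul (2 * ⟪z, w⟫))).add
      ((HasJet.id.mul HasJet.id).const_mul (‖w‖ ^ 2))).congr (by ring) (by ring) (by ring)
      |>.congr_fun fun s => ?_
    rw [norm_add_sq_real, real_inner_smul_right, norm_smul, mul_pow, Real.norm_eq_abs, sq_abs]
    ring
  refine (((((j0.mul j0).sub (((j0.mul j1).mul j3).const_mul 2)).add ((j1.mul j1).mul j4)).const_mul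
    lam).sub (((j0.mul j0).mul j0).mul j2)).congr (by ring) (by ring) (by ring) |>.congr_fun
    fun s => ?_
  rw [@norm_sub_sq_real, norm_smul, norm_smul, hv, real_inner_smul_left, real_inner_smul_right,
    mul_pow, mul_pow, Real.norm_eq_abs, Real.norm_eq_abs, sq_abs, sq_abs, real_inner_comm]
  ring

/-- The derivative conditions at a spatial maximum of the curvature quotient. -/
lemma derivatives_of_curvature_max (hg : IsGauge g) (hz : z ≠ 0) (hz1 : g z = 1) {κ : Fin n → ℝ}
    {e : Fin n → E} (he : IsEigenframe (fderiv ℝ g z) (fderiv ℝ (fderiv ℝ g) z) κ e) (k : Fin n)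
    (hmax : ∀ y, y ≠ 0 → ∀ v, g y ^ 3 * fderiv ℝ (fderiv ℝ g) y v v ≤
      κ k * ‖g y • v - fderiv ℝ g y v • y‖ ^ 2) (i : Fin n) :
    (dirDeriv (e i) (dirDeriv (e k) (dirDeriv (e k) g)) z =
      if i = k then -2 * κ k ^ 2 * ⟪z, e k⟫ else 0) ∧
    (i ≠ k → dirDeriv (e i) (dirDeriv (e i) (dirDeriv (e k) (dirDeriv (e k) g))) z ≤
      -κ k * κ i - 2 * κ k * ⟪z, e k⟫ * dirDeriv (e i) (dirDeriv (e i) (dirDeriv (e k) g)) z) := by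
  have hkk : fderiv ℝ (fderiv ℝ g) z (e k) (e k) = κ k := by rw [he.diagonal, if_pos rfl]
  -- The gap for the fixed vector e_k is nonnegative along the line z + s eᵢ and vanishes at s = 0.
  obtain ⟨h1, h2⟩ := (hg.hasJet_gap hz hz1 (he.orthonormal.1 k) (he.tangent i) (he.tangent k)
    hkk).of_nonneg (by
      filter_upwards [eventually_ne_line hz (e i)] with s hs
      rw [hg.dirDeriv_dirDeriv hs]
      linarith [hmax _ hs (e k)])
  rw [he.diagonal] at h1 h2
  refine ⟨?_, fun hik => ?_⟩
  · split_ifs with hik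
    · subst hik
      rw [if_pos rfl] at h1
      linarith
    · rw [if_neg hik] at h1
      linarith
  · simp only [he.diagonal, if_neg hik, if_true] at h2
    linarith

lemma continuousAt_fderiv (hg : IsGauge g) (hz : z ≠ 0) : ContinuousAt (fderiv ℝ g) z :=
  (hg.differentiableAt_fderiv hz).continuousAt

lemma continuousAt_fderiv_fderiv (hg : IsGauge g) (hz : z ≠ 0) :
    ContinuousAt (fderiv ℝ (fderiv ℝ g)) z :=
  ((hg.contDiffOn_fderiv.fderiv_of_isOpen (m := ∞) isOpen_compl_singleton
    (by simp)).contDiffAt (isOpen_compl_singleton.mem_nhds hz)).continuousAt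

lemma tendsto_line (z v : E) : Tendsto (fun s : ℝ => z + s • v) (𝓝 0) (𝓝 z) := by
  have hc : Continuous (fun s : ℝ => z + s • v) := by fun_prop
  simpa using hc.tendsto 0

end IsGauge

/-- The unit normal field of the level sets of `g`. -/
noncomputable def levelNormal [CompleteSpace E] (g : E → ℝ) (y : E) : E :=
  ‖fderiv ℝ g y‖⁻¹ • (InnerProductSpace.toDual ℝ E).symm (fderiv ℝ g y)

namespace IsGauge

variable [CompleteSpace E] {g : E → ℝ} {z : E}

lemma inner_levelNormal (g : E → ℝ) (y v : E) :
    ⟪levelNormal g y, v⟫ = ‖fderiv ℝ g y‖⁻¹ * fderiv ℝ g y v := by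
  rw [levelNormal, real_inner_smul_left, InnerProductSpace.toDual_symm_apply]

lemma norm_levelNormal (hg : IsGauge g) (hz : z ≠ 0) : ‖levelNormal g z‖ = 1 := by
  rw [levelNormal, norm_smul, LinearIsometryEquiv.norm_map, norm_inv, norm_norm,
    inv_mul_cancel₀ (norm_ne_zero_iff.2 (hg.fderiv_ne_zero hz))]

lemma continuousAt_levelNormal (hg : IsGauge g) (hz : z ≠ 0) : ContinuousAt (levelNormal g) z := by
  have h1 := hg.continuousAt_fderiv hz
  refine ContinuousAt.smul (h1.norm.inv₀ (norm_ne_zero_iff.2 (hg.fderiv_ne_zero hz))) ?_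
  exact (LinearIsometryEquiv.continuous _).continuousAt.comp h1

/-- The frame `e` of the tangent space at `z`, rotated to the tangent space at `y`. -/
noncomputable def rotatedFrame (g : E → ℝ) (z : E) (e : Fin n → E) (y : E) (i : Fin n) : E :=
  e i - (⟪levelNormal g y, e i⟫ / (1 + ⟪levelNormal g z, levelNormal g y⟫)) •
    (levelNormal g z + levelNormal g y)

lemma rotatedFrame_spec (hg : IsGauge g) {y : E} (hz : z ≠ 0) (hy : y ≠ 0)
    (hc : 1 + ⟪levelNormal g z, levelNormal g y⟫ ≠ 0) {e : Fin n → E} (he : Orthonormal ℝ e)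
    (hp : ∀ i, fderiv ℝ g z (e i) = 0) :
    Orthonormal ℝ (rotatedFrame g z e y) ∧ ∀ i, fderiv ℝ g y (rotatedFrame g z e y i) = 0 := by
  obtain ⟨h1, h2⟩ := orthonormal_rotate (hg.norm_levelNormal hz) (hg.norm_levelNormal hy) hc he
    fun i => by rw [inner_levelNormal, hp, mul_zero]
  refine ⟨h1, fun i => ?_⟩
  have h3 := h2 i
  rw [inner_levelNormal] at h3
  exact (mul_eq_zero.1 h3).resolve_left
    (inv_ne_zero (norm_ne_zero_iff.2 (hg.fderiv_ne_zero hy)))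

lemma tendsto_levelNormal_line (hg : IsGauge g) (hz : z ≠ 0) (v : E) :
    Tendsto (fun s : ℝ => levelNormal g (z + s • v)) (𝓝 0) (𝓝 (levelNormal g z)) :=
  (hg.continuousAt_levelNormal hz).tendsto.comp (tendsto_line z v)

lemma tendsto_one_add_inner (hg : IsGauge g) (hz : z ≠ 0) (v : E) :
    Tendsto (fun s : ℝ => 1 + ⟪levelNormal g z, levelNormal g (z + s • v)⟫) (𝓝 0) (𝓝 2) := by
  have h := (tendsto_const_nhds (x := levelNormal g z)).inner (𝕜 := ℝ)
    (hg.tendsto_levelNormal_line hz v)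
  rw [real_inner_self_eq_norm_sq, hg.norm_levelNormal hz] at h
  have := h.const_add 1
  norm_num at this
  exact this

/-- The rotated vector differs from eᵢ by a multiple of Dg(z + s v)(eᵢ). When this is o(s²), the
rotation does not affect the second order expansion, and the frame need not be differentiated. -/
lemma hasJet_rotatedFrame (hg : IsGauge g) (hz : z ≠ 0) {e : Fin n → E} (v : E) {i : Fin n}
    (hi : (fun s => fderiv ℝ g (z + s • v) (e i)) =o[𝓝 0] fun s : ℝ => s ^ 2) :
    HasJet (fun s => fderiv ℝ (fderiv ℝ g) (z + s • v) (rotatedFrame g z e (z + s • v) i)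
        (rotatedFrame g z e (z + s • v) i))
      (fderiv ℝ (fderiv ℝ g) z (e i) (e i))
      (dirDeriv v (dirDeriv (e i) (dirDeriv (e i) g)) z)
      (dirDeriv v (dirDeriv v (dirDeriv (e i) (dirDeriv (e i) g))) z / 2) := by
  have hB : Tendsto (fun s : ℝ => fderiv ℝ (fderiv ℝ g) (z + s • v)) (𝓝 0)
      (𝓝 (fderiv ℝ (fderiv ℝ g) z)) :=
    (hg.continuousAt_fderiv_fderiv hz).tendsto.comp (tendsto_line z v)
  have hp : Tendsto (fun s : ℝ => fderiv ℝ g (z + s • v)) (𝓝 0) (𝓝 (fderiv ℝ g z)) :=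
    (hg.continuousAt_fderiv hz).tendsto.comp (tendsto_line z v)
  have hν := hg.tendsto_levelNormal_line hz v
  have hq : Tendsto (fun s : ℝ => levelNormal g z + levelNormal g (z + s • v)) (𝓝 0)
      (𝓝 (levelNormal g z + levelNormal g z)) := hν.const_add _
  set q := fun s : ℝ => levelNormal g z + levelNormal g (z + s • v) with hqdef
  set b := fun s : ℝ => ‖fderiv ℝ g (z + s • v)‖⁻¹ /
    (1 + ⟪levelNormal g z, levelNormal g (z + s • v)⟫) with hb
  have hbt : Tendsto b (𝓝 0) (𝓝 (‖fderiv ℝ g z‖⁻¹ / 2)) :=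
    (hp.norm.inv₀ (norm_ne_zero_iff.2 (hg.fderiv_ne_zero hz))).div
      (hg.tendsto_one_add_inner hz v) two_ne_zero
  set a := fun s : ℝ => fderiv ℝ g (z + s • v) (e i) with ha
  have hat : Tendsto a (𝓝 0) (𝓝 (fderiv ℝ g z (e i))) := tendsto_clm_apply hp tendsto_const_nhds
  have hc1 : Tendsto (fun s => -(b s * (fderiv ℝ (fderiv ℝ g) (z + s • v) (e i) (q s) +
      fderiv ℝ (fderiv ℝ g) (z + s • v) (q s) (e i))) +
      b s ^ 2 * a s * fderiv ℝ (fderiv ℝ g) (z + s • v) (q s) (q s)) (𝓝 0) (𝓝 _) :=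
    ((hbt.mul ((tendsto_clm_apply (tendsto_clm_apply hB tendsto_const_nhds) hq).add
      (tendsto_clm_apply (tendsto_clm_apply hB hq) tendsto_const_nhds))).neg).add
      (((hbt.pow 2).mul hat).mul (tendsto_clm_apply (tendsto_clm_apply hB hq) hq))
  have hsmall := hi.mul_isBigO (HasJet.isBigO_one_of_tendsto hc1)
  simp only [mul_one] at hsmall
  refine (hg.hasJet_dirDeriv_dirDeriv hz v (e i)).congr_of_isLittleO
    (hsmall.congr' ?_ EventuallyEq.rfl)
  filter_upwards [eventually_ne_line hz v] with s hs
  rw [hg.dirDeriv_dirDeriv hs]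
  have hframe : rotatedFrame g z e (z + s • v) i = e i - (a s * b s) • q s := by
    rw [rotatedFrame, inner_levelNormal]
    congr 2
    simp only [ha, hb]
    ring
  rw [hframe]
  simp only [map_sub, map_smul, sub_apply, smul_apply, smul_eq_mul]
  ring

end IsGauge

end CurvatureStep

/-! ### The sign of the speed at a curvature maximum. -/

section CurvatureMaximum

open Filter Topology Set

variable {n : ℕ} {E : Type*} [NormedAddCommGroup E] [InnerProductSpace ℝ E]
  {Γ : Set (Fin n → ℝ)} {f : (Fin n → ℝ) → ℝ}

namespace IsGauge

variable {g : E → ℝ} {z : E} {κ : Fin n → ℝ} {e : Fin n → E} {k : Fin n}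

/-- At a spatial maximum of the curvature quotient, the jets of the first derivatives along the
direction of maximal curvature. -/
lemma hasJet_tangent (hg : IsGauge g) (hz : z ≠ 0)
    (he : IsEigenframe (fderiv ℝ g z) (fderiv ℝ (fderiv ℝ g) z) κ e)
    (hT : ∀ i, dirDeriv (e i) (dirDeriv (e k) (dirDeriv (e k) g)) z =
      if i = k then -2 * κ k ^ 2 * ⟪z, e k⟫ else 0) (i : Fin n) :
    HasJet (fun s => fderiv ℝ g (z + s • e k) (e i)) 0 (if i = k then κ k else 0)
      (if i = k then -κ k ^ 2 * ⟪z, e k⟫ else 0) := by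
  refine (hg.hasJet_dirDeriv hz (e k) (e i)).congr (he.tangent i) ?_ ?_
  · rw [he.diagonal]
    by_cases h : i = k
    · simp [h]
    · simp [h, Ne.symm h]
  · rw [← dirDeriv_comm_three hg.smooth isOpen_compl_singleton (e i) (e k) hz, hT]
    split_ifs <;> ring

variable [CompleteSpace E]

lemma norm_fderiv_sq [FiniteDimensional ℝ E] (hE : Module.finrank ℝ E = n + 1) (hg : IsGauge g)
    (hz : z ≠ 0)
    (he : Orthonormal ℝ e) (hp : ∀ i, fderiv ℝ g z (e i) = 0) (p : E →L[ℝ] ℝ) :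
    ‖p‖ ^ 2 = ∑ i, p (e i) ^ 2 + p (levelNormal g z) ^ 2 := by
  have h := norm_sq_eq_sum_add hE he (hg.norm_levelNormal hz)
    (fun i => by rw [inner_levelNormal, hp, mul_zero]) ((InnerProductSpace.toDual ℝ E).symm p)
  simp_rw [LinearIsometryEquiv.norm_map, real_inner_comm _ (e _),
    real_inner_comm _ (levelNormal g z), InnerProductSpace.toDual_symm_apply] at h
  exact h

/-- Euler's relation Dg(y) y = g(y) at y = z + s e_k, together with ⟪levelNormal g z, z⟫ =
1/|Dg(z)|, expresses the normal component of Dg(y) by the tangential ones. Thus |Dg|² can be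
expanded without derivatives of Dg in normal direction. -/
lemma fderiv_levelNormal [FiniteDimensional ℝ E] (hE : Module.finrank ℝ E = n + 1) (hg : IsGauge g)
    (hz : z ≠ 0) (hz1 : g z = 1)
    (he : Orthonormal ℝ e) (hp : ∀ i, fderiv ℝ g z (e i) = 0) {s : ℝ} (hs : z + s • e k ≠ 0) :
    fderiv ℝ g (z + s • e k) (levelNormal g z) = ‖fderiv ℝ g z‖ * (g (z + s • e k) -
      (∑ i, ⟪e i, z⟫ * fderiv ℝ g (z + s • e k) (e i) + s * fderiv ℝ g (z + s • e k) (e k))) := by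
  have hn : ‖fderiv ℝ g z‖ ≠ 0 := norm_ne_zero_iff.2 (hg.fderiv_ne_zero hz)
  have h1 := eq_sum_add_of_orthonormal hE he (hg.norm_levelNormal hz)
    (fun i => by rw [inner_levelNormal, hp, mul_zero]) z
  rw [inner_levelNormal, hg.fderiv_self hz, hz1, mul_one] at h1
  have h2 := hg.fderiv_self hs
  set p := fderiv ℝ g (z + s • e k) with hpdef
  have h3 : p z = ∑ i, ⟪e i, z⟫ * p (e i) + ‖fderiv ℝ g z‖⁻¹ * p (levelNormal g z) := by
    conv_lhs => rw [h1]
    simp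
  rw [map_add, map_smul, smul_eq_mul, h3] at h2
  rw [← h2]
  field_simp
  ring

lemma hasJet_norm_fderiv_sq [FiniteDimensional ℝ E] (hE : Module.finrank ℝ E = n + 1)
    (hg : IsGauge g) (hz : z ≠ 0) (hz1 : g z = 1)
    (he : IsEigenframe (fderiv ℝ g z) (fderiv ℝ (fderiv ℝ g) z) κ e)
    (hT : ∀ i, dirDeriv (e i) (dirDeriv (e k) (dirDeriv (e k) g)) z =
      if i = k then -2 * κ k ^ 2 * ⟪z, e k⟫ else 0) :
    HasJet (fun s => ‖fderiv ℝ g (z + s • e k)‖ ^ 2) (‖fderiv ℝ g z‖ ^ 2)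
      (-2 * κ k * ‖fderiv ℝ g z‖ ^ 2 * ⟪z, e k⟫)
      (κ k ^ 2 + ‖fderiv ℝ g z‖ ^ 2 * (3 * κ k ^ 2 * ⟪z, e k⟫ ^ 2 - κ k)) := by
  have j0 := hg.hasJet hz (e k)
  rw [hz1, he.tangent, he.diagonal, if_pos rfl] at j0
  have j1 := hg.hasJet_tangent hz he hT
  have j2 := (HasJet.sum Finset.univ fun i _ => (j1 i).mul (j1 i)).congr (a' := 0) (b' := 0)
    (c' := κ k ^ 2) (by simp) (by simp) (by
      rw [Finset.sum_eq_single k] <;> simp +contextual [sq])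
  have j3 := HasJet.sum Finset.univ fun i _ => (j1 i).const_mul ⟪e i, z⟫
  have j4 := HasJet.id.mul (j1 k)
  have j5 := (j0.sub (j3.add j4)).const_mul ‖fderiv ℝ g z‖
  have j6 := j2.add (j5.mul j5)
  simp only [mul_zero, zero_mul, add_zero, zero_add, Finset.sum_const_zero, mul_ite,
    Finset.sum_ite_eq', Finset.mem_univ, if_true, sub_zero, zero_sub, mul_one, one_mul] at j6
  refine (j6.congr (by ring) (by rw [real_inner_comm z]; ring)
    (by rw [real_inner_comm z]; ring)).congr_of_isLittleO ?_
  refine Asymptotics.IsLittleO.congr' (Asymptotics.isLittleO_zero _ _) ?_ EventuallyEq.rfl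
  filter_upwards [eventually_ne_line hz (e k)] with s hs
  rw [hg.norm_fderiv_sq hE hz he.orthonormal he.tangent,
    hg.fderiv_levelNormal hE hz hz1 he.orthonormal he.tangent hs]
  simp only [sq, sub_self]

/-- The curvature quotient does not increase at a spatial maximum, in terms of the speed `ψ` of the
gauge. -/
theorem curvature_speed_nonpos [FiniteDimensional ℝ E] (hE : Module.finrank ℝ E = n + 1)
    (hn : 0 < n) (hf : IsAdmissibleCurvatureFunction Γ f) (hg : IsGauge g) {ψ : E → ℝ}
    (hψ : ContDiffOn ℝ ∞ ψ {0}ᶜ)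
    (hpde : ∀ y, y ≠ 0 → ∃ κ ∈ Γ, ∃ e : Fin n → E,
      IsEigenframe (fderiv ℝ g y) (fderiv ℝ (fderiv ℝ g) y) κ e ∧
      ψ y = g y / n - ‖fderiv ℝ g y‖ ^ 2 / f κ)
    (hz : z ≠ 0) (hz1 : g z = 1) (hκ : κ ∈ Γ)
    (he : IsEigenframe (fderiv ℝ g z) (fderiv ℝ (fderiv ℝ g) z) κ e)
    (hψz : ψ z = g z / n - ‖fderiv ℝ g z‖ ^ 2 / f κ) (hk : ∀ i, κ i ≤ κ k)
    (hmax : ∀ y, y ≠ 0 → ∀ v, g y ^ 3 * fderiv ℝ (fderiv ℝ g) y v v ≤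
      κ k * ‖g y • v - fderiv ℝ g y v • y‖ ^ 2) :
    κ k * ψ z + dirDeriv (e k) (dirDeriv (e k) ψ) z +
      2 * κ k * ⟪z, e k⟫ * dirDeriv (e k) ψ z ≤ 0 := by
  have hn' : (0 : ℝ) < n := Nat.cast_pos.2 hn
  have hF := hf.pos κ hκ
  have hFn : f κ / n ≤ κ k := by
    rw [div_le_iff₀ hn']
    refine (hf.le_sum hn hκ).trans ((Finset.sum_le_sum fun i _ => hk i).trans (le_of_eq ?_))
    simp [mul_comm]
  have hlam : 0 < κ k := (div_pos hF hn').trans_le hFn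
  have hp0 : 0 < ‖fderiv ℝ g z‖ := norm_pos_iff.2 (hg.fderiv_ne_zero hz)
  have hT := fun i => (hg.derivatives_of_curvature_max hz hz1 he k hmax i).1
  have hX := fun i => (hg.derivatives_of_curvature_max hz hz1 he k hmax i).2
  set c : Fin n → ℝ := fun i => fderiv ℝ f κ (Pi.single i 1) with hc
  have hcpos : ∀ i, 0 < c i := hf.strictly_monotone κ hκ
  set d : ℝ → Fin n → ℝ := fun s i => fderiv ℝ (fderiv ℝ g) (z + s • e k)
    (rotatedFrame g z e (z + s • e k) i) (rotatedFrame g z e (z + s • e k) i) with hd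
  set Y : Fin n → ℝ := fun i => dirDeriv (e i) (dirDeriv (e i) (dirDeriv (e k) g)) z with hY
  set X : Fin n → ℝ :=
    fun i => dirDeriv (e i) (dirDeriv (e i) (dirDeriv (e k) (dirDeriv (e k) g))) z with hXdef
  -- Only the entries i ≠ k are expanded: for them the first order condition of the maximum makes
  -- Dg(z + s e_k)(eᵢ) = o(s²).
  have jd : ∀ i ∈ Finset.univ.erase k, HasJet (fun s => c i * d s i) (c i * κ i) (c i * Y i)
      (c i * (X i / 2)) := by
    intro i hi
    have hik : i ≠ k := Finset.ne_of_mem_erase hi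
    have j1 := hg.hasJet_tangent hz he hT i
    rw [if_neg hik, if_neg hik] at j1
    refine ((hg.hasJet_rotatedFrame hz (e k) j1.isLittleO).congr ?_ ?_ ?_).const_mul (c i)
    · rw [he.diagonal, if_pos rfl]
    · exact (dirDeriv_comm_three hg.smooth isOpen_compl_singleton (e k) (e i) hz)
    · rw [dirDeriv_comm_four hg.smooth isOpen_compl_singleton (e k) (e i) hz]
  have j0 := hg.hasJet hz (e k)
  rw [hz1, he.tangent, he.diagonal, if_pos rfl] at j0
  have jψ := hasJet_line hψ isOpen_compl_singleton hz (e k)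
  have jR := (j0.const_mul (n : ℝ)⁻¹).sub jψ
  have jN := (HasJet.const (c k * κ k)).add (j0.mul (HasJet.sum _ jd))
  have jP := (hg.hasJet_norm_fderiv_sq hE hz hz1 he hT).mul j0
  have jJ := (jR.mul jN).sub jP
  have hA : c k * κ k + ∑ i ∈ Finset.univ.erase k, c i * κ i = f κ := by
    rw [Finset.add_sum_erase _ (fun i => c i * κ i) (Finset.mem_univ k)]
    exact hf.sum_fderiv_mul hκ
  -- Concavity linearizes f at κ in the rotated frame, and the equation gives (g/n − ψ) f(μ) = |Dg|²
  -- on the line. Equality holds at s = 0.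
  have hev : ∀ᶠ s : ℝ in 𝓝 0, 0 ≤ ((n : ℝ)⁻¹ * g (z + s • e k) - ψ (z + s • e k)) *
      (c k * κ k + g (z + s • e k) * ∑ i ∈ Finset.univ.erase k, c i * d s i) -
      ‖fderiv ℝ g (z + s • e k)‖ ^ 2 * g (z + s • e k) := by
    filter_upwards [eventually_ne_line hz (e k),
      (hg.tendsto_one_add_inner hz (e k)).eventually_ne two_ne_zero] with s hs hs2
    obtain ⟨μ, hμ, e', he', hψs⟩ := hpde _ hs
    obtain ⟨hfr1, hfr2⟩ := hg.rotatedFrame_spec hz hs hs2 he.orthonormal he.tangent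
    obtain ⟨hdΓ, hμd⟩ := he'.map_diag hE hf (hg.fderiv_ne_zero hs) hμ hfr1 hfr2
    have hgs := hg.pos _ hs
    have hfμ := hf.pos μ hμ
    have h1 : f μ ≤ ∑ i, c i * d s i := hμd.trans (hf.le_sum_fderiv hκ hdΓ)
    rw [← Finset.add_sum_erase _ (fun i => c i * d s i) (Finset.mem_univ k)] at h1
    -- The entry in direction k is not expanded; the global bound `hmax` for a tangential unit
    -- vector replaces it by κ k / g.
    have h2 : g (z + s • e k) * d s k ≤ κ k := by
      have h3 := hmax _ hs (rotatedFrame g z e (z + s • e k) k)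
      rw [hfr2 k, zero_smul, sub_zero, norm_smul, hfr1.1 k, mul_one, Real.norm_eq_abs, sq_abs] at h3
      have h4 : g (z + s • e k) ^ 2 * (g (z + s • e k) * d s k) ≤ g (z + s • e k) ^ 2 * κ k := by
        simp only [hd]; linarith
      exact le_of_mul_le_mul_left h4 (by positivity)
    have h5 : g (z + s • e k) * f μ ≤
        c k * κ k + g (z + s • e k) * ∑ i ∈ Finset.univ.erase k, c i * d s i := by
      have h6 := mul_le_mul_of_nonneg_left h1 hgs.le
      have h7 := mul_le_mul_of_nonneg_left h2 (hcpos k).le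
      linarith
    have h8 : (n : ℝ)⁻¹ * g (z + s • e k) - ψ (z + s • e k) =
        ‖fderiv ℝ g (z + s • e k)‖ ^ 2 / f μ := by
      rw [hψs]; ring
    rw [h8]
    have h9 := mul_le_mul_of_nonneg_left h5
      (show 0 ≤ ‖fderiv ℝ g (z + s • e k)‖ ^ 2 / f μ by positivity)
    have h10 : ‖fderiv ℝ g (z + s • e k)‖ ^ 2 / f μ * (g (z + s • e k) * f μ) =
        ‖fderiv ℝ g (z + s • e k)‖ ^ 2 * g (z + s • e k) := by
      field_simp
    linarith
  rw [hz1] at hψz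
  set A0 := ∑ i ∈ Finset.univ.erase k, c i * κ i with hA0
  have hR : (n : ℝ)⁻¹ - ψ z = ‖fderiv ℝ g z‖ ^ 2 / f κ := by rw [hψz]; ring
  -- The zeroth coefficient vanishes since R F = |Dg|² at z; the other two feed
  -- `curvature_inequality`.
  obtain ⟨h1, h2⟩ := (jJ.congr (a' := 0) (by
    rw [mul_one, one_mul, hA, hR]; field_simp; simp) rfl rfl).of_nonneg hev
  have hXs : ∑ i ∈ Finset.univ.erase k, c i * (X i / 2) ≤
      (-κ k * A0 - 2 * κ k * ⟪z, e k⟫ * ∑ i ∈ Finset.univ.erase k, c i * Y i) / 2 := by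
    rw [hA0, Finset.mul_sum, Finset.mul_sum, ← Finset.sum_sub_distrib, Finset.sum_div]
    refine Finset.sum_le_sum fun i hi => ?_
    have := mul_le_mul_of_nonneg_left (hX i (Finset.ne_of_mem_erase hi)) (hcpos i).le
    simp only [hXdef, hY]
    linarith
  refine curvature_inequality (n := n) (F := f κ) (a := ‖fderiv ℝ g z‖ ^ 2) (A0 := A0)
    (R0 := (n : ℝ)⁻¹ - ψ z) (Y := ∑ i ∈ Finset.univ.erase k, c i * Y i)
    (X := 2 * ∑ i ∈ Finset.univ.erase k, c i * (X i / 2)) hF (by positivity) hlam hFn hR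
    (by ring) (by linarith) ?_ ?_
  · rw [← h1, ← hA]; ring
  · refine h2.trans (le_of_eq ?_)
    rw [← hA]; ring

end IsGauge

end CurvatureMaximum

/-! ### The maximum principle for the curvature quotient. -/

section CurvatureEstimate

open Filter Topology Set

variable {n : ℕ} {E : Type*} [NormedAddCommGroup E] [InnerProductSpace ℝ E]
  {Γ : Set (Fin n → ℝ)} {f : (Fin n → ℝ) → ℝ}

lemma dirDeriv_dirDeriv_space {Ω : Set (ℝ × E)} {u : ℝ × E → ℝ} (hu : ContDiffOn ℝ ∞ u Ω)
    (hΩ : IsOpen Ω) {t : ℝ} {z : E} (hp : (t, z) ∈ Ω) (v w : E) :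
    dirDeriv (0, v) (dirDeriv (0, w) u) (t, z) = dirDeriv v (dirDeriv w fun y => u (t, y)) z := by
  rw [hasDerivAt_space (hu.dirDeriv hΩ _) hΩ hp]
  have h : (fun y => dirDeriv ((0 : ℝ), w) u (t, y)) =ᶠ[𝓝 z] dirDeriv w fun y => u (t, y) := by
    have hc : ContinuousAt (fun y : E => (t, y)) z := by fun_prop
    filter_upwards [hc.eventually_mem (hΩ.mem_nhds hp)] with y hy using hasDerivAt_space hu hΩ hy w
  exact congrArg (fun L : E →L[ℝ] ℝ => L v) h.fderiv_eq

/-- `κ_max / u ≤ Θ` on the level set `g = 1`, in homogeneous form. -/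
def CurvatureQuotientLE (g : E → ℝ) (Θ : ℝ) (z v : E) : Prop :=
  g z ^ 3 * fderiv ℝ (fderiv ℝ g) z v v ≤ Θ * ‖g z • v - fderiv ℝ g z v • z‖ ^ 2

namespace IsGauge

variable {g : E → ℝ} {z : E} {Θ : ℝ}

lemma gap_smul_left (hg : IsGauge g) (hz : z ≠ 0) {l : ℝ} (hl : 0 < l) (v : E) :
    Θ * ‖g (l • z) • v - fderiv ℝ g (l • z) v • (l • z)‖ ^ 2 -
      g (l • z) ^ 3 * fderiv ℝ (fderiv ℝ g) (l • z) v v =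
    l ^ 2 * (Θ * ‖g z • v - fderiv ℝ g z v • z‖ ^ 2 - g z ^ 3 * fderiv ℝ (fderiv ℝ g) z v v) := by
  rw [hg.homogeneous z hz l hl, hg.fderiv_smul hz hl, hg.fderiv_fderiv_smul hz hl]
  have h1 : (l * g z) • v - fderiv ℝ g z v • l • z = l • (g z • v - fderiv ℝ g z v • z) := by
    module
  rw [h1, norm_smul, mul_pow, Real.norm_eq_abs, sq_abs]
  simp only [smul_apply, smul_eq_mul]
  field_simp

lemma gap_smul_right (g : E → ℝ) (z : E) (l : ℝ) (v : E) :
    Θ * ‖g z • (l • v) - fderiv ℝ g z (l • v) • z‖ ^ 2 -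
      g z ^ 3 * fderiv ℝ (fderiv ℝ g) z (l • v) (l • v) =
    l ^ 2 * (Θ * ‖g z • v - fderiv ℝ g z v • z‖ ^ 2 - g z ^ 3 * fderiv ℝ (fderiv ℝ g) z v v) := by
  have h1 : g z • (l • v) - fderiv ℝ g z (l • v) • z = l • (g z • v - fderiv ℝ g z v • z) := by
    rw [map_smul, smul_eq_mul]; module
  rw [h1, norm_smul, mul_pow, Real.norm_eq_abs, sq_abs]
  simp only [map_smul, smul_apply, smul_eq_mul]
  ring

lemma gap_add_smul_self (hg : IsGauge g) (hz : z ≠ 0) (v : E) (a : ℝ) :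
    Θ * ‖g z • (v + a • z) - fderiv ℝ g z (v + a • z) • z‖ ^ 2 -
      g z ^ 3 * fderiv ℝ (fderiv ℝ g) z (v + a • z) (v + a • z) =
    Θ * ‖g z • v - fderiv ℝ g z v • z‖ ^ 2 - g z ^ 3 * fderiv ℝ (fderiv ℝ g) z v v := by
  have h1 : g z • (v + a • z) - fderiv ℝ g z (v + a • z) • z =
      g z • v - fderiv ℝ g z v • z := by
    rw [map_add, map_smul, hg.fderiv_self hz, smul_eq_mul]; module
  rw [h1]
  simp [hg.fderiv_fderiv_self hz, hg.fderiv_fderiv_self' hz]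

lemma curvatureQuotientLE_iff (g : E → ℝ) (Θ : ℝ) (z v : E) : CurvatureQuotientLE g Θ z v ↔
    0 ≤ Θ * ‖g z • v - fderiv ℝ g z v • z‖ ^ 2 - g z ^ 3 * fderiv ℝ (fderiv ℝ g) z v v :=
  sub_nonneg.symm

/-- The gap scales by positive factors in z and in v, and does not change when a multiple of z is
added to v. So unit vectors z and v with v ⊥ z suffice, and these form a compact set. -/
lemma curvatureQuotientLE_of_sphere (hg : IsGauge g)
    (h : ∀ z ∈ Metric.sphere (0 : E) 1, ∀ v ∈ Metric.sphere (0 : E) 1, ⟪z, v⟫ = 0 →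
      CurvatureQuotientLE g Θ z v) (hz : z ≠ 0) (v : E) : CurvatureQuotientLE g Θ z v := by
  have hn : 0 < ‖z‖ := norm_pos_iff.2 hz
  set y := ‖z‖⁻¹ • z with hy
  have hy1 : ‖y‖ = 1 := by simp [hy, norm_smul, hn.ne']
  have hy0 : y ≠ 0 := by rintro h; simp [h] at hy1
  have hzy : z = ‖z‖ • y := by rw [hy, smul_smul, mul_inv_cancel₀ hn.ne', one_smul]
  have hyy : ⟪y, y⟫ = 1 := by rw [real_inner_self_eq_norm_sq, hy1, one_pow]
  rw [curvatureQuotientLE_iff, hzy, hg.gap_smul_left hy0 hn]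
  refine mul_nonneg (sq_nonneg _) ?_
  set w := v - ⟪y, v⟫ • y with hw
  have hvw : v = w + ⟪y, v⟫ • y := by rw [hw, sub_add_cancel]
  rw [hvw, hg.gap_add_smul_self hy0]
  rcases eq_or_ne w 0 with h0 | h0
  · simp [h0]
  · have hwn : 0 < ‖w‖ := norm_pos_iff.2 h0
    have hww : w = ‖w‖ • (‖w‖⁻¹ • w) := by rw [smul_smul, mul_inv_cancel₀ hwn.ne', one_smul]
    rw [hww, gap_smul_right]
    refine mul_nonneg (sq_nonneg _) ((curvatureQuotientLE_iff _ _ _ _).1 (h y (by simpa using hy1) _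
      (by simp [norm_smul, hwn.ne']) ?_))
    rw [real_inner_smul_right, hw, inner_sub_right, real_inner_smul_right, hyy, mul_one, sub_self,
      mul_zero]

/-- For v ⊥ z the squared norm is g(z)²‖v‖² + (Dg(z)v)²‖z‖². -/
lemma denominator_pos (hg : IsGauge g) (hz : z ≠ 0) {v : E} (hv : v ≠ 0) (hzv : ⟪z, v⟫ = 0) :
    0 < ‖g z • v - fderiv ℝ g z v • z‖ ^ 2 := by
  have h1 := hg.pos z hz
  have h2 : 0 < ‖v‖ := norm_pos_iff.2 hv
  rw [@norm_sub_sq_real, real_inner_smul_left, real_inner_smul_right, real_inner_comm, hzv,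
    norm_smul, Real.norm_of_nonneg h1.le, mul_zero, mul_zero, mul_zero, sub_zero]
  positivity

end IsGauge

namespace IsGaugeFlow

variable {τ : ℝ} {φ : ℝ → E → ℝ}

/-- The curvature quotient strictly decreases at a spatial maximum up to a linear perturbation. -/
lemma curvature_max_false [FiniteDimensional ℝ E] (hE : Module.finrank ℝ E = n + 1) (hn : 0 < n)
    (hf : IsAdmissibleCurvatureFunction Γ f) (h : IsGaugeFlow Γ f τ φ) {s : ℝ} (hs : s ∈ Ioo 0 τ)
    {lam ε : ℝ} (hε : 0 < ε)
    (hmax : ∀ r ∈ Ioc 0 s, ∀ y, y ≠ 0 → ∀ v, CurvatureQuotientLE (φ r) (lam + ε * (r - s)) y v)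
    {y v : E} (hy : y ≠ 0) (hv : v ≠ 0) (hyv : ⟪y, v⟫ = 0)
    (heq : φ s y ^ 3 * fderiv ℝ (fderiv ℝ (φ s)) y v v =
      lam * ‖φ s y • v - fderiv ℝ (φ s) y v • y‖ ^ 2) : False := by
  have := FiniteDimensional.complete ℝ E
  have hg := h.gauge s (Ioo_subset_Ico_self hs)
  set g := φ s with hgdef
  have hgy := hg.pos y hy
  -- Move to the level set g = 1 by scaling.
  set z := (g y)⁻¹ • y with hz
  have hz0 : z ≠ 0 := smul_ne_zero (inv_ne_zero hgy.ne') hy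
  have hz1 : g z = 1 := by
    rw [hz, hg.homogeneous y hy _ (inv_pos.2 hgy), inv_mul_cancel₀ hgy.ne']
  have hmaxs : ∀ y, y ≠ 0 → ∀ v, g y ^ 3 * fderiv ℝ (fderiv ℝ g) y v v ≤
      lam * ‖g y • v - fderiv ℝ g y v • y‖ ^ 2 := by
    intro y hy v
    have := hmax s ⟨hs.1, le_rfl⟩ y hy v
    rwa [sub_self, mul_zero, add_zero] at this
  have heqz : fderiv ℝ (fderiv ℝ g) z v v = lam * ‖v - fderiv ℝ g z v • z‖ ^ 2 := by
    have h1 := hg.gap_smul_left (Θ := lam) hy (inv_pos.2 hgy) v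
    rw [← hz, hz1, heq, sub_self, mul_zero, one_smul, one_pow, one_mul] at h1
    linarith
  obtain ⟨κ, hκ, e, he, hd⟩ := h.evolution s hs z hz0
  obtain ⟨k, hk⟩ : ∃ k, ∀ i, κ i ≤ κ k := by
    have : Nonempty (Fin n) := ⟨⟨0, hn⟩⟩
    exact Finite.exists_max κ
  set w := v - fderiv ℝ g z v • z with hw
  have hpw : fderiv ℝ g z w = 0 := by
    rw [hw, map_sub, map_smul, hg.fderiv_self hz0, hz1, smul_eq_mul, mul_one, sub_self]
  have hw0 : 0 < ‖w‖ ^ 2 := by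
    have := hg.denominator_pos hz0 hv (by rw [hz, real_inner_smul_left, hyv, mul_zero])
    rwa [hz1, one_smul] at this
  have hwv : fderiv ℝ (fderiv ℝ g) z w w = fderiv ℝ (fderiv ℝ g) z v v := by
    rw [hw]
    simp [hg.fderiv_fderiv_self hz0, hg.fderiv_fderiv_self' hz0]
  -- Equality in some direction, together with the upper bound for the principal direction k,
  -- identifies the quotient with the largest eigenvalue.
  have hlam : κ k = lam := by
    refine le_antisymm ?_ ?_
    · have := hmaxs z hz0 (e k)
      rw [hz1, he.tangent, he.diagonal, if_pos rfl, one_smul, zero_smul, sub_zero,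
        he.orthonormal.1 k] at this
      linarith
    · have h1 := he.apply hE (hg.fderiv_ne_zero hz0) hpw hpw
      rw [hwv, heqz] at h1
      have h2 : lam * ‖w‖ ^ 2 ≤ κ k * ‖w‖ ^ 2 := by
        rw [h1, ← sum_sq_inner_of_orthonormal hE he.orthonormal (hg.fderiv_ne_zero hz0) he.tangent
          hpw, Finset.mul_sum]
        refine Finset.sum_le_sum fun i _ => ?_
        rw [← sq]
        exact mul_le_mul_of_nonneg_right (hk i) (sq_nonneg _)
      exact le_of_mul_le_mul_right h2 hw0
  set Ω : Set (ℝ × E) := Ioo 0 τ ×ˢ {0}ᶜ with hΩdef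
  have hΩ : IsOpen Ω := isOpen_Ioo.prod isOpen_compl_singleton
  set u : ℝ × E → ℝ := fun p => φ p.1 p.2 with hu
  have hus : ContDiffOn ℝ ∞ u Ω := h.smooth
  have hmem : ∀ y : E, y ≠ 0 → (s, y) ∈ Ω := fun y hy => ⟨hs, hy⟩
  set ψ : E → ℝ := fun y => dirDeriv ((1 : ℝ), (0 : E)) u (s, y) with hψ
  have hψs : ContDiffOn ℝ ∞ ψ {0}ᶜ :=
    (hus.dirDeriv hΩ _).comp (contDiff_const.prodMk contDiff_id).contDiffOn fun y hy => hmem y hy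
  have hψd : ∀ y, y ≠ 0 → ψ y = deriv (fun r => φ r y) s := fun y hy =>
    (hasDerivAt_time hus hΩ (hmem y hy)).deriv.symm
  have hstep := hg.curvature_speed_nonpos hE hn hf hψs (fun y hy => by
    obtain ⟨κ, hκ, e, he, hd⟩ := h.evolution s hs y hy
    exact ⟨κ, hκ, e, he, by rw [hψd y hy, hd]⟩) hz0 hz1 hκ he (by rw [hψd z hz0, hd]) hk
    (by rw [hlam]; exact hmaxs)
  rw [hlam] at hstep
  have t0 : HasDerivAt (fun r => φ r z) (ψ z) s := hasDerivAt_time hus hΩ (hmem z hz0)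
  have t1 : HasDerivAt (fun r => dirDeriv ((0 : ℝ), e k) u (r, z)) (dirDeriv (e k) ψ z) s := by
    refine (hasDerivAt_time (hus.dirDeriv hΩ _) hΩ (hmem z hz0)).congr_deriv ?_
    rw [dirDeriv_comm hus hΩ _ _ (hmem z hz0), hasDerivAt_space (hus.dirDeriv hΩ _) hΩ (hmem z hz0)]
  have t2 : HasDerivAt (fun r => dirDeriv ((0 : ℝ), e k) (dirDeriv ((0 : ℝ), e k) u) (r, z))
      (dirDeriv (e k) (dirDeriv (e k) ψ) z) s := by
    refine (hasDerivAt_time ((hus.dirDeriv hΩ _).dirDeriv hΩ _) hΩ (hmem z hz0)).congr_deriv ?_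
    rw [dirDeriv_comm_three hus hΩ _ _ (hmem z hz0),
      dirDeriv_dirDeriv_space (hus.dirDeriv hΩ _) hΩ (hmem z hz0)]
  have e1 : ∀ r ∈ Ioo 0 τ, dirDeriv ((0 : ℝ), e k) u (r, z) = fderiv ℝ (φ r) z (e k) :=
    fun r hr => hasDerivAt_space hus hΩ (show (r, z) ∈ Ω from ⟨hr, hz0⟩) _
  have e2 : ∀ r ∈ Ioo 0 τ, dirDeriv ((0 : ℝ), e k) (dirDeriv ((0 : ℝ), e k) u) (r, z) =
      fderiv ℝ (fderiv ℝ (φ r)) z (e k) (e k) := fun r hr => by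
    rw [dirDeriv_dirDeriv_space hus hΩ (show (r, z) ∈ Ω from ⟨hr, hz0⟩)]
    exact (h.gauge r (Ioo_subset_Ico_self hr)).dirDeriv_dirDeriv hz0 _ _
  -- The time derivative, at fixed z and e_k, of the numerator minus (lam + ε(r − s)) times the
  -- denominator. As g = 1 and Dg(e_k) = 0 at z, it equals lam ψ + ∂²ψ + 2 lam ⟪z, e_k⟫ ∂ψ − ε, with
  -- ∂ the derivative along e_k. It is negative by `hstep`, but nonnegative by the maximum over
  -- earlier times.
  have tG := (((t0.pow 3).mul t2).sub
    (((((hasDerivAt_id s).sub_const s).const_mul ε).const_add lam).mul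
      (((t0.pow 2).sub ((t0.mul t1).const_mul (2 * ⟪z, e k⟫))).add
        ((t1.pow 2).mul_const (‖z‖ ^ 2)))))
  have hden : ∀ r ∈ Ioo 0 τ, ‖φ r z • e k - fderiv ℝ (φ r) z (e k) • z‖ ^ 2 =
      φ r z ^ 2 - 2 * ⟪z, e k⟫ * (φ r z * fderiv ℝ (φ r) z (e k)) +
        fderiv ℝ (φ r) z (e k) ^ 2 * ‖z‖ ^ 2 := by
    intro r _
    rw [@norm_sub_sq_real, norm_smul, norm_smul, he.orthonormal.1 k, real_inner_smul_left,
      real_inner_smul_right, real_inner_comm, mul_pow, mul_pow, Real.norm_eq_abs, Real.norm_eq_abs,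
      sq_abs, sq_abs]
    ring
  have v1 : dirDeriv ((0 : ℝ), e k) u (s, z) = 0 := by rw [e1 s hs]; exact he.tangent k
  have v2 : dirDeriv ((0 : ℝ), e k) (dirDeriv ((0 : ℝ), e k) u) (s, z) = lam := by
    rw [e2 s hs, ← hlam, ← hgdef, he.diagonal, if_pos rfl]
  have hz1' : φ s z = 1 := hz1
  have hnonneg := nonneg_of_hasDerivAt_of_le_left tG (by
    filter_upwards [Ioo_mem_nhdsLT hs.1] with r hr
    have hr' : r ∈ Ioo 0 τ := ⟨hr.1, hr.2.trans hs.2⟩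
    have h1 := hmax r ⟨hr.1, hr.2.le⟩ z hz0 (e k)
    rw [CurvatureQuotientLE, hden r hr', ← e2 r hr', ← e1 r hr'] at h1
    simp only [Pi.mul_apply, Pi.sub_apply, Pi.add_apply, Pi.pow_apply, id, v1, v2, hz1', sub_self, mul_zero, add_zero]
    linarith)
  simp only [Pi.mul_apply, Pi.sub_apply, Pi.add_apply, Pi.pow_apply, id, v1, v2, hz1', sub_self, mul_zero, add_zero] at hnonneg
  norm_num at hnonneg
  linarith

/-- The curvature estimate. -/
theorem curvatureQuotientLE [FiniteDimensional ℝ E] (hE : Module.finrank ℝ E = n + 1) (hn : 0 < n)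
    (hf : IsAdmissibleCurvatureFunction Γ f) (h : IsGaugeFlow Γ f τ φ)
    (hc1 : ContinuousOn (fun p : ℝ × E => fderiv ℝ (φ p.1) p.2) (Ico 0 τ ×ˢ {0}ᶜ))
    (hc2 : ContinuousOn (fun p : ℝ × E => fderiv ℝ (fderiv ℝ (φ p.1)) p.2) (Ico 0 τ ×ˢ {0}ᶜ))
    {Θ : ℝ} (h0 : ∀ z, z ≠ 0 → ∀ v, CurvatureQuotientLE (φ 0) Θ z v) {t : ℝ} (ht : t ∈ Ico 0 τ)
    {z : E} (hz : z ≠ 0) (v : E) : CurvatureQuotientLE (φ t) Θ z v := by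
  refine (h.gauge t ht).curvatureQuotientLE_of_sphere (fun z hz v hv hzv => ?_) hz v
  have hS : ∀ z ∈ Metric.sphere (0 : E) 1, z ≠ 0 := fun z hz => ne_zero_of_mem_unit_sphere ⟨z, hz⟩
  set N : ℝ × E × E → ℝ := fun p =>
    φ p.1 p.2.1 ^ 3 * fderiv ℝ (fderiv ℝ (φ p.1)) p.2.1 p.2.2 p.2.2 with hN
  set D : ℝ × E × E → ℝ := fun p =>
    ‖φ p.1 p.2.1 • p.2.2 - fderiv ℝ (φ p.1) p.2.1 p.2.2 • p.2.1‖ ^ 2 with hD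
  set K : Set (ℝ × E × E) := {p | p ∈ Icc 0 t ×ˢ Metric.sphere (0 : E) 1 ×ˢ Metric.sphere (0 : E) 1 ∧
    ⟪p.2.1, p.2.2⟫ = 0} with hK
  have hKc : IsCompact K := by
    refine (isCompact_Icc.prod ((isCompact_sphere (0 : E) 1).prod
      (isCompact_sphere (0 : E) 1))).inter_right (t := {p : ℝ × E × E | ⟪p.2.1, p.2.2⟫ = 0}) ?_
    exact isClosed_eq (by fun_prop) continuous_const
  have hDpos : ∀ p ∈ K, 0 < D p := fun p hp =>
    (h.gauge p.1 ⟨hp.1.1.1, hp.1.1.2.trans_lt ht.2⟩).denominator_pos (hS _ hp.1.2.1)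
      (hS _ hp.1.2.2) hp.2
  have hmaps : MapsTo (fun p : ℝ × E × E => (p.1, p.2.1)) K (Ico 0 τ ×ˢ {0}ᶜ) :=
    fun p hp => ⟨⟨hp.1.1.1, hp.1.1.2.trans_lt ht.2⟩, hS _ hp.1.2.1⟩
  have hcm : ContinuousOn (fun p : ℝ × E × E => (p.1, p.2.1)) K := by fun_prop
  have hφc : ContinuousOn (fun p : ℝ × E × E => φ p.1 p.2.1) K := h.continuousOn.comp hcm hmaps
  have h1c : ContinuousOn (fun p : ℝ × E × E => fderiv ℝ (φ p.1) p.2.1) K := hc1.comp hcm hmaps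
  have h2c : ContinuousOn (fun p : ℝ × E × E => fderiv ℝ (fderiv ℝ (φ p.1)) p.2.1) K :=
    hc2.comp hcm hmaps
  have hvc : ContinuousOn (fun p : ℝ × E × E => p.2.2) K := by fun_prop
  have hyc : ContinuousOn (fun p : ℝ × E × E => p.2.1) K := by fun_prop
  have hNc : ContinuousOn N K := (hφc.pow 3).mul ((h2c.clm_apply hvc).clm_apply hvc)
  have hDc : ContinuousOn D K := ((hφc.smul hvc).sub ((h1c.clm_apply hvc).smul hyc)).norm.pow 2
  by_contra hlt
  rw [CurvatureQuotientLE, not_le] at hlt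
  have hpK : (t, z, v) ∈ K := ⟨⟨⟨ht.1, le_rfl⟩, hz, hv⟩, hzv⟩
  have hlt' : Θ < N (t, z, v) / D (t, z, v) := (lt_div_iff₀ (hDpos _ hpK)).2 hlt
  -- As in the comparison principle, ε t makes the contradiction strict.
  obtain ⟨ε, hε, hlt'⟩ : ∃ ε > 0, Θ < N (t, z, v) / D (t, z, v) - ε * t := by
    have ht0 := ht.1
    refine ⟨(N (t, z, v) / D (t, z, v) - Θ) / (2 * (t + 1)),
      div_pos (by linarith) (by linarith), ?_⟩
    have : (N (t, z, v) / D (t, z, v) - Θ) / (2 * (t + 1)) * t < N (t, z, v) / D (t, z, v) - Θ := by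
      rw [div_mul_eq_mul_div, div_lt_iff₀ (by linarith)]
      nlinarith
    linarith
  have hqc : ContinuousOn (fun p => N p / D p - ε * p.1) K :=
    (hNc.div hDc fun p hp => (hDpos p hp).ne').sub (by fun_prop)
  obtain ⟨⟨s, y, w⟩, hsK, hmax⟩ := hKc.exists_isMaxOn ⟨_, hpK⟩ hqc
  have hval : Θ < N (s, y, w) / D (s, y, w) - ε * s := hlt'.trans_le (hmax hpK)
  have hy := hsK.1.2.1
  have hw := hsK.1.2.2
  have hsI := hsK.1.1
  simp only at hy hw hsI
  have hs0 : 0 < s := by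
    rcases hsI.1.eq_or_lt with h1 | h1
    · subst h1
      have := h0 y (hS y hy) w
      rw [mul_zero, sub_zero, lt_div_iff₀ (hDpos _ hsK)] at hval
      rw [CurvatureQuotientLE] at this
      exact absurd hval (not_lt.2 this)
    · exact h1
  refine h.curvature_max_false hE hn hf ⟨hs0, hsI.2.trans_lt ht.2⟩
    (lam := N (s, y, w) / D (s, y, w)) hε ?_ (hS y hy) (hS w hw) hsK.2
    (div_mul_cancel₀ _ (hDpos _ hsK).ne').symm
  intro r hr y' hy' v'
  have hr' : r ∈ Icc 0 t := ⟨hr.1.le, hr.2.trans hsI.2⟩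
  refine (h.gauge r ⟨hr'.1, hr'.2.trans_lt ht.2⟩).curvatureQuotientLE_of_sphere
    (fun a ha b hb hab => ?_) hy' v'
  have hrK : (r, a, b) ∈ K := ⟨⟨hr', ha, hb⟩, hab⟩
  have h1 : N (r, a, b) / D (r, a, b) - ε * r ≤ N (s, y, w) / D (s, y, w) - ε * s := hmax hrK
  have h2 : N (r, a, b) / D (r, a, b) ≤ N (s, y, w) / D (s, y, w) + ε * (r - s) := by linarith
  exact (div_le_iff₀ (hDpos _ hrK)).1 h2

end IsGaugeFlow

end CurvatureEstimate

/-! ### Families smooth up to the initial time, and smooth inverses. -/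

section PartialDerivatives

open Filter Topology Set

variable {E F : Type*} [NormedAddCommGroup E] [NormedSpace ℝ E] [NormedAddCommGroup F]
  [NormedSpace ℝ F] {I : Set ℝ} {Ω : Set E} {W : ℝ → E → F}

/-- Joint smoothness of `W` on `I × Ω`. -/
def SmoothFamily (I : Set ℝ) (Ω : Set E) (W : ℝ → E → F) : Prop :=
  ContDiffOn ℝ ∞ (fun p : ℝ × E => W p.1 p.2) (I ×ˢ Ω)

namespace SmoothFamily

lemma contDiffOn_slice (h : SmoothFamily I Ω W) {t : ℝ} (ht : t ∈ I) :
    ContDiffOn ℝ ∞ (W t) Ω :=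
  ContDiffOn.comp (g := fun p : ℝ × E => W p.1 p.2) (f := fun y : E => (t, y)) h (by fun_prop)
    fun _ hy => ⟨ht, hy⟩

lemma contDiffAt_slice (h : SmoothFamily I Ω W) (hΩ : IsOpen Ω) {t : ℝ} (ht : t ∈ I) {z : E}
    (hz : z ∈ Ω) : ContDiffAt ℝ ∞ (W t) z :=
  (h.contDiffOn_slice ht).contDiffAt (hΩ.mem_nhds hz)

lemma differentiableAt (h : SmoothFamily I Ω W) (hΩ : IsOpen Ω) {t : ℝ} (ht : t ∈ I) {z : E}
    (hz : z ∈ Ω) : DifferentiableAt ℝ (W t) z :=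
  (h.contDiffAt_slice hΩ ht hz).differentiableAt (by simp)

lemma hasFDerivWithinAt (h : SmoothFamily I Ω W) {t : ℝ} (ht : t ∈ I) {z : E} (hz : z ∈ Ω) :
    HasFDerivWithinAt (fun p : ℝ × E => W p.1 p.2)
      (fderivWithin ℝ (fun p : ℝ × E => W p.1 p.2) (I ×ˢ Ω) (t, z)) (I ×ˢ Ω) (t, z) :=
  (h.differentiableOn (by simp) (t, z) ⟨ht, hz⟩).hasFDerivWithinAt

lemma fderiv_slice (h : SmoothFamily I Ω W) (hΩ : IsOpen Ω) {t : ℝ} (ht : t ∈ I) {z : E}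
    (hz : z ∈ Ω) : fderiv ℝ (W t) z =
      (fderivWithin ℝ (fun p : ℝ × E => W p.1 p.2) (I ×ˢ Ω) (t, z)).comp
        (ContinuousLinearMap.inr ℝ ℝ E) := by
  have h1 : HasFDerivWithinAt (fun y : E => (t, y)) (ContinuousLinearMap.inr ℝ ℝ E) Ω z :=
    (hasFDerivAt_prodMk_right t z).hasFDerivWithinAt
  have h2 := (h.hasFDerivWithinAt ht hz).comp z h1 fun y hy => ⟨ht, hy⟩
  exact (h2.hasFDerivAt (hΩ.mem_nhds hz)).fderiv

/-- The spatial derivative is the restriction of the joint derivative within I × Ω, so unique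
differentiability of I gives smoothness up to the end points of I. -/
lemma fderiv (h : SmoothFamily I Ω W) (hI : UniqueDiffOn ℝ I) (hΩ : IsOpen Ω) :
    SmoothFamily I Ω fun t => fderiv ℝ (W t) := by
  have h1 : ContDiffOn ℝ ∞ (fderivWithin ℝ (fun p : ℝ × E => W p.1 p.2) (I ×ˢ Ω)) (I ×ˢ Ω) :=
    ContDiffOn.fderivWithin h (hI.prod hΩ.uniqueDiffOn) (by simp)
  have h2 : ContDiffOn ℝ ∞ (fun p => (fderivWithin ℝ (fun p : ℝ × E => W p.1 p.2) (I ×ˢ Ω) p).comp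
        (ContinuousLinearMap.inr ℝ ℝ E)) (I ×ˢ Ω) := h1.clm_comp contDiffOn_const
  exact h2.congr fun p hp => h.fderiv_slice hΩ hp.1 hp.2

lemma hasDerivWithinAt (h : SmoothFamily I Ω W) {t : ℝ} (ht : t ∈ I) {z : E} (hz : z ∈ Ω) :
    HasDerivWithinAt (fun s => W s z)
      (fderivWithin ℝ (fun p : ℝ × E => W p.1 p.2) (I ×ˢ Ω) (t, z) (1, 0)) I t := by
  have h1 : HasDerivWithinAt (fun s : ℝ => (s, z)) ((1 : ℝ), (0 : E)) I t :=
    (hasDerivWithinAt_id t I).prodMk (hasDerivWithinAt_const t I z)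
  have h2 : MapsTo (fun s : ℝ => (s, z)) I (I ×ˢ Ω) := fun s hs => ⟨hs, hz⟩
  exact HasFDerivWithinAt.comp_hasDerivWithinAt (f := fun s : ℝ => (s, z)) t
    (h.hasFDerivWithinAt ht hz) h1 h2

lemma continuousOn_derivWithin (h : SmoothFamily I Ω W) (hI : UniqueDiffOn ℝ I) (hΩ : IsOpen Ω) :
    ContinuousOn (fun p : ℝ × E => derivWithin (fun s => W s p.2) I p.1) (I ×ˢ Ω) := by
  have h1 : ContinuousOn (fderivWithin ℝ (fun p : ℝ × E => W p.1 p.2) (I ×ˢ Ω)) (I ×ˢ Ω) :=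
    ContDiffOn.continuousOn_fderivWithin h (hI.prod hΩ.uniqueDiffOn) (by simp)
  have h2 : ContinuousOn (fun p => fderivWithin ℝ (fun p : ℝ × E => W p.1 p.2) (I ×ˢ Ω) p
      ((1 : ℝ), (0 : E))) (I ×ˢ Ω) := h1.clm_apply continuousOn_const
  exact h2.congr fun p hp => (h.hasDerivWithinAt hp.1 hp.2).derivWithin (hI p.1 hp.1)

lemma mono {J : Set ℝ} (h : SmoothFamily I Ω W) (hJ : J ⊆ I) : SmoothFamily J Ω W :=
  ContDiffOn.mono h (prod_mono hJ subset_rfl)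

end SmoothFamily

/-- The continuous linear equivalence given by an injective endomorphism. -/
noncomputable def equivOfInjective [FiniteDimensional ℝ E] (A : E →L[ℝ] E) (h : Function.Injective A) :
    E ≃L[ℝ] E :=
  (LinearEquiv.ofInjectiveEndo (A : E →ₗ[ℝ] E) h).toContinuousLinearEquiv

lemma coe_equivOfInjective [FiniteDimensional ℝ E] (A : E →L[ℝ] E) (h : Function.Injective A) :
    (equivOfInjective A h : E →L[ℝ] E) = A := by
  ext v; rfl

/-- Near G a, every left inverse agrees with the local inverse of the inverse function theorem. -/
lemma contDiffAt_of_eventually_leftInverse [FiniteDimensional ℝ E] {G H : E → E} {a : E}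
    (hG : ContDiffAt ℝ ∞ G a) (hinj : Function.Injective (fderiv ℝ G a))
    (hH : ∀ᶠ y in 𝓝 a, H (G y) = y) : ContDiffAt ℝ ∞ H (G a) := by
  have hc : CompleteSpace E := FiniteDimensional.complete ℝ E
  have hd : HasFDerivAt G (equivOfInjective _ hinj : E →L[ℝ] E) a := by
    rw [coe_equivOfInjective]
    exact (hG.differentiableAt (by simp)).hasFDerivAt
  have hs := hG.hasStrictFDerivAt' hd (by simp)
  refine (hG.to_localInverse hd (by simp)).congr_of_eventuallyEq ?_
  filter_upwards [hs.localInverse_tendsto.eventually hH, hs.eventually_right_inverse] with y h1 h2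
  rw [h2] at h1
  exact h1

end PartialDerivatives

/-! ### Homogeneous local diffeomorphisms depending on time. -/

section RadialFamily

open Filter Topology Set

namespace IsRadialFamily

variable {E : Type*} [NormedAddCommGroup E] {I : Set ℝ}

lemma eventually_prod {P : ℝ × E → Prop} {t : ℝ} {ζ : E} (hζ : ζ ≠ 0)
    (h : ∀ᶠ p in 𝓝[I ×ˢ {0}ᶜ] (t, ζ), P p) : ∀ᶠ p in 𝓝[I] t ×ˢ 𝓝 ζ, P p := by
  rwa [nhdsWithin_prod_eq, isOpen_compl_singleton.nhdsWithin_eq hζ] at h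

lemma eventually_forall_compact {K : Set E} (hK : IsCompact K) {P : ℝ → E → Prop} {t : ℝ}
    (h : ∀ ζ ∈ K, ∀ᶠ p in 𝓝[I] t ×ˢ 𝓝 ζ, P p.1 p.2) : ∀ᶠ s in 𝓝[I] t, ∀ ζ ∈ K, P s ζ := by
  rw [eventually_nhdsWithin_iff]
  have h1 : ∀ᶠ s in 𝓝 t, ∀ ζ ∈ K, s ∈ I → P s ζ := by
    refine hK.eventually_forall_of_forall_eventually fun ζ hζ => ?_
    have h2 := h ζ hζ
    rw [nhdsWithin, ← nhdsWithin_univ ζ] at h2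
    rw [show 𝓟 I = 𝓟 I from rfl, ← nhdsWithin, ← nhdsWithin_prod_eq, eventually_nhdsWithin_iff] at h2
    filter_upwards [h2] with p hp hpI using hp ⟨hpI, mem_univ _⟩
  filter_upwards [h1] with s hs hsI ζ hζ using hs ζ hζ hsI

end IsRadialFamily

variable {E : Type*} [NormedAddCommGroup E] [NormedSpace ℝ E] {I : Set ℝ} {X : ℝ → E → E}

/-- A family of homogeneous immersions of `E \ {0}`: the cones over a family of hypersurfaces
which are everywhere transversal to the position vector. -/
structure IsRadialFamily (I : Set ℝ) (X : ℝ → E → E) : Prop where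
  uniqueDiffOn : UniqueDiffOn ℝ I
  homogeneous : ∀ t ∈ I, ∀ ζ, ζ ≠ 0 → ∀ l : ℝ, 0 < l → X t (l • ζ) = l • X t ζ
  ne_zero : ∀ t ∈ I, ∀ ζ, ζ ≠ 0 → X t ζ ≠ 0
  smooth : SmoothFamily I {0}ᶜ X
  immersion : ∀ t ∈ I, ∀ ζ, ζ ≠ 0 → Function.Injective (fderiv ℝ (X t) ζ)

namespace IsRadialFamily

lemma continuousWithinAt (h : IsRadialFamily I X) {t : ℝ} (ht : t ∈ I) {ζ : E} (hζ : ζ ≠ 0) :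
    ContinuousWithinAt (fun p : ℝ × E => X p.1 p.2) (I ×ˢ {0}ᶜ) (t, ζ) :=
  h.smooth.continuousOn (t, ζ) ⟨ht, hζ⟩

lemma tendsto (h : IsRadialFamily I X) {t : ℝ} (ht : t ∈ I) {ζ : E} (hζ : ζ ≠ 0) :
    Tendsto (fun p : ℝ × E => X p.1 p.2) (𝓝[I] t ×ˢ 𝓝 ζ) (𝓝 (X t ζ)) := by
  have := h.continuousWithinAt ht hζ
  rwa [ContinuousWithinAt, nhdsWithin_prod_eq, isOpen_compl_singleton.nhdsWithin_eq hζ] at this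

variable [FiniteDimensional ℝ E]

lemma exists_bounds (h : IsRadialFamily I X) {t : ℝ} (ht : t ∈ I) : ∃ m M : ℝ, 0 < m ∧ 0 < M ∧
    ∀ᶠ s in 𝓝[I] t, ∀ ζ, ζ ≠ 0 → m * ‖ζ‖ ≤ ‖X s ζ‖ ∧ ‖X s ζ‖ ≤ M * ‖ζ‖ := by
  have hK : IsCompact (Metric.sphere (0 : E) 1) := isCompact_sphere 0 1
  have h0 : ∀ ζ ∈ Metric.sphere (0 : E) 1, ζ ≠ 0 := fun ζ hζ =>
    norm_ne_zero_iff.1 (by simp [mem_sphere_zero_iff_norm.1 hζ])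
  have hc : ContinuousOn (fun ζ => ‖X t ζ‖) (Metric.sphere (0 : E) 1) :=
    ((h.smooth.contDiffOn_slice ht).continuousOn.mono h0).norm
  have hpos : ∀ ζ ∈ Metric.sphere (0 : E) 1, 0 < ‖X t ζ‖ := fun ζ hζ =>
    norm_pos_iff.2 (h.ne_zero t ht ζ (h0 ζ hζ))
  obtain ⟨a, ha⟩ := hK.bddAbove_image hc
  obtain ⟨b, hb⟩ := hK.bddAbove_image (hc.inv₀ fun ζ hζ => (hpos ζ hζ).ne')
  have hm : 0 < (|b| + 1)⁻¹ := by positivity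
  refine ⟨(|b| + 1)⁻¹, |a| + 1, hm, by positivity, ?_⟩
  have h1 : ∀ᶠ s in 𝓝[I] t, ∀ ζ ∈ Metric.sphere (0 : E) 1,
      (|b| + 1)⁻¹ < ‖X s ζ‖ ∧ ‖X s ζ‖ < |a| + 1 := by
    refine eventually_forall_compact hK fun ζ hζ => ?_
    have h2 := (h.tendsto ht (h0 ζ hζ)).norm
    refine (h2.eventually_const_lt ?_).and (h2.eventually_lt_const ?_)
    · refine inv_lt_of_inv_lt₀ (hpos ζ hζ) ?_
      have := hb ⟨ζ, hζ, rfl⟩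
      have h4 := le_abs_self b
      simp only [Pi.inv_apply] at this
      linarith
    · have := ha ⟨ζ, hζ, rfl⟩
      have h4 := le_abs_self a
      simp only at this
      linarith
  filter_upwards [h1, self_mem_nhdsWithin] with s hs hsI ζ hζ
  have hn : 0 < ‖ζ‖ := norm_pos_iff.2 hζ
  have h3 := hs (‖ζ‖⁻¹ • ζ) (by simp [norm_smul, hn.ne'])
  rw [h.homogeneous s hsI ζ hζ _ (inv_pos.2 hn), norm_smul, norm_inv, norm_norm,
    inv_mul_eq_div, lt_div_iff₀ hn, div_lt_iff₀ hn] at h3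
  exact ⟨h3.1.le, h3.2.le⟩

/-- One ball and one linear map serve for all times near t, by joint continuity of the derivative.
This makes local injectivity and local surjectivity uniform in time. -/
lemma exists_approximatesLinearOn [Nontrivial E] (h : IsRadialFamily I X) {t : ℝ} (ht : t ∈ I)
    {ζ : E} (hζ : ζ ≠ 0) : ∃ A : E ≃L[ℝ] E, ∃ c : NNReal, c < ‖(A.symm : E →L[ℝ] E)‖₊⁻¹ ∧ ∃ r : ℝ, 0 < r ∧
      Metric.closedBall ζ r ⊆ {0}ᶜ ∧ ∀ᶠ s in 𝓝[I] t,
        ApproximatesLinearOn (X s) (A : E →L[ℝ] E) (Metric.closedBall ζ r) c := by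
  set A := equivOfInjective _ (h.immersion t ht ζ hζ) with hA
  have hpos : 0 < ‖(A.symm : E →L[ℝ] E)‖₊⁻¹ := inv_pos.2 A.nnnorm_symm_pos
  refine ⟨A, ‖(A.symm : E →L[ℝ] E)‖₊⁻¹ / 2, half_lt_self hpos, ?_⟩
  set c := ‖(A.symm : E →L[ℝ] E)‖₊⁻¹ / 2 with hc
  have hcpos : 0 < c := half_pos hpos
  have h1 : ContinuousWithinAt (fun p : ℝ × E => fderiv ℝ (X p.1) p.2) (I ×ˢ {0}ᶜ) (t, ζ) :=
    (h.smooth.fderiv h.uniqueDiffOn isOpen_compl_singleton).continuousOn (t, ζ) ⟨ht, hζ⟩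
  have h2 := eventually_prod hζ (h1.eventually (Metric.ball_mem_nhds _ (NNReal.coe_pos.2 hcpos)))
  obtain ⟨P, hP, Q, hQ, hPQ⟩ := eventually_prod_iff.1 h2
  obtain ⟨r, hr, hrQ⟩ := Metric.nhds_basis_closedBall.eventually_iff.1
    (hQ.and (isOpen_compl_singleton.eventually_mem hζ))
  refine ⟨r, hr, fun y hy => (hrQ hy).2, ?_⟩
  filter_upwards [hP, self_mem_nhdsWithin] with s hs hsI
  intro y hy w hw
  refine (convex_closedBall ζ r).norm_image_sub_le_of_norm_fderiv_le'
    (fun v hv => h.smooth.differentiableAt isOpen_compl_singleton hsI (hrQ hv).2)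
    (fun v hv => ?_) hw hy
  have := hPQ hs (hrQ hv).1
  rw [hA, coe_equivOfInjective, ← dist_eq_norm]
  exact (Metric.mem_ball.1 this).le

lemma eventually_injOn [Nontrivial E] (h : IsRadialFamily I X) {t : ℝ} (ht : t ∈ I)
    {ζ : E} (hζ : ζ ≠ 0) : ∃ V ∈ 𝓝 ζ, ∀ᶠ s in 𝓝[I] t, InjOn (X s) V := by
  obtain ⟨A, c, hc, r, hr, -, hs⟩ := h.exists_approximatesLinearOn ht hζ
  refine ⟨Metric.closedBall ζ r, Metric.closedBall_mem_nhds ζ hr, ?_⟩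
  filter_upwards [hs] with s hs using hs.injOn (Or.inr hc)

/-- The image of a small ball under X s contains a ball around X s ζ whose radius δ does not depend
on s, and X s ζ → X t ζ. -/
lemma eventually_surjOn [Nontrivial E] (h : IsRadialFamily I X) {t : ℝ} (ht : t ∈ I)
    {ζ : E} (hζ : ζ ≠ 0) {V : Set E} (hV : V ∈ 𝓝 ζ) :
    ∀ᶠ p in 𝓝[I] t ×ˢ 𝓝 (X t ζ), p.2 ∈ X p.1 '' (V ∩ {0}ᶜ) := by
  obtain ⟨A, c, hc, r, hr, hr0, hs⟩ := h.exists_approximatesLinearOn ht hζ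
  obtain ⟨r', hr', hrV⟩ := Metric.nhds_basis_closedBall.mem_iff.1 hV
  set ε := min r r' with hε
  have hε0 : 0 < ε := lt_min hr hr'
  set δ := (((‖(A.symm : E →L[ℝ] E)‖₊⁻¹ : NNReal) : ℝ) - c) * ε with hδ
  have hδ0 : 0 < δ := mul_pos (sub_pos.2 (NNReal.coe_lt_coe.2 hc)) hε0
  have h1 : Tendsto (fun s => X s ζ) (𝓝[I] t) (𝓝 (X t ζ)) :=
    (h.tendsto ht hζ).comp (tendsto_id.prodMk tendsto_const_nhds)
  have h2 : ∀ᶠ p in 𝓝[I] t ×ˢ 𝓝 (X t ζ), dist p.2 (X p.1 ζ) < δ := by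
    have h3 : Tendsto (fun p : ℝ × E => dist p.2 (X p.1 ζ)) (𝓝[I] t ×ˢ 𝓝 (X t ζ)) (𝓝 0) := by
      have := (tendsto_snd (f := 𝓝[I] t) (g := 𝓝 (X t ζ))).dist (h1.comp tendsto_fst)
      rwa [dist_self] at this
    exact h3.eventually_lt_const hδ0
  filter_upwards [h2, hs.prod_inl (𝓝 (X t ζ))] with p hp hps
  have h4 := hps.surjOn_closedBall_of_nonlinearRightInverse A.toNonlinearRightInverse hε0.le
    (Metric.closedBall_subset_closedBall (min_le_left r r'))
  obtain ⟨y, hy, hyp⟩ := h4 (show p.2 ∈ _ from by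
    rw [Metric.mem_closedBall]
    exact hp.le)
  exact ⟨y, ⟨hrV (Metric.closedBall_subset_closedBall (min_le_right _ _) hy),
    hr0 (Metric.closedBall_subset_closedBall (min_le_left _ _) hy)⟩, hyp⟩

end IsRadialFamily

end RadialFamily

/-! ### Global invertibility and regularity of the inverse. -/

section RadialInverse

open Filter Topology Set

namespace IsRadialFamily

section

variable {E : Type*} [NormedAddCommGroup E] [NormedSpace ℝ E] {I : Set ℝ} {X : ℝ → E → E}
  [FiniteDimensional ℝ E]

/-- By homogeneity one of two points with equal image has norm one; the bounds on X confine the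
other to a compact annulus. On this compact set of pairs, uniform local injectivity handles the
diagonal and continuity the rest. -/
lemma eventually_injOn_of_injOn [Nontrivial E] (h : IsRadialFamily I X) {t : ℝ} (ht : t ∈ I)
    (hinj : InjOn (X t) {0}ᶜ) : ∀ᶠ s in 𝓝[I] t, InjOn (X s) {0}ᶜ := by
  obtain ⟨m, M, hm, hM, hb⟩ := h.exists_bounds ht
  set R := M / m with hR
  set K : Set E := Metric.sphere 0 1 with hKdef
  set L : Set E := {ζ | m / M ≤ ‖ζ‖} ∩ Metric.closedBall 0 R with hLdef
  have hK : IsCompact K := isCompact_sphere 0 1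
  have hL : IsCompact L := (isCompact_closedBall _ _).inter_left
    (isClosed_le continuous_const continuous_norm)
  have hK0 : ∀ ζ ∈ K, ζ ≠ 0 := fun ζ hζ =>
    norm_ne_zero_iff.1 (by simp [mem_sphere_zero_iff_norm.1 hζ])
  have hL0 : ∀ ζ ∈ L, ζ ≠ 0 := fun ζ hζ =>
    norm_pos_iff.1 ((div_pos hm hM).trans_le hζ.1)
  have h1 : ∀ᶠ s in 𝓝[I] t, ∀ p ∈ K ×ˢ L, X s p.1 = X s p.2 → p.1 = p.2 := by
    refine eventually_forall_compact (hK.prod hL)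
      (P := fun s (p : E × E) => X s p.1 = X s p.2 → p.1 = p.2) fun p hp => ?_
    have ha := hK0 _ hp.1
    have hb := hL0 _ hp.2
    have e1 : Tendsto (fun q : ℝ × E × E => (q.1, q.2.1)) (𝓝[I] t ×ˢ 𝓝 p) (𝓝[I] t ×ˢ 𝓝 p.1) :=
      tendsto_fst.prodMk ((continuous_fst.tendsto p).comp tendsto_snd)
    have e2 : Tendsto (fun q : ℝ × E × E => (q.1, q.2.2)) (𝓝[I] t ×ˢ 𝓝 p) (𝓝[I] t ×ˢ 𝓝 p.2) :=
      tendsto_fst.prodMk ((continuous_snd.tendsto p).comp tendsto_snd)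
    by_cases heq : p.1 = p.2
    · obtain ⟨V, hV, hs⟩ := h.eventually_injOn ht ha
      have e3 := e1.eventually (hs.prod_inl _ |>.and (Eventually.prod_inr hV _))
      have e4 := e2.eventually (Eventually.prod_inr (heq ▸ hV) (𝓝[I] t))
      filter_upwards [e3, e4] with q hq hq' hX using hq.1 hq.2 hq' hX
    · have hne : X t p.1 ≠ X t p.2 := fun hX => heq (hinj ha hb hX)
      have e5 := ((h.tendsto ht ha).comp e1).prodMk_nhds ((h.tendsto ht hb).comp e2)
      have e6 := e5.eventually (isOpen_ne_fun continuous_fst continuous_snd |>.eventually_mem hne)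
      filter_upwards [e6] with q hq hX using absurd hX hq
  filter_upwards [h1, hb, self_mem_nhdsWithin] with s hs hbs hsI ζ hζ η hη hX
  have hn : 0 < ‖ζ‖ := norm_pos_iff.2 hζ
  have hX' : X s (‖ζ‖⁻¹ • ζ) = X s (‖ζ‖⁻¹ • η) := by
    rw [h.homogeneous s hsI ζ hζ _ (inv_pos.2 hn), h.homogeneous s hsI η hη _ (inv_pos.2 hn), hX]
  have hζ1 : ‖‖ζ‖⁻¹ • ζ‖ = 1 := by simp [norm_smul, hn.ne']
  have hζ0 : ‖ζ‖⁻¹ • ζ ≠ 0 := smul_ne_zero (inv_pos.2 hn).ne' hζ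
  have hη0 : ‖ζ‖⁻¹ • η ≠ 0 := smul_ne_zero (inv_pos.2 hn).ne' hη
  have b1 := hbs _ hζ0
  have b2 := hbs _ hη0
  rw [← hX'] at b2
  rw [hζ1] at b1
  have hmem : ‖ζ‖⁻¹ • η ∈ L := by
    refine ⟨?_, ?_⟩
    · rw [mem_ofPred_eq, div_le_iff₀ hM]; linarith [b1.1, b2.2]
    · rw [mem_closedBall_zero_iff, hR, le_div_iff₀ hm]; linarith [b1.2, b2.1]
  have := hs (_, _) ⟨mem_sphere_zero_iff_norm.2 hζ1, hmem⟩ hX'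
  exact smul_right_injective E (inv_pos.2 hn).ne' this

/-- If ζ ≠ η have the same image under X t, then for s near t this image is attained by X s in each
of two disjoint neighbourhoods. -/
lemma eventually_not_injOn [Nontrivial E] (h : IsRadialFamily I X) {t : ℝ} (ht : t ∈ I)
    (hinj : ¬ InjOn (X t) {0}ᶜ) : ∀ᶠ s in 𝓝[I] t, ¬ InjOn (X s) {0}ᶜ := by
  simp only [InjOn] at hinj
  push Not at hinj
  obtain ⟨ζ, hζ, η, hη, hX, hne⟩ := hinj
  obtain ⟨V, V', hV, hV', hζV, hηV, hd⟩ := t2_separation hne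
  have e1 := h.eventually_surjOn ht hζ (hV.mem_nhds hζV)
  have e2 := h.eventually_surjOn ht hη (hV'.mem_nhds hηV)
  rw [← hX] at e2
  obtain ⟨p, hp, q, hq, hpq⟩ := eventually_prod_iff.1 (e1.and e2)
  filter_upwards [hp] with s hs hinj
  obtain ⟨⟨y, hy, hyX⟩, ⟨w, hw, hwX⟩⟩ := hpq hs hq.self_of_nhds
  have : y = w := hinj hy.2 hw.2 (by simpa using hyX.trans hwX.symm)
  exact disjoint_left.1 hd hy.1 (this ▸ hw.1)

lemma injOn [Nontrivial E] (h : IsRadialFamily I X) (hI : IsPreconnected I) {t t₀ : ℝ}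
    (ht₀ : t₀ ∈ I) (hinj : InjOn (X t₀) {0}ᶜ) (ht : t ∈ I) : InjOn (X t) {0}ᶜ := by
  have := hI.induction₂ (fun s t => InjOn (X s) {0}ᶜ ↔ InjOn (X t) {0}ᶜ) (fun s hs => ?_)
    (fun _ _ _ _ _ _ h h' => h.trans h') (fun _ _ _ _ h => h.symm) ht₀ ht
  · exact this.1 hinj
  · by_cases hs' : InjOn (X s) {0}ᶜ
    · filter_upwards [h.eventually_injOn_of_injOn hs hs'] with r hr using iff_of_true hs' hr
    · filter_upwards [h.eventually_not_injOn hs hs'] with r hr using iff_of_false hs' hr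

/-- The image is open, and relatively closed because preimages of points near z ≠ 0 stay in a
compact annulus. The complement of the origin is connected in dimension at least two. -/
lemma surjOn (h : IsRadialFamily I X) (hE : 1 < Module.rank ℝ E) {t : ℝ} (ht : t ∈ I) :
    SurjOn (X t) {0}ᶜ {0}ᶜ := by
  have hnt : Nontrivial E := rank_pos_iff_nontrivial.1 (zero_lt_one.trans hE)
  have hconn := isConnected_compl_singleton_of_one_lt_rank hE (0 : E)
  refine hconn.isPreconnected.subset_of_closure_inter_subset (isOpen_iff_mem_nhds.2 ?_) ?_ ?_
  · rintro _ ⟨ζ, hζ, rfl⟩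
    obtain ⟨p, hp, q, hq, hpq⟩ := eventually_prod_iff.1 (h.eventually_surjOn ht hζ univ_mem)
    filter_upwards [hq] with z hz
    obtain ⟨y, hy, hyz⟩ := hpq (hp.self_of_nhdsWithin ht) hz
    exact ⟨y, hy.2, hyz⟩
  · obtain ⟨ζ, hζ⟩ := exists_ne (0 : E)
    exact ⟨X t ζ, h.ne_zero t ht ζ hζ, ζ, hζ, rfl⟩
  · rintro z ⟨hz, hz0⟩
    obtain ⟨m, M, hm, hM, hb⟩ := h.exists_bounds ht
    replace hb := hb.self_of_nhdsWithin ht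
    have hn : 0 < ‖z‖ := norm_pos_iff.2 hz0
    set L : Set E := {ζ | ‖z‖ / 2 / M ≤ ‖ζ‖} ∩ Metric.closedBall 0 (2 * ‖z‖ / m) with hLdef
    have hL : IsCompact L := (isCompact_closedBall _ _).inter_left
      (isClosed_le continuous_const continuous_norm)
    have hL0 : L ⊆ {0}ᶜ := fun ζ hζ =>
      norm_pos_iff.1 ((div_pos (half_pos hn) hM).trans_le hζ.1)
    have hcl : IsClosed (X t '' L) :=
      (hL.image_of_continuousOn ((h.smooth.contDiffOn_slice ht).continuousOn.mono hL0)).isClosed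
    refine image_mono hL0 (hcl.closure_subset ?_)
    rw [mem_closure_iff_frequently] at hz ⊢
    refine (hz.and_eventually (Metric.ball_mem_nhds z (half_pos hn))).mono ?_
    rintro _ ⟨⟨ζ, hζ, rfl⟩, hball⟩
    refine ⟨ζ, ?_, rfl⟩
    have h1 := abs_le.1 ((abs_norm_sub_norm_le (X t ζ) z).trans (by
      exact (mem_ball_iff_norm.1 hball).le))
    have h2 := hb ζ hζ
    refine ⟨?_, ?_⟩
    · rw [mem_ofPred_eq, div_le_iff₀ hM]; linarith
    · rw [mem_closedBall_zero_iff, le_div_iff₀ hm]; linarith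

end

end IsRadialFamily

/-- The inverse of the map `X` on `E \ {0}`. -/
noncomputable def radialInverse {E : Type*} [NormedAddCommGroup E] (X : E → E) : E → E :=
  Function.invFunOn X {0}ᶜ

section

variable {E : Type*} [NormedAddCommGroup E]

lemma radialInverse_apply {Y : E → E} (hinj : InjOn Y {0}ᶜ) {ζ : E} (hζ : ζ ≠ 0) :
    radialInverse Y (Y ζ) = ζ := by
  exact hinj.leftInvOn_invFunOn hζ

lemma apply_radialInverse {Y : E → E} (hs : SurjOn Y {0}ᶜ {0}ᶜ) {z : E} (hz : z ≠ 0) :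
    Y (radialInverse Y z) = z := Function.invFunOn_eq (hs hz)

lemma radialInverse_ne_zero {Y : E → E} (hs : SurjOn Y {0}ᶜ {0}ᶜ) {z : E} (hz : z ≠ 0) :
    radialInverse Y z ≠ 0 := Function.invFunOn_mem (hs hz)

end

namespace IsRadialFamily

variable {E : Type*} [NormedAddCommGroup E] [NormedSpace ℝ E] {I : Set ℝ} {X : ℝ → E → E}

lemma radialInverse_smul (h : IsRadialFamily I X) {t : ℝ} (ht : t ∈ I) (hinj : InjOn (X t) {0}ᶜ)
    (hs : SurjOn (X t) {0}ᶜ {0}ᶜ) {z : E} (hz : z ≠ 0) {l : ℝ} (hl : 0 < l) :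
    radialInverse (X t) (l • z) = l • radialInverse (X t) z := by
  have h0 := radialInverse_ne_zero hs hz
  conv_lhs => rw [← apply_radialInverse hs hz, ← h.homogeneous t ht _ h0 l hl]
  exact radialInverse_apply hinj (smul_ne_zero hl.ne' h0)

variable [FiniteDimensional ℝ E]

lemma contDiffOn_radialInverse (h : IsRadialFamily I X) {t : ℝ} (ht : t ∈ I)
    (hinj : InjOn (X t) {0}ᶜ) (hs : SurjOn (X t) {0}ᶜ {0}ᶜ) :
    ContDiffOn ℝ ∞ (radialInverse (X t)) {0}ᶜ := by
  intro z hz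
  have h0 := radialInverse_ne_zero hs hz
  rw [← apply_radialInverse hs hz]
  refine (contDiffAt_of_eventually_leftInverse (h.smooth.contDiffAt_slice isOpen_compl_singleton ht h0)
    (h.immersion t ht _ h0) ?_).contDiffWithinAt
  filter_upwards [isOpen_compl_singleton.mem_nhds h0] with y hy using radialInverse_apply hinj hy

lemma continuousOn_radialInverse [Nontrivial E] (h : IsRadialFamily I X)
    (hinj : ∀ t ∈ I, InjOn (X t) {0}ᶜ) (hs : ∀ t ∈ I, SurjOn (X t) {0}ᶜ {0}ᶜ) :
    ContinuousOn (fun p : ℝ × E => radialInverse (X p.1) p.2) (I ×ˢ {0}ᶜ) := by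
  rintro ⟨t, z⟩ ⟨ht, hz⟩
  have h0 := radialInverse_ne_zero (hs t ht) hz
  rw [ContinuousWithinAt, nhdsWithin_prod_eq, isOpen_compl_singleton.nhdsWithin_eq hz]
  refine tendsto_iff_eventually.2 fun p hp => ?_
  obtain ⟨V, hV, hVp⟩ := eventually_iff_exists_mem.1 hp
  have h1 := h.eventually_surjOn ht h0 hV
  rw [apply_radialInverse (hs t ht) hz] at h1
  filter_upwards [h1, Eventually.prod_inl (self_mem_nhdsWithin (a := t) (s := I)) (𝓝 z)] with q hq hqI
  obtain ⟨y, hy, hyp⟩ := hq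
  refine hVp _ ?_
  rw [← hyp, radialInverse_apply (hinj q.1 hqI) hy.2]
  exact hy.1

/-- Inverse function theorem for (t, ζ) ↦ (t, X t ζ), which needs a full neighbourhood in time. -/
lemma smoothFamily_radialInverse (h : IsRadialFamily I X)
    (hinj : ∀ t ∈ I, InjOn (X t) {0}ᶜ) (hs : ∀ t ∈ I, SurjOn (X t) {0}ᶜ {0}ᶜ) :
    SmoothFamily (interior I) {0}ᶜ fun t => radialInverse (X t) := by
  rintro ⟨t, z⟩ ⟨ht, hz⟩
  have htI := interior_subset ht
  have h0 := radialInverse_ne_zero (hs t htI) hz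
  set ζ := radialInverse (X t) z with hζ
  set Ψ : ℝ × E → ℝ × E := fun p => (p.1, X p.1 p.2) with hΨ
  have hopen : interior I ×ˢ ({0}ᶜ : Set E) ∈ 𝓝 (t, ζ) :=
    (isOpen_interior.prod isOpen_compl_singleton).mem_nhds ⟨ht, h0⟩
  have hX : ContDiffAt ℝ ∞ (fun p : ℝ × E => X p.1 p.2) (t, ζ) :=
    (h.smooth.mono interior_subset).contDiffAt hopen
  have hΨs : ContDiffAt ℝ ∞ Ψ (t, ζ) := contDiffAt_fst.prodMk hX
  have hd := (hX.differentiableAt (by simp)).hasFDerivAt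
  have hslice : fderiv ℝ (X t) ζ = (fderiv ℝ (fun p : ℝ × E => X p.1 p.2) (t, ζ)).comp
      (ContinuousLinearMap.inr ℝ ℝ E) := (hd.comp ζ (hasFDerivAt_prodMk_right t ζ)).fderiv
  have hΨd : fderiv ℝ Ψ (t, ζ) = (ContinuousLinearMap.fst ℝ ℝ E).prod
      (fderiv ℝ (fun p : ℝ × E => X p.1 p.2) (t, ζ)) := (hasFDerivAt_fst.prodMk hd).fderiv
  have hinjΨ : Function.Injective (fderiv ℝ Ψ (t, ζ)) := by
    rw [injective_iff_map_eq_zero]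
    rintro ⟨a, v⟩ hav
    rw [hΨd] at hav
    have ha : a = 0 := congrArg Prod.fst hav
    subst ha
    have hv : fderiv ℝ (X t) ζ v = 0 := by
      rw [hslice]; exact congrArg Prod.snd hav
    have := (injective_iff_map_eq_zero _).1 (h.immersion t htI ζ h0) v hv
    rw [this]; rfl
  have key := contDiffAt_of_eventually_leftInverse (H := fun p : ℝ × E => (p.1, radialInverse (X p.1) p.2))
    hΨs hinjΨ (by
      filter_upwards [hopen] with p hp
      simp only [hΨ]
      rw [radialInverse_apply (hinj p.1 (interior_subset hp.1)) hp.2])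
  have hval : Ψ (t, ζ) = (t, z) := by
    simp only [hΨ, hζ]
    rw [apply_radialInverse (hs t htI) hz]
  rw [hval] at key
  exact (contDiffAt_snd.comp (t, z) key).contDiffWithinAt

end IsRadialFamily

end RadialInverse

/-! ### The gauge of a starshaped flow and its derivatives. -/

section StarshapedFlow

open Filter Topology Set

/-- `w` is a frame at `ζ`, orthogonal to `ζ`, whose image under `DX` is an orthonormal frame of
principal directions with principal curvatures `κ`. -/
structure IsCurvatureFrame {n : ℕ} {E : Type*} [NormedAddCommGroup E] [InnerProductSpace ℝ E]
    (X N : E → E) (ζ : E) (κ : Fin n → ℝ) (w : Fin n → E) : Prop where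
  tangent : ∀ i, ⟪ζ, w i⟫ = 0
  orthonormal : Orthonormal ℝ fun i => fderiv ℝ X ζ (w i)
  diagonal : ∀ i j, ⟪fderiv ℝ N ζ (w i), fderiv ℝ X ζ (w j)⟫ = if i = j then κ i else 0

/-- A solution of the flow with positive support function. The parametrization `X` and the unit
normal `N` are extended to `E \ {0}` homogeneously of degree one and zero. -/
structure IsStarshapedFlow {n : ℕ} {E : Type*} [NormedAddCommGroup E] [InnerProductSpace ℝ E]
    (Γ : Set (Fin n → ℝ)) (f : (Fin n → ℝ) → ℝ) (I : Set ℝ) (X N : ℝ → E → E) : Prop where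
  uniqueDiffOn : UniqueDiffOn ℝ I
  position_smul : ∀ t ∈ I, ∀ ζ, ζ ≠ 0 → ∀ l : ℝ, 0 < l → X t (l • ζ) = l • X t ζ
  normal_smul : ∀ t ∈ I, ∀ ζ, ζ ≠ 0 → ∀ l : ℝ, 0 < l → N t (l • ζ) = N t ζ
  smooth_position : SmoothFamily I {0}ᶜ X
  smooth_normal : SmoothFamily I {0}ᶜ N
  norm_normal : ∀ t ∈ I, ∀ ζ, ζ ≠ 0 → ‖N t ζ‖ = 1
  orthogonal : ∀ t ∈ I, ∀ ζ, ζ ≠ 0 → ∀ w, ⟪ζ, w⟫ = 0 → ⟪fderiv ℝ (X t) ζ w, N t ζ⟫ = 0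
  support_pos : ∀ t ∈ I, ∀ ζ, ζ ≠ 0 → 0 < ⟪X t ζ, N t ζ⟫
  injOn : ∀ t ∈ I, InjOn (X t) {0}ᶜ
  evolution : ∀ t ∈ I, ∀ ζ, ‖ζ‖ = 1 → ∃ κ ∈ Γ, ∃ w : Fin n → E,
    IsCurvatureFrame (X t) (N t) ζ κ w ∧
    HasDerivWithinAt (fun s => X s ζ) ((1 / f κ - ⟪X t ζ, N t ζ⟫ / n) • N t ζ) I t

/-- The gauge whose level set `1` is the image of the unit sphere under `X t`. -/
noncomputable def radialGauge {E : Type*} [NormedAddCommGroup E] (X : ℝ → E → E) (t : ℝ) (z : E) :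
    ℝ :=
  ‖radialInverse (X t) z‖

lemma exists_smul_add_orthogonal {E : Type*} [NormedAddCommGroup E] [InnerProductSpace ℝ E] {ζ : E}
    (hζ : ζ ≠ 0) (w : E) : ∃ w₀, ⟪ζ, w₀⟫ = 0 ∧ w = (⟪ζ, w⟫ / ‖ζ‖ ^ 2) • ζ + w₀ := by
  refine ⟨w - (⟪ζ, w⟫ / ‖ζ‖ ^ 2) • ζ, ?_, by abel⟩
  have hn : ‖ζ‖ ≠ 0 := norm_ne_zero_iff.2 hζ
  rw [inner_sub_right, inner_smul_right, real_inner_self_eq_norm_sq]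
  field_simp
  ring

namespace IsStarshapedFlow

variable {n : ℕ} {E : Type*} [NormedAddCommGroup E] [InnerProductSpace ℝ E]
  {Γ : Set (Fin n → ℝ)} {f : (Fin n → ℝ) → ℝ} {I : Set ℝ} {X N : ℝ → E → E} {t : ℝ} {ζ : E}

lemma position_ne_zero (h : IsStarshapedFlow Γ f I X N) (ht : t ∈ I) (hζ : ζ ≠ 0) : X t ζ ≠ 0 := by
  intro h0
  have := h.support_pos t ht ζ hζ
  rw [h0, inner_zero_left] at this
  exact lt_irrefl _ this

lemma differentiableAt_position (h : IsStarshapedFlow Γ f I X N) (ht : t ∈ I) (hζ : ζ ≠ 0) :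
    DifferentiableAt ℝ (X t) ζ := h.smooth_position.differentiableAt isOpen_compl_singleton ht hζ

lemma differentiableAt_normal (h : IsStarshapedFlow Γ f I X N) (ht : t ∈ I) (hζ : ζ ≠ 0) :
    DifferentiableAt ℝ (N t) ζ := h.smooth_normal.differentiableAt isOpen_compl_singleton ht hζ

lemma fderiv_position_self (h : IsStarshapedFlow Γ f I X N) (ht : t ∈ I) (hζ : ζ ≠ 0) :
    fderiv ℝ (X t) ζ ζ = X t ζ := by
  have h2 : HasDerivAt (fun l : ℝ => X t (l • ζ)) (fderiv ℝ (X t) ζ ζ) 1 :=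
    HasFDerivAt.comp_hasDerivAt (1 : ℝ)
      (by simpa using (h.differentiableAt_position ht hζ).hasFDerivAt) (IsGauge.hasDerivAt_ray ζ)
  refine h2.unique ((IsGauge.hasDerivAt_ray (X t ζ)).congr_of_eventuallyEq ?_)
  filter_upwards [lt_mem_nhds (zero_lt_one' ℝ)] with l hl using h.position_smul t ht ζ hζ l hl

lemma fderiv_position_smul (h : IsStarshapedFlow Γ f I X N) (ht : t ∈ I) (hζ : ζ ≠ 0) {l : ℝ}
    (hl : 0 < l) : fderiv ℝ (X t) (l • ζ) = fderiv ℝ (X t) ζ := by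
  have h1 : (fun y => X t (l • y)) =ᶠ[𝓝 ζ] fun y => l • X t y := by
    filter_upwards [isOpen_compl_singleton.mem_nhds hζ] with y hy using h.position_smul t ht y hy l hl
  have h2 := h1.fderiv_eq (𝕜 := ℝ)
  rw [fderiv_comp_smul, fderiv_fun_const_smul (h.differentiableAt_position ht hζ)] at h2
  exact smul_right_injective _ hl.ne' h2

/-- DX maps the principal frame to an orthonormal basis of the hyperplane orthogonal to N, and ζ to
X, which is transversal to this hyperplane since the support function is positive. -/
lemma surjective_fderiv_of_norm_eq_one [FiniteDimensional ℝ E] (hE : Module.finrank ℝ E = n + 1)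
    (h : IsStarshapedFlow Γ f I X N) (ht : t ∈ I) (hζ : ‖ζ‖ = 1) :
    Function.Surjective (fderiv ℝ (X t) ζ) := by
  have hζ0 : ζ ≠ 0 := norm_ne_zero_iff.1 (by simp [hζ])
  obtain ⟨κ, -, w, hw, -⟩ := h.evolution t ht ζ hζ
  have hu := h.support_pos t ht ζ hζ0
  intro v
  set a := ⟪v, N t ζ⟫ / ⟪X t ζ, N t ζ⟫ with ha
  have hp : innerSL ℝ (N t ζ) ≠ 0 := by
    intro h0
    have := congrArg norm h0
    rw [innerSL_apply_norm, h.norm_normal t ht ζ hζ0] at this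
    simp at this
  have hv : innerSL ℝ (N t ζ) (v - a • X t ζ) = 0 := by
    rw [innerSL_apply_apply, inner_sub_right, inner_smul_right, real_inner_comm, ha,
      real_inner_comm (X t ζ), div_mul_cancel₀ _ hu.ne', sub_self]
  have h1 := eq_sum_inner_of_orthonormal hE hw.orthonormal hp (fun i => by
    rw [innerSL_apply_apply, real_inner_comm]
    exact h.orthogonal t ht ζ hζ0 _ (hw.tangent i)) hv
  refine ⟨a • ζ + ∑ i, ⟪fderiv ℝ (X t) ζ (w i), v - a • X t ζ⟫ • w i, ?_⟩
  rw [map_add, map_smul, h.fderiv_position_self ht hζ0, map_sum]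
  simp only [map_smul]
  rw [← h1]
  abel

lemma surjective_fderiv [FiniteDimensional ℝ E] (hE : Module.finrank ℝ E = n + 1)
    (h : IsStarshapedFlow Γ f I X N) (ht : t ∈ I) (hζ : ζ ≠ 0) :
    Function.Surjective (fderiv ℝ (X t) ζ) := by
  have hn : 0 < ‖ζ‖ := norm_pos_iff.2 hζ
  rw [← h.fderiv_position_smul ht hζ (inv_pos.2 hn)]
  exact h.surjective_fderiv_of_norm_eq_one hE ht (by simp [norm_smul, hn.ne'])

lemma injective_fderiv [FiniteDimensional ℝ E] (hE : Module.finrank ℝ E = n + 1)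
    (h : IsStarshapedFlow Γ f I X N) (ht : t ∈ I) (hζ : ζ ≠ 0) :
    Function.Injective (fderiv ℝ (X t) ζ) :=
  (LinearMap.injective_iff_surjective (f := (fderiv ℝ (X t) ζ : E →ₗ[ℝ] E))).2
    (h.surjective_fderiv hE ht hζ)

lemma radialGauge_apply (h : IsStarshapedFlow Γ f I X N) (ht : t ∈ I) (hζ : ζ ≠ 0) :
    radialGauge X t (X t ζ) = ‖ζ‖ := by
  rw [radialGauge, radialInverse_apply (h.injOn t ht) hζ]

/-- The gradient of the gauge, in the parametrization. -/
noncomputable def gaugeGradient (X N : ℝ → E → E) (t : ℝ) (ζ : E) : E :=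
  (‖ζ‖ * ⟪X t ζ, N t ζ⟫⁻¹) • N t ζ

lemma smooth_gaugeGradient (h : IsStarshapedFlow Γ f I X N) :
    SmoothFamily I {0}ᶜ (gaugeGradient X N) := by
  have h1 : ContDiffOn ℝ ∞ (fun p : ℝ × E => ‖p.2‖) (I ×ˢ {0}ᶜ) :=
    contDiffOn_snd.norm ℝ fun p hp => hp.2
  have h2 : ContDiffOn ℝ ∞ (fun p : ℝ × E => ⟪X p.1 p.2, N p.1 p.2⟫⁻¹) (I ×ˢ {0}ᶜ) :=
    (ContDiffOn.inner ℝ h.smooth_position h.smooth_normal).inv fun p hp =>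
      (h.support_pos p.1 hp.1 p.2 hp.2).ne'
  exact (h1.mul h2).smul h.smooth_normal

variable [FiniteDimensional ℝ E]

lemma isRadialFamily (hE : Module.finrank ℝ E = n + 1) (h : IsStarshapedFlow Γ f I X N) :
    IsRadialFamily I X where
  uniqueDiffOn := h.uniqueDiffOn
  homogeneous := h.position_smul
  ne_zero _ ht _ hζ := h.position_ne_zero ht hζ
  smooth := h.smooth_position
  immersion _ ht _ hζ := h.injective_fderiv hE ht hζ

lemma surjOn (hE : Module.finrank ℝ E = n + 1) (hn : 0 < n) (h : IsStarshapedFlow Γ f I X N)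
    (ht : t ∈ I) : SurjOn (X t) {0}ᶜ {0}ᶜ := by
  refine (h.isRadialFamily hE).surjOn ?_ ht
  rw [← Module.finrank_eq_rank, hE]
  exact_mod_cast Nat.lt_add_of_pos_left hn

lemma isGauge_radialGauge (hE : Module.finrank ℝ E = n + 1) (hn : 0 < n)
    (h : IsStarshapedFlow Γ f I X N) (ht : t ∈ I) : IsGauge (radialGauge X t) where
  pos _ hz := norm_pos_iff.2 (radialInverse_ne_zero (h.surjOn hE hn ht) hz)
  homogeneous z hz l hl := by
    rw [radialGauge, (h.isRadialFamily hE).radialInverse_smul ht (h.injOn t ht)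
      (h.surjOn hE hn ht) hz hl, norm_smul, Real.norm_of_nonneg hl.le, radialGauge]
  smooth := ((h.isRadialFamily hE).contDiffOn_radialInverse ht (h.injOn t ht)
    (h.surjOn hE hn ht)).norm ℝ fun _ hz => radialInverse_ne_zero (h.surjOn hE hn ht) hz

/-- Differentiate the identity that the gauge composed with X is the norm: the gradient is normal,
and Euler's relation fixes its length. -/
lemma fderiv_radialGauge_apply (hE : Module.finrank ℝ E = n + 1) (hn : 0 < n)
    (h : IsStarshapedFlow Γ f I X N) (ht : t ∈ I) (hζ : ζ ≠ 0) :
    fderiv ℝ (radialGauge X t) (X t ζ) = innerSL ℝ (gaugeGradient X N t ζ) := by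
  have hn0 : ‖ζ‖ ≠ 0 := norm_ne_zero_iff.2 hζ
  have h1 : (fun y => radialGauge X t (X t y)) =ᶠ[𝓝 ζ] norm := by
    filter_upwards [isOpen_compl_singleton.mem_nhds hζ] with y hy using h.radialGauge_apply ht hy
  have h2 := ((h.isGauge_radialGauge hE hn ht).differentiableAt
    (h.position_ne_zero ht hζ)).hasFDerivAt.comp ζ (h.differentiableAt_position ht hζ).hasFDerivAt
  have h3 := h2.fderiv.symm.trans (h1.fderiv_eq (𝕜 := ℝ))
  ext v
  obtain ⟨w, rfl⟩ := h.surjective_fderiv hE ht hζ v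
  have h4 := congrArg (fun L : E →L[ℝ] ℝ => L w) h3
  simp only [ContinuousLinearMap.comp_apply] at h4
  rw [h4, fderiv_norm_of_ne hζ, innerSL_apply_apply]
  obtain ⟨w₀, hw₀, hw⟩ := exists_smul_add_orthogonal hζ w
  have h5 : ⟪N t ζ, fderiv ℝ (X t) ζ w⟫ = ⟪ζ, w⟫ / ‖ζ‖ ^ 2 * ⟪X t ζ, N t ζ⟫ := by
    conv_lhs => rw [hw]
    rw [map_add, map_smul, h.fderiv_position_self ht hζ, inner_add_right, inner_smul_right,
      real_inner_comm (X t ζ) (N t ζ), real_inner_comm (fderiv ℝ (X t) ζ w₀), h.orthogonal t ht ζ hζ w₀ hw₀, add_zero]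
  rw [gaugeGradient, real_inner_smul_left, h5]
  have := (h.support_pos t ht ζ hζ).ne'
  field_simp

lemma fderiv_radialGauge (hE : Module.finrank ℝ E = n + 1) (hn : 0 < n)
    (h : IsStarshapedFlow Γ f I X N) (ht : t ∈ I) {z : E} (hz : z ≠ 0) :
    fderiv ℝ (radialGauge X t) z = innerSL ℝ (gaugeGradient X N t (radialInverse (X t) z)) := by
  have hs := h.surjOn hE hn ht
  rw [← h.fderiv_radialGauge_apply hE hn ht (radialInverse_ne_zero hs hz),
    apply_radialInverse hs hz]

lemma fderiv_fderiv_radialGauge_comp (hE : Module.finrank ℝ E = n + 1) (hn : 0 < n)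
    (h : IsStarshapedFlow Γ f I X N) (ht : t ∈ I) (hζ : ζ ≠ 0) :
    (fderiv ℝ (fderiv ℝ (radialGauge X t)) (X t ζ)).comp (fderiv ℝ (X t) ζ) =
      (innerSL ℝ (E := E)).comp (fderiv ℝ (gaugeGradient X N t) ζ) := by
  have h1 : (fun y => fderiv ℝ (radialGauge X t) (X t y)) =ᶠ[𝓝 ζ]
      fun y => innerSL ℝ (gaugeGradient X N t y) := by
    filter_upwards [isOpen_compl_singleton.mem_nhds hζ] with y hy using
      h.fderiv_radialGauge_apply hE hn ht hy
  have h2 := ((h.isGauge_radialGauge hE hn ht).differentiableAt_fderiv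
    (h.position_ne_zero ht hζ)).hasFDerivAt.comp ζ (h.differentiableAt_position ht hζ).hasFDerivAt
  have h3 := (innerSL ℝ (E := E)).hasFDerivAt.comp ζ
    (h.smooth_gaugeGradient.differentiableAt isOpen_compl_singleton ht hζ).hasFDerivAt
  exact h2.fderiv.symm.trans ((h1.fderiv_eq (𝕜 := ℝ)).trans h3.fderiv)

lemma continuousOn_fderiv_radialGauge (hE : Module.finrank ℝ E = n + 1) (hn : 0 < n)
    (h : IsStarshapedFlow Γ f I X N) :
    ContinuousOn (fun p : ℝ × E => fderiv ℝ (radialGauge X p.1) p.2) (I ×ˢ {0}ᶜ) := by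
  have hnt : Nontrivial E := Module.nontrivial_of_finrank_pos (R := ℝ) (by omega)
  have hZ := (h.isRadialFamily hE).continuousOn_radialInverse h.injOn fun t => h.surjOn hE hn
  have h1 : ContinuousOn (fun p : ℝ × E => gaugeGradient X N p.1 (radialInverse (X p.1) p.2))
      (I ×ˢ {0}ᶜ) :=
    h.smooth_gaugeGradient.continuousOn.comp (f := fun p : ℝ × E => (p.1, radialInverse (X p.1) p.2))
      (continuousOn_fst.prodMk hZ) fun p hp => ⟨hp.1, radialInverse_ne_zero (h.surjOn hE hn hp.1) hp.2⟩
  exact ((innerSL ℝ (E := E)).continuous.comp_continuousOn h1).congr fun p hp =>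
    h.fderiv_radialGauge hE hn hp.1 hp.2

/-- Composing `fderiv_fderiv_radialGauge_comp` with the inverse of DX writes D²φ through first
derivatives of X and of the gauge gradient, which are continuous up to the initial time. -/
lemma continuousOn_fderiv_fderiv_radialGauge (hE : Module.finrank ℝ E = n + 1) (hn : 0 < n)
    (h : IsStarshapedFlow Γ f I X N) :
    ContinuousOn (fun p : ℝ × E => fderiv ℝ (fderiv ℝ (radialGauge X p.1)) p.2) (I ×ˢ {0}ᶜ) := by
  have hnt : Nontrivial E := Module.nontrivial_of_finrank_pos (R := ℝ) (by omega)
  have hc : CompleteSpace E := FiniteDimensional.complete ℝ E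
  have hZ := (h.isRadialFamily hE).continuousOn_radialInverse h.injOn fun t => h.surjOn hE hn
  have hm : MapsTo (fun p : ℝ × E => (p.1, radialInverse (X p.1) p.2)) (I ×ˢ {0}ᶜ) (I ×ˢ {0}ᶜ) :=
    fun p hp => ⟨hp.1, radialInverse_ne_zero (h.surjOn hE hn hp.1) hp.2⟩
  have hZ' : ContinuousOn (fun p : ℝ × E => (p.1, radialInverse (X p.1) p.2)) (I ×ˢ {0}ᶜ) :=
    continuousOn_fst.prodMk hZ
  have h1 := (h.smooth_gaugeGradient.fderiv h.uniqueDiffOn isOpen_compl_singleton).continuousOn.comp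
    hZ' hm
  have h2 : ContinuousOn (fun p : ℝ × E => fderiv ℝ (X p.1) (radialInverse (X p.1) p.2))
      (I ×ˢ {0}ᶜ) :=
    (h.smooth_position.fderiv h.uniqueDiffOn isOpen_compl_singleton).continuousOn.comp hZ' hm
  have h3 : ContinuousOn (fun p : ℝ × E => ContinuousLinearMap.inverse
      (fderiv ℝ (X p.1) (radialInverse (X p.1) p.2))) (I ×ˢ {0}ᶜ) := by
    intro p hp
    have hi := h.injective_fderiv hE hp.1 (hm hp).2
    have h4 := (contDiffAt_map_inverse (𝕜 := ℝ) (n := ∞) (equivOfInjective _ hi)).continuousAt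
    rw [coe_equivOfInjective] at h4
    exact ContinuousAt.comp_continuousWithinAt
      (f := fun p : ℝ × E => fderiv ℝ (X p.1) (radialInverse (X p.1) p.2)) h4 (h2 p hp)
  refine ((continuousOn_const (c := innerSL ℝ (E := E))).clm_comp h1 |>.clm_comp h3).congr
    fun p hp => ?_
  have h5 := h.fderiv_fderiv_radialGauge_comp hE hn hp.1 (hm hp).2
  simp only at h5
  rw [apply_radialInverse (h.surjOn hE hn hp.1) hp.2] at h5
  have hi := h.injective_fderiv hE hp.1 (hm hp).2
  simp only [Function.comp_apply]
  rw [← h5]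
  have h6 : (fderiv ℝ (X p.1) (radialInverse (X p.1) p.2)).comp (ContinuousLinearMap.inverse
      (fderiv ℝ (X p.1) (radialInverse (X p.1) p.2))) = ContinuousLinearMap.id ℝ E := by
    conv_lhs => rw [← coe_equivOfInjective _ hi]
    rw [ContinuousLinearMap.inverse_equiv]
    ext v; simp
  rw [ContinuousLinearMap.comp_assoc, h6, ContinuousLinearMap.comp_id]

end IsStarshapedFlow

end StarshapedFlow

/-! ### The evolution equation of the gauge. -/

section StarshapedFlowGauge

open Filter Topology Set

namespace IsStarshapedFlow

variable {n : ℕ} {E : Type*} [NormedAddCommGroup E] [InnerProductSpace ℝ E]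
  {Γ : Set (Fin n → ℝ)} {f : (Fin n → ℝ) → ℝ} {I : Set ℝ} {X N : ℝ → E → E} {t : ℝ} {ζ : E}

/-- The derivative of the scalar factor is multiplied by N, which is orthogonal to v. -/
lemma inner_fderiv_gaugeGradient (h : IsStarshapedFlow Γ f I X N) (ht : t ∈ I) (hζ : ‖ζ‖ = 1)
    (w : E) {v : E} (hv : ⟪v, N t ζ⟫ = 0) : ⟪fderiv ℝ (gaugeGradient X N t) ζ w, v⟫ =
      ⟪X t ζ, N t ζ⟫⁻¹ * ⟪fderiv ℝ (N t) ζ w, v⟫ := by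
  have hζ0 : ζ ≠ 0 := norm_ne_zero_iff.1 (by simp [hζ])
  have h1 : DifferentiableAt ℝ (fun y => ‖y‖ * ⟪X t y, N t y⟫⁻¹) ζ :=
    (hasFDerivAt_norm_of_ne hζ0).differentiableAt.mul
      (((h.differentiableAt_position ht hζ0).inner ℝ (h.differentiableAt_normal ht hζ0)).inv
        (h.support_pos t ht ζ hζ0).ne')
  have h2 := (h1.hasFDerivAt.smul (h.differentiableAt_normal ht hζ0).hasFDerivAt).fderiv
  have h3 : gaugeGradient X N t = (fun y => ‖y‖ * ⟪X t y, N t y⟫⁻¹) • N t := rfl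
  rw [h3, h2]
  simp only [add_apply, smul_apply, ContinuousLinearMap.smulRight_apply, inner_add_left,
    real_inner_smul_left, hζ, one_mul, real_inner_comm v (N t ζ), hv]
  simp

lemma neg_inner_gaugeGradient (h : IsStarshapedFlow Γ f I X N) (ht : t ∈ I) {η : E} (hη : ‖η‖ = 1)
    {κ : Fin n → ℝ} (hd : HasDerivWithinAt (fun s => X s η)
      ((1 / f κ - ⟪X t η, N t η⟫ / n) • N t η) I t) :
    -⟪gaugeGradient X N t η, derivWithin (fun s => X s η) I t⟫ =
      1 / n - 1 / (⟪X t η, N t η⟫ * f κ) := by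
  have hη0 : η ≠ 0 := norm_ne_zero_iff.1 (by simp [hη])
  have hu := (h.support_pos t ht η hη0).ne'
  rw [hd.derivWithin (h.uniqueDiffOn t ht), gaugeGradient, real_inner_smul_left, inner_smul_right,
    real_inner_self_eq_norm_sq, h.norm_normal t ht η hη0, hη]
  field_simp
  ring

variable [FiniteDimensional ℝ E]

lemma norm_fderiv_radialGauge (hE : Module.finrank ℝ E = n + 1) (hn : 0 < n)
    (h : IsStarshapedFlow Γ f I X N) (ht : t ∈ I) (hζ : ‖ζ‖ = 1) :
    ‖fderiv ℝ (radialGauge X t) (X t ζ)‖ = ⟪X t ζ, N t ζ⟫⁻¹ := by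
  have hζ0 : ζ ≠ 0 := norm_ne_zero_iff.1 (by simp [hζ])
  rw [h.fderiv_radialGauge_apply hE hn ht hζ0, innerSL_apply_norm, gaugeGradient, norm_smul,
    h.norm_normal t ht ζ hζ0, hζ, one_mul, mul_one,
    Real.norm_of_nonneg (inv_pos.2 (h.support_pos t ht ζ hζ0)).le]

lemma isEigenframe (hE : Module.finrank ℝ E = n + 1) (hn : 0 < n)
    (h : IsStarshapedFlow Γ f I X N) (ht : t ∈ I) (hζ : ‖ζ‖ = 1) {κ : Fin n → ℝ} {w : Fin n → E}
    (hw : IsCurvatureFrame (X t) (N t) ζ κ w) :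
    IsEigenframe (fderiv ℝ (radialGauge X t) (X t ζ))
      (fderiv ℝ (fderiv ℝ (radialGauge X t)) (X t ζ)) (⟪X t ζ, N t ζ⟫⁻¹ • κ)
      fun i => fderiv ℝ (X t) ζ (w i) := by
  have hζ0 : ζ ≠ 0 := norm_ne_zero_iff.1 (by simp [hζ])
  refine ⟨hw.orthonormal, fun i => ?_, fun i j => ?_⟩
  · rw [h.fderiv_radialGauge_apply hE hn ht hζ0, innerSL_apply_apply, gaugeGradient,
      real_inner_smul_left, real_inner_comm (fderiv ℝ (X t) ζ (w i)),
      h.orthogonal t ht ζ hζ0 _ (hw.tangent i), mul_zero]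
  · have h1 := congrArg (fun L : E →L[ℝ] E →L[ℝ] ℝ => L (w i) (fderiv ℝ (X t) ζ (w j)))
      (h.fderiv_fderiv_radialGauge_comp hE hn ht hζ0)
    simp only [ContinuousLinearMap.comp_apply, innerSL_apply_apply] at h1
    rw [h1, h.inner_fderiv_gaugeGradient ht hζ _ (h.orthogonal t ht ζ hζ0 _ (hw.tangent j)),
      hw.diagonal i j]
    split_ifs <;> simp

/-- The logarithmic time derivative of the gauge. -/
noncomputable def gaugeSpeed (I : Set ℝ) (X N : ℝ → E → E) (p : ℝ × E) : ℝ :=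
  -⟪gaugeGradient X N p.1 (‖radialInverse (X p.1) p.2‖⁻¹ • radialInverse (X p.1) p.2),
    derivWithin (fun s => X s (‖radialInverse (X p.1) p.2‖⁻¹ • radialInverse (X p.1) p.2)) I p.1⟫

lemma continuousOn_gaugeSpeed (hE : Module.finrank ℝ E = n + 1) (hn : 0 < n)
    (h : IsStarshapedFlow Γ f I X N) : ContinuousOn (gaugeSpeed I X N) (I ×ˢ {0}ᶜ) := by
  have hnt : Nontrivial E := Module.nontrivial_of_finrank_pos (R := ℝ) (by omega)
  have hZ := (h.isRadialFamily hE).continuousOn_radialInverse h.injOn fun t => h.surjOn hE hn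
  have hZ0 : ∀ p ∈ I ×ˢ ({0}ᶜ : Set E), radialInverse (X p.1) p.2 ≠ 0 := fun p hp =>
    radialInverse_ne_zero (h.surjOn hE hn hp.1) hp.2
  have hc : ContinuousOn (fun p : ℝ × E => (p.1, ‖radialInverse (X p.1) p.2‖⁻¹ •
      radialInverse (X p.1) p.2)) (I ×ˢ {0}ᶜ) :=
    continuousOn_fst.prodMk ((hZ.norm.inv₀ fun p hp => norm_ne_zero_iff.2 (hZ0 p hp)).smul hZ)
  have hm : MapsTo (fun p : ℝ × E => (p.1, ‖radialInverse (X p.1) p.2‖⁻¹ •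
      radialInverse (X p.1) p.2)) (I ×ˢ {0}ᶜ) (I ×ˢ {0}ᶜ) := fun p hp =>
    ⟨hp.1, smul_ne_zero (inv_ne_zero (norm_ne_zero_iff.2 (hZ0 p hp))) (hZ0 p hp)⟩
  have h1 := h.smooth_gaugeGradient.continuousOn.comp hc hm
  have h2 := (h.smooth_position.continuousOn_derivWithin h.uniqueDiffOn
    isOpen_compl_singleton).comp hc hm
  exact (h1.inner h2).neg

lemma gaugeSpeed_eq (hE : Module.finrank ℝ E = n + 1) (hn : 0 < n)
    (h : IsStarshapedFlow Γ f I X N) (ht : t ∈ I) {z : E} (hz : z ≠ 0) : ∃ η : E, ‖η‖ = 1 ∧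
      z = radialGauge X t z • X t η ∧
      gaugeSpeed I X N (t, z) = -⟪gaugeGradient X N t η, derivWithin (fun s => X s η) I t⟫ := by
  have h0 := radialInverse_ne_zero (h.surjOn hE hn ht) hz
  have hpos : 0 < ‖radialInverse (X t) z‖ := norm_pos_iff.2 h0
  refine ⟨‖radialInverse (X t) z‖⁻¹ • radialInverse (X t) z, by simp [norm_smul, hpos.ne'], ?_, rfl⟩
  rw [h.position_smul t ht _ h0 _ (inv_pos.2 hpos), radialGauge, smul_smul,
    mul_inv_cancel₀ hpos.ne', one_smul, apply_radialInverse (h.surjOn hE hn ht) hz]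

lemma smoothFamily_radialGauge (hE : Module.finrank ℝ E = n + 1) (hn : 0 < n)
    (h : IsStarshapedFlow Γ f I X N) : SmoothFamily (interior I) {0}ᶜ (radialGauge X) :=
  ContDiffOn.norm ℝ ((h.isRadialFamily hE).smoothFamily_radialInverse h.injOn fun _ =>
    h.surjOn hE hn) fun _ hp => radialInverse_ne_zero (h.surjOn hE hn (interior_subset hp.1)) hp.2

/-- φ(s, X s η) = 1 for all s gives ∂ₜφ = −Dφ(∂ₜX) on the level set; homogeneity transports this
along the ray through z. -/
lemma deriv_radialGauge (hE : Module.finrank ℝ E = n + 1) (hn : 0 < n)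
    (h : IsStarshapedFlow Γ f I X N) (ht : t ∈ interior I) {z : E} (hz : z ≠ 0) :
    deriv (fun s => radialGauge X s z) t = radialGauge X t z * gaugeSpeed I X N (t, z) := by
  have htI := interior_subset ht
  obtain ⟨η, hη, hzη, hr⟩ := h.gaugeSpeed_eq hE hn htI hz
  have hη0 : η ≠ 0 := norm_ne_zero_iff.1 (by simp [hη])
  have hy := h.position_ne_zero htI hη0
  have hl := (h.isGauge_radialGauge hE hn htI).pos z hz
  set l := radialGauge X t z with hldef
  have hS := h.smoothFamily_radialGauge hE hn
  have hΩ : IsOpen (interior I ×ˢ ({0}ᶜ : Set E)) := isOpen_interior.prod isOpen_compl_singleton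
  have hmem : (t, X t η) ∈ interior I ×ˢ ({0}ᶜ : Set E) := ⟨ht, hy⟩
  have hd : HasFDerivAt (fun p : ℝ × E => radialGauge X p.1 p.2)
      (fderiv ℝ (fun p : ℝ × E => radialGauge X p.1 p.2) (t, X t η)) (t, X t η) :=
    ((ContDiffOn.contDiffAt hS (hΩ.mem_nhds hmem)).differentiableAt (by simp)).hasFDerivAt
  have hXd : HasDerivAt (fun s => X s η) (derivWithin (fun s => X s η) I t) t :=
    ((h.smooth_position.hasDerivWithinAt htI hη0).differentiableWithinAt.hasDerivWithinAt).hasDerivAt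
      (mem_interior_iff_mem_nhds.1 ht)
  have h1 : HasDerivAt (fun s => radialGauge X s (X s η)) _ t :=
    HasFDerivAt.comp_hasDerivAt (f := fun s => (s, X s η)) t hd ((hasDerivAt_id t).prodMk hXd)
  have h2 : HasDerivAt (fun s => radialGauge X s (X s η)) 0 t := by
    refine (hasDerivAt_const t (1 : ℝ)).congr_of_eventuallyEq ?_
    filter_upwards [mem_interior_iff_mem_nhds.1 ht] with s hs
    rw [h.radialGauge_apply hs hη0, hη]
  have h3 := h1.unique h2
  have h4 : ((1 : ℝ), derivWithin (fun s => X s η) I t) = ((1 : ℝ), (0 : E)) +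
      ((0 : ℝ), derivWithin (fun s => X s η) I t) := by simp
  have h5 := hasDerivAt_time hS hΩ hmem
  have h6 := hasDerivAt_space hS hΩ hmem (derivWithin (fun s => X s η) I t)
  simp only [dirDeriv] at h5 h6
  rw [h4, map_add, h6] at h3
  have h7 : fderiv ℝ (radialGauge X t) (X t η) (derivWithin (fun s => X s η) I t) =
      ⟪gaugeGradient X N t η, derivWithin (fun s => X s η) I t⟫ := by
    rw [h.fderiv_radialGauge_apply hE hn htI hη0, innerSL_apply_apply]
  have h8 : deriv (fun s => radialGauge X s (X t η)) t = gaugeSpeed I X N (t, z) := by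
    rw [h5.deriv, hr, ← h7]
    linarith
  have h9 : (fun s => radialGauge X s z) =ᶠ[𝓝 t] fun s => l * radialGauge X s (X t η) := by
    filter_upwards [mem_interior_iff_mem_nhds.1 ht] with s hs
    conv_lhs => rw [hzη]
    rw [(h.isGauge_radialGauge hE hn hs).homogeneous _ hy l hl]
  rw [h9.deriv_eq, deriv_const_mul _ h5.differentiableAt, h8]

lemma exists_isEigenframe (hE : Module.finrank ℝ E = n + 1) (hn : 0 < n)
    (hf : IsAdmissibleCurvatureFunction Γ f) (h : IsStarshapedFlow Γ f I X N) (ht : t ∈ I) {z : E}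
    (hz : z ≠ 0) : ∃ κ ∈ Γ, ∃ e : Fin n → E,
      IsEigenframe (fderiv ℝ (radialGauge X t) z) (fderiv ℝ (fderiv ℝ (radialGauge X t)) z) κ e ∧
      radialGauge X t z * gaugeSpeed I X N (t, z) =
        radialGauge X t z / n - ‖fderiv ℝ (radialGauge X t) z‖ ^ 2 / f κ := by
  obtain ⟨η, hη, hzη, hr⟩ := h.gaugeSpeed_eq hE hn ht hz
  have hη0 : η ≠ 0 := norm_ne_zero_iff.1 (by simp [hη])
  have hg := h.isGauge_radialGauge hE hn ht
  have hl := hg.pos z hz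
  have hy := h.position_ne_zero ht hη0
  have hu := h.support_pos t ht η hη0
  obtain ⟨κ, hκ, w, hw, hd⟩ := h.evolution t ht η hη
  have he := (h.isEigenframe hE hn ht hη hw).smul 1 (radialGauge X t z)⁻¹
  rw [one_smul, ← hg.fderiv_fderiv_smul hy hl, ← hg.fderiv_smul hy hl, ← hzη] at he
  refine ⟨_, hf.smul_mem _ (hf.smul_mem _ hκ _ (inv_pos.2 hu)) _ (inv_pos.2 hl), _, he, ?_⟩
  have h1 : ‖fderiv ℝ (radialGauge X t) z‖ = ⟪X t η, N t η⟫⁻¹ := by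
    rw [← h.norm_fderiv_radialGauge hE hn ht hη]
    conv_lhs => rw [hzη]
    rw [hg.fderiv_smul hy hl]
  have hfκ := (hf.pos κ hκ).ne'
  rw [hr, h.neg_inner_gaugeGradient ht hη hd, h1,
    hf.homogeneous _ (hf.smul_mem _ hκ _ (inv_pos.2 hu)) _ (inv_pos.2 hl),
    hf.homogeneous _ hκ _ (inv_pos.2 hu)]
  have hu' := hu.ne'
  have hl' := hl.ne'
  field_simp

theorem isGaugeFlow (hE : Module.finrank ℝ E = n + 1) (hn : 0 < n)
    (hf : IsAdmissibleCurvatureFunction Γ f) {τ : ℝ} (h : IsStarshapedFlow Γ f (Ico 0 τ) X N) :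
    IsGaugeFlow Γ f τ (radialGauge X) where
  gauge t ht := h.isGauge_radialGauge hE hn ht
  continuousOn := by
    have hnt : Nontrivial E := Module.nontrivial_of_finrank_pos (R := ℝ) (by omega)
    exact ((h.isRadialFamily hE).continuousOn_radialInverse h.injOn fun t => h.surjOn hE hn).norm
  smooth := by
    have := h.smoothFamily_radialGauge hE hn
    rwa [interior_Ico] at this
  evolution t ht z hz := by
    obtain ⟨κ, hκ, e, he, h1⟩ := h.exists_isEigenframe hE hn hf (Ioo_subset_Ico_self ht) hz
    refine ⟨κ, hκ, e, he, ?_⟩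
    rw [← h1, h.deriv_radialGauge hE hn (by rwa [interior_Ico]) hz]

/-- The equation expresses the speed by φ, Dφ and D²φ at a single time, and f of the eigenvalues
does not depend on the eigenframe. So the initial speed depends on the initial hypersurface only. -/
lemma gaugeSpeed_congr (hE : Module.finrank ℝ E = n + 1) (hn : 0 < n)
    (hf : IsAdmissibleCurvatureFunction Γ f) (h : IsStarshapedFlow Γ f I X N) {I' : Set ℝ}
    {X' N' : ℝ → E → E} (h' : IsStarshapedFlow Γ f I' X' N') {t' : ℝ} (ht : t ∈ I) (ht' : t' ∈ I')
    (heq : EqOn (radialGauge X t) (radialGauge X' t') {0}ᶜ) {z : E} (hz : z ≠ 0) :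
    gaugeSpeed I X N (t, z) = gaugeSpeed I' X' N' (t', z) := by
  have h1 : EqOn (fderiv ℝ (radialGauge X t)) (fderiv ℝ (radialGauge X' t')) {0}ᶜ := fun y hy =>
    (heq.eventuallyEq_of_mem (isOpen_compl_singleton.mem_nhds hy)).fderiv_eq
  have h2 : fderiv ℝ (fderiv ℝ (radialGauge X t)) z = fderiv ℝ (fderiv ℝ (radialGauge X' t')) z :=
    (h1.eventuallyEq_of_mem (isOpen_compl_singleton.mem_nhds hz)).fderiv_eq
  obtain ⟨κ, hκ, e, he, hr⟩ := h.exists_isEigenframe hE hn hf ht hz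
  obtain ⟨κ', hκ', e', he', hr'⟩ := h'.exists_isEigenframe hE hn hf ht' hz
  have hg := h.isGauge_radialGauge hE hn ht
  have hp := hg.fderiv_ne_zero hz
  rw [← h1 hz, ← h2] at he'
  have h3 : f κ = f κ' := le_antisymm
    (he.mono hE hf he' hp hκ hκ' fun v _ => le_rfl) (he'.mono hE hf he hp hκ' hκ fun v _ => le_rfl)
  rw [← h1 hz, ← heq hz, ← h3, ← hr] at hr'
  exact (mul_left_cancel₀ (hg.pos z hz).ne' hr').symm

end IsStarshapedFlow

end StarshapedFlowGauge

/-! ### Preserved bounds and their geometric meaning. -/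

section UniformBounds

open Filter Topology Set

variable {n : ℕ} {E : Type*} [NormedAddCommGroup E] [InnerProductSpace ℝ E]

/-- Bounds for a gauge and its derivatives which are preserved along the flow. -/
structure GaugeBounds (g : E → ℝ) (m M L Θ : ℝ) : Prop where
  pos : 0 < m
  nonneg : 0 ≤ Θ
  lower : ∀ z, z ≠ 0 → m * ‖z‖ ≤ g z
  upper : ∀ z, z ≠ 0 → g z ≤ M * ‖z‖
  norm_fderiv : ∀ z, z ≠ 0 → ‖fderiv ℝ g z‖ ≤ L
  quotient : ∀ z, z ≠ 0 → ∀ v, CurvatureQuotientLE g Θ z v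

lemma IsGauge.norm_fderiv_le_of_sphere {g : E → ℝ} (hg : IsGauge g) {L : ℝ}
    (h : ∀ z, ‖z‖ = 1 → ‖fderiv ℝ g z‖ ≤ L) {z : E} (hz : z ≠ 0) : ‖fderiv ℝ g z‖ ≤ L := by
  have hn : 0 < ‖z‖ := norm_pos_iff.2 hz
  rw [← hg.fderiv_smul hz (inv_pos.2 hn)]
  exact h _ (by simp [norm_smul, hn.ne'])

lemma IsGauge.exists_gaugeBounds [FiniteDimensional ℝ E] {g : E → ℝ} (hg : IsGauge g) :
    ∃ m M L Θ : ℝ, GaugeBounds g m M L Θ := by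
  have hS := isCompact_sphere (0 : E) 1
  have hS0 : ∀ z ∈ Metric.sphere (0 : E) 1, z ≠ 0 := fun z hz => ne_zero_of_mem_unit_sphere ⟨z, hz⟩
  have hc : ContinuousOn g (Metric.sphere 0 1) := hg.smooth.continuousOn.mono hS0
  have hc1 : ContinuousOn (fderiv ℝ g) (Metric.sphere 0 1) := hg.contDiffOn_fderiv.continuousOn.mono hS0
  have hc2 : ContinuousOn (fderiv ℝ (fderiv ℝ g)) (Metric.sphere 0 1) :=
    (ContDiffOn.continuousOn_fderiv_of_isOpen hg.contDiffOn_fderiv isOpen_compl_singleton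
      (by simp)).mono hS0
  obtain ⟨M, hM⟩ := hS.bddAbove_image hc
  obtain ⟨m, hm⟩ := hS.bddAbove_image (hc.inv₀ fun z hz => (hg.pos z (hS0 z hz)).ne')
  obtain ⟨L, hL⟩ := hS.bddAbove_image hc1.norm
  set K : Set (E × E) := (Metric.sphere (0 : E) 1 ×ˢ Metric.sphere (0 : E) 1) ∩ {p | ⟪p.1, p.2⟫ = 0}
    with hK
  have hKc : IsCompact K := (hS.prod hS).inter_right (isClosed_eq (by fun_prop) continuous_const)
  have hKf : MapsTo Prod.fst K (Metric.sphere (0 : E) 1) := fun p hp => hp.1.1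
  have a0 : ContinuousOn (fun p : E × E => g p.1) K := hc.comp continuousOn_fst hKf
  have a1 : ContinuousOn (fun p : E × E => fderiv ℝ g p.1 p.2) K :=
    (hc1.comp continuousOn_fst hKf).clm_apply continuousOn_snd
  have a2 : ContinuousOn (fun p : E × E => fderiv ℝ (fderiv ℝ g) p.1 p.2 p.2) K :=
    ((hc2.comp continuousOn_fst hKf).clm_apply continuousOn_snd).clm_apply continuousOn_snd
  have hden : ∀ p ∈ K, 0 < ‖g p.1 • p.2 - fderiv ℝ g p.1 p.2 • p.1‖ ^ 2 := fun p hp =>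
    hg.denominator_pos (hS0 _ hp.1.1) (hS0 _ hp.1.2) hp.2
  have a3 : ContinuousOn (fun p : E × E => g p.1 ^ 3 * fderiv ℝ (fderiv ℝ g) p.1 p.2 p.2 /
      ‖g p.1 • p.2 - fderiv ℝ g p.1 p.2 • p.1‖ ^ 2) K :=
    ((a0.pow 3).mul a2).div (((a0.smul continuousOn_snd).sub (a1.smul continuousOn_fst)).norm.pow 2)
      fun p hp => (hden p hp).ne'
  obtain ⟨Θ, hΘ⟩ := hKc.bddAbove_image a3
  have hm0 : 0 < |m| + 1 := by positivity
  -- The number m bounds 1/g; |m| + 1 is a positive bound in every case, and |Θ| makes the quotient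
  -- bound nonnegative.
  refine ⟨(|m| + 1)⁻¹, M, L, |Θ|, inv_pos.2 hm0, abs_nonneg _, fun z hz => ?_, fun z hz => ?_,
    fun z hz => ?_, fun z hz v => ?_⟩
  · have := isGauge_norm.ratio_le_of_sphere hg (C := |m| + 1) (fun y hy => ?_) hz
    · rwa [inv_mul_le_iff₀ hm0]
    · have h1 := hm ⟨y, hy, rfl⟩
      simp only [Pi.inv_apply] at h1
      rw [mem_sphere_zero_iff_norm.1 hy, ← inv_mul_le_iff₀' (hg.pos y (hS0 y hy)), mul_one]
      linarith [le_abs_self m]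
  · refine hg.ratio_le_of_sphere isGauge_norm (fun y hy => ?_) hz
    rw [mem_sphere_zero_iff_norm.1 hy, mul_one]
    exact hM ⟨y, hy, rfl⟩
  · exact hg.norm_fderiv_le_of_sphere (fun y hy => hL ⟨y, by simpa using hy, rfl⟩) hz
  · refine hg.curvatureQuotientLE_of_sphere (fun z hz v hv hzv => ?_) hz v
    have hp : (z, v) ∈ K := ⟨⟨hz, hv⟩, hzv⟩
    have h1 : _ ≤ Θ := hΘ ⟨(z, v), hp, rfl⟩
    rw [div_le_iff₀ (hden _ hp)] at h1
    exact h1.trans (mul_le_mul_of_nonneg_right (le_abs_self Θ) (sq_nonneg _))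

lemma GaugeBounds.congr {g g' : E → ℝ} {m M L Θ : ℝ} (h : GaugeBounds g m M L Θ)
    (heq : EqOn g' g {0}ᶜ) : GaugeBounds g' m M L Θ := by
  have h1 : EqOn (fderiv ℝ g') (fderiv ℝ g) {0}ᶜ := fun y hy =>
    (heq.eventuallyEq_of_mem (isOpen_compl_singleton.mem_nhds hy)).fderiv_eq
  have h2 : EqOn (fderiv ℝ (fderiv ℝ g')) (fderiv ℝ (fderiv ℝ g)) {0}ᶜ := fun y hy =>
    (h1.eventuallyEq_of_mem (isOpen_compl_singleton.mem_nhds hy)).fderiv_eq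
  refine ⟨h.pos, h.nonneg, fun z hz => ?_, fun z hz => ?_, fun z hz => ?_, fun z hz v => ?_⟩
  · rw [heq hz]; exact h.lower z hz
  · rw [heq hz]; exact h.upper z hz
  · rw [h1 hz]; exact h.norm_fderiv z hz
  · rw [CurvatureQuotientLE, heq hz, h1 hz, h2 hz]; exact h.quotient z hz v

variable {Γ : Set (Fin n → ℝ)} {f : (Fin n → ℝ) → ℝ}

namespace IsStarshapedFlow

variable {I : Set ℝ} {X N : ℝ → E → E} {t τ : ℝ} [FiniteDimensional ℝ E]

lemma gaugeSpeed_smul (hE : Module.finrank ℝ E = n + 1) (hn : 0 < n)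
    (h : IsStarshapedFlow Γ f I X N) (ht : t ∈ I) {z : E} (hz : z ≠ 0) {l : ℝ} (hl : 0 < l) :
    gaugeSpeed I X N (t, l • z) = gaugeSpeed I X N (t, z) := by
  have h1 := (h.isRadialFamily hE).radialInverse_smul ht (h.injOn t ht) (h.surjOn hE hn ht) hz hl
  have h2 : ‖radialInverse (X t) (l • z)‖⁻¹ • radialInverse (X t) (l • z) =
      ‖radialInverse (X t) z‖⁻¹ • radialInverse (X t) z := by
    rw [h1, norm_smul, Real.norm_of_nonneg hl.le, smul_smul, mul_inv, mul_right_comm,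
      inv_mul_cancel₀ hl.ne', one_mul]
  simp only [gaugeSpeed, h2]

/-- The bounds m, M come from comparison with the norm and Θ from the curvature estimate. Only the
gradient bound deteriorates, once, to (1 + 2L/m) M. -/
lemma gaugeBounds (hE : Module.finrank ℝ E = n + 1) (hn : 0 < n)
    (hf : IsAdmissibleCurvatureFunction Γ f) (h : IsStarshapedFlow Γ f (Ico 0 τ) X N)
    {m M L Θ : ℝ} (h0 : GaugeBounds (radialGauge X 0) m M L Θ) (ht : t ∈ Ico 0 τ) :
    GaugeBounds (radialGauge X t) m M ((1 + 2 * L / m) * M) Θ := by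
  have hflow := h.isGaugeFlow hE hn hf
  have hnorm := IsGaugeFlow.isGaugeFlow_norm hE hn hf τ
  have hg := hflow.gauge t ht
  have hL : 0 ≤ L := by
    have hnt : Nontrivial E := Module.nontrivial_of_finrank_pos (R := ℝ) (by omega)
    obtain ⟨z, hz⟩ := exists_ne (0 : E)
    exact (norm_nonneg _).trans (h0.norm_fderiv z hz)
  have hm := h0.pos
  have hup : ∀ z, z ≠ 0 → radialGauge X t z ≤ M * ‖z‖ := fun z hz =>
    hflow.le_of_le hE hf hnorm h0.upper ht hz
  refine ⟨h0.pos, h0.nonneg, fun z hz => ?_, hup, fun z hz => ?_, fun z hz v => ?_⟩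
  · have := hnorm.le_of_le hE hf hflow (C := m⁻¹) (fun y hy => ?_) ht hz
    · rwa [← div_eq_inv_mul, le_div_iff₀' hm] at this
    · rw [← div_eq_inv_mul, le_div_iff₀' hm]
      exact h0.lower y hy
  · refine hg.norm_fderiv_le_of_sphere (fun y hy => ?_) hz
    have hy0 : y ≠ 0 := norm_ne_zero_iff.1 (by simp [hy])
    refine (hflow.norm_fderiv_le hE hf hm hL h0.norm_fderiv h0.lower ht hy).trans ?_
    refine mul_le_mul_of_nonneg_left ?_ (by positivity)
    have := hup y hy0
    rwa [hy, mul_one] at this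
  · exact hflow.curvatureQuotientLE hE hn hf (h.continuousOn_fderiv_radialGauge hE hn)
      (h.continuousOn_fderiv_fderiv_radialGauge hE hn) h0.quotient ht hz v

lemma gaugeSpeed_mem_Icc (hE : Module.finrank ℝ E = n + 1) (hn : 0 < n)
    (hf : IsAdmissibleCurvatureFunction Γ f) (h : IsStarshapedFlow Γ f (Ico 0 τ) X N) {a b : ℝ}
    (h0 : ∀ z ∈ Metric.sphere (0 : E) 1, gaugeSpeed (Ico 0 τ) X N (0, z) ∈ Icc a b)
    (ht : t ∈ Ico 0 τ) {z : E} (hz : z ≠ 0) : gaugeSpeed (Ico 0 τ) X N (t, z) ∈ Icc a b := by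
  have hS0 : ∀ z ∈ Metric.sphere (0 : E) 1, z ≠ 0 := fun z hz => ne_zero_of_mem_unit_sphere ⟨z, hz⟩
  rcases ht.1.eq_or_lt with rfl | htpos
  · have hn0 : 0 < ‖z‖ := norm_pos_iff.2 hz
    rw [← h.gaugeSpeed_smul hE hn ht hz (inv_pos.2 hn0)]
    exact h0 _ (by simp [norm_smul, hn0.ne'])
  · have hflow := h.isGaugeFlow hE hn hf
    have hc := (h.continuousOn_gaugeSpeed hE hn).mono (prod_mono subset_rfl hS0)
    have hd : ∀ t ∈ Ioo 0 τ, ∀ z, z ≠ 0 → deriv (fun s => radialGauge X s z) t =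
        radialGauge X t z * gaugeSpeed (Ico 0 τ) X N (t, z) := fun t ht z hz =>
      h.deriv_radialGauge hE hn (by rwa [interior_Ico]) hz
    have ht' : t ∈ Ioo 0 τ := ⟨htpos, ht.2⟩
    have h1 := hflow.deriv_le hE hf hc (fun t ht z hz => hd t ht z (hS0 z hz))
      (fun z hz => (h0 z hz).2) ht' hz
    have h2 := hflow.le_deriv hE hf hc (fun t ht z hz => hd t ht z (hS0 z hz))
      (fun z hz => (h0 z hz).1) ht' hz
    rw [hd t ht' z hz] at h1 h2
    have hpos := (hflow.gauge t ht).pos z hz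
    exact ⟨le_of_mul_le_mul_left h2 hpos, le_of_mul_le_mul_left h1 hpos⟩

lemma exists_gaugeSpeed_bounds (hE : Module.finrank ℝ E = n + 1) (hn : 0 < n)
    (hf : IsAdmissibleCurvatureFunction Γ f) (h : IsStarshapedFlow Γ f I X N) (ht : t ∈ I) :
    ∃ q Q : ℝ, 0 < q ∧ ∀ z ∈ Metric.sphere (0 : E) 1,
      gaugeSpeed I X N (t, z) ∈ Icc (1 / n - Q) (1 / n - q) := by
  have hS := isCompact_sphere (0 : E) 1
  have hS0 : ∀ z ∈ Metric.sphere (0 : E) 1, z ≠ 0 := fun z hz => ne_zero_of_mem_unit_sphere ⟨z, hz⟩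
  have hc : ContinuousOn (fun z => 1 / (n : ℝ) - gaugeSpeed I X N (t, z)) (Metric.sphere 0 1) :=
    continuousOn_const.sub ((h.continuousOn_gaugeSpeed hE hn).comp (by fun_prop) fun z hz =>
      ⟨ht, hS0 z hz⟩)
  have hpos : ∀ z ∈ Metric.sphere (0 : E) 1, 0 < 1 / (n : ℝ) - gaugeSpeed I X N (t, z) := by
    intro z hz
    obtain ⟨κ, hκ, e, he, h1⟩ := h.exists_isEigenframe hE hn hf ht (hS0 z hz)
    have hg := h.isGauge_radialGauge hE hn ht
    have h2 := hg.pos z (hS0 z hz)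
    have h3 : 0 < ‖fderiv ℝ (radialGauge X t) z‖ ^ 2 / f κ :=
      div_pos (pow_pos (norm_pos_iff.2 (hg.fderiv_ne_zero (hS0 z hz))) 2) (hf.pos κ hκ)
    have h4 : radialGauge X t z * (1 / n - gaugeSpeed I X N (t, z)) =
        ‖fderiv ℝ (radialGauge X t) z‖ ^ 2 / f κ := by
      rw [mul_sub, h1]; ring
    rw [← h4] at h3
    exact (mul_pos_iff_of_pos_left h2).1 h3
  obtain ⟨Q, hQ⟩ := hS.bddAbove_image hc
  obtain ⟨q, hq⟩ := hS.bddAbove_image (hc.inv₀ fun z hz => (hpos z hz).ne')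
  have hq0 : 0 < |q| + 1 := by positivity
  refine ⟨(|q| + 1)⁻¹, Q, inv_pos.2 hq0, fun z hz => ⟨?_, ?_⟩⟩
  · have : 1 / (n : ℝ) - gaugeSpeed I X N (t, z) ≤ Q := hQ ⟨z, hz, rfl⟩
    linarith
  · have h1 : (1 / (n : ℝ) - gaugeSpeed I X N (t, z))⁻¹ ≤ q := hq ⟨z, hz, rfl⟩
    have h2 : (|q| + 1)⁻¹ ≤ 1 / (n : ℝ) - gaugeSpeed I X N (t, z) :=
      inv_le_of_inv_le₀ (hpos z hz) (h1.trans (by linarith [le_abs_self q]))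
    linarith

/-- On the level set 1/u = |Dφ| ≤ L and u ≤ |X| ≤ 1/m; the speed bound reads q ≤ 1/(uF) ≤ Q; the
quotient bound reads κᵢ ≤ uΘ. The lower bound for κᵢ follows from Σ κⱼ ≥ F > 0. -/
lemma curvature_bounds (hE : Module.finrank ℝ E = n + 1) (hn : 0 < n)
    (hf : IsAdmissibleCurvatureFunction Γ f) (h : IsStarshapedFlow Γ f I X N) (ht : t ∈ I)
    {m M L Θ q Q : ℝ} (hb : GaugeBounds (radialGauge X t) m M L Θ) (hq : 0 < q)
    (hs : ∀ z, z ≠ 0 → gaugeSpeed I X N (t, z) ∈ Icc (1 / (n : ℝ) - Q) (1 / n - q)) {ζ : E}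
    (hζ : ‖ζ‖ = 1) {κ : Fin n → ℝ} (hκ : κ ∈ Γ) {w : Fin n → E}
    (hw : IsCurvatureFrame (X t) (N t) ζ κ w) (hd : HasDerivWithinAt (fun s => X s ζ)
      ((1 / f κ - ⟪X t ζ, N t ζ⟫ / n) • N t ζ) I t) :
    (L⁻¹ ≤ ⟪X t ζ, N t ζ⟫ ∧ ⟪X t ζ, N t ζ⟫ ≤ m⁻¹ ∧ ‖X t ζ‖ ≤ m⁻¹) ∧
    (m * Q⁻¹ ≤ f κ ∧ f κ ≤ L * q⁻¹) ∧ ∀ i, |κ i| ≤ n * (m⁻¹ * Θ) := by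
  have hζ0 : ζ ≠ 0 := norm_ne_zero_iff.1 (by simp [hζ])
  have hg := h.isGauge_radialGauge hE hn ht
  have hu := h.support_pos t ht ζ hζ0
  have hy := h.position_ne_zero ht hζ0
  have hm := hb.pos
  have hφ : radialGauge X t (X t ζ) = 1 := by rw [h.radialGauge_apply ht hζ0, hζ]
  have hnorm := h.norm_fderiv_radialGauge hE hn ht hζ
  set u := ⟪X t ζ, N t ζ⟫ with hudef
  have huL : u⁻¹ ≤ L := hnorm ▸ hb.norm_fderiv _ hy
  have hL : 0 < L := (inv_pos.2 hu).trans_le huL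
  have hXm : ‖X t ζ‖ ≤ m⁻¹ := by
    have := hb.lower _ hy
    rw [hφ] at this
    rwa [← one_div, le_div_iff₀' hm]
  have hum : u ≤ m⁻¹ := by
    refine le_trans ?_ hXm
    have := real_inner_le_norm (X t ζ) (N t ζ)
    rwa [h.norm_normal t ht ζ hζ0, mul_one] at this
  have huL' : L⁻¹ ≤ u := inv_le_of_inv_le₀ hu huL
  have hfκ := hf.pos κ hκ
  obtain ⟨η, hη, hzη, hr⟩ := h.gaugeSpeed_eq hE hn ht hy
  rw [hφ, one_smul] at hzη
  have hη0 : η ≠ 0 := norm_ne_zero_iff.1 (by simp [hη])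
  have : ζ = η := h.injOn t ht hζ0 hη0 hzη
  subst this
  rw [h.neg_inner_gaugeGradient ht hζ hd] at hr
  have hsp := hs _ hy
  rw [hr] at hsp
  have hq1 : q ≤ 1 / (u * f κ) := by linarith [hsp.2]
  have hq2 : 1 / (u * f κ) ≤ Q := by linarith [hsp.1]
  have huf : 0 < u * f κ := mul_pos hu hfκ
  have hQ : 0 < Q := hq.trans_le (hq1.trans hq2)
  have hκup : ∀ i, κ i ≤ m⁻¹ * Θ := by
    intro i
    have he := h.isEigenframe hE hn ht hζ hw
    have h1 := hb.quotient _ hy (fderiv ℝ (X t) ζ (w i))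
    rw [CurvatureQuotientLE, hφ, he.tangent i, he.diagonal i i, if_pos rfl, zero_smul, sub_zero,
      one_smul, he.orthonormal.1 i] at h1
    simp only [one_pow, one_mul, mul_one, Pi.smul_apply, smul_eq_mul] at h1
    rw [inv_mul_le_iff₀ hu] at h1
    exact h1.trans (mul_le_mul_of_nonneg_right hum hb.nonneg)
  refine ⟨⟨huL', hum, hXm⟩, ⟨?_, ?_⟩, fun i => ?_⟩
  · rw [div_le_iff₀ huf] at hq2
    rw [← div_eq_mul_inv, div_le_iff₀ hQ]
    have h1 : u * (f κ * Q) ≤ m⁻¹ * (f κ * Q) := mul_le_mul_of_nonneg_right hum (by positivity)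
    have h2 : 1 ≤ m⁻¹ * (f κ * Q) := by linarith
    rwa [← div_eq_inv_mul, le_div_iff₀ hm, one_mul] at h2
  · rw [le_div_iff₀ huf] at hq1
    rw [← div_eq_mul_inv, le_div_iff₀ hq]
    have h1 : L⁻¹ * (f κ * q) ≤ u * (f κ * q) := mul_le_mul_of_nonneg_right huL' (by positivity)
    have h2 : L⁻¹ * (f κ * q) ≤ 1 := by linarith
    rwa [inv_mul_le_iff₀ hL, mul_one] at h2
  · have hC : 0 ≤ m⁻¹ * Θ := mul_nonneg (inv_pos.2 hm).le hb.nonneg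
    have hn1 : (1 : ℝ) ≤ n := by exact_mod_cast hn
    have h1 : 0 < ∑ j, κ j := hfκ.trans_le (hf.le_sum hn hκ)
    rw [← Finset.add_sum_erase _ _ (Finset.mem_univ i)] at h1
    have h2 : ∑ j ∈ Finset.univ.erase i, κ j ≤ ∑ j ∈ Finset.univ.erase i, m⁻¹ * Θ :=
      Finset.sum_le_sum fun j _ => hκup j
    rw [Finset.sum_const, Finset.card_erase_of_mem (Finset.mem_univ i), Finset.card_univ,
      Fintype.card_fin, nsmul_eq_mul] at h2
    have h3 : ((n - 1 : ℕ) : ℝ) * (m⁻¹ * Θ) ≤ n * (m⁻¹ * Θ) :=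
      mul_le_mul_of_nonneg_right (by exact_mod_cast Nat.sub_le n 1) hC
    have h4 : m⁻¹ * Θ ≤ n * (m⁻¹ * Θ) := le_mul_of_one_le_left hC hn1
    exact abs_le.2 ⟨by linarith, (hκup i).trans h4⟩

end IsStarshapedFlow

end UniformBounds

/-! ### From the gauge to the radial function. -/

section RadialFunctionBounds

open Filter Topology Set

variable {n : ℕ} {E : Type*} [NormedAddCommGroup E] [InnerProductSpace ℝ E]

/-- The first and second derivatives of `r` at `y` along vectors orthogonal to `y` are bounded
by `c`. -/
def TangentialC2Bound (r : E → ℝ) (y : E) (c : ℝ) : Prop :=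
  |r y| ≤ c ∧ (∀ v, ⟪v, y⟫ = 0 → |fderiv ℝ r y v| ≤ c * ‖v‖) ∧
    ∀ v w, ⟪v, y⟫ = 0 → ⟪w, y⟫ = 0 → |fderiv ℝ (fderiv ℝ r) y v w| ≤ c * ‖v‖ * ‖w‖

namespace IsGauge

variable {g : E → ℝ} {z : E}

lemma hasFDerivAt_norm_mul_inv (hg : IsGauge g) (hz : z ≠ 0) :
    HasFDerivAt (fun y => ‖y‖ * (g y)⁻¹)
      ((g z)⁻¹ • fderiv ℝ norm z - (‖z‖ * (g z ^ 2)⁻¹) • fderiv ℝ g z) z := by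
  have h1 : HasFDerivAt (fun y => (g y)⁻¹) (-(g z ^ 2)⁻¹ • fderiv ℝ g z) z := by
    exact (hasDerivAt_inv (hg.pos z hz).ne').comp_hasFDerivAt z (hg.differentiableAt hz).hasFDerivAt
  have h2 := (hasFDerivAt_norm_of_ne hz).differentiableAt.hasFDerivAt.mul h1
  refine h2.congr_fderiv ?_
  ext v
  simp
  ring

lemma fderiv_fderiv_norm_mul_inv (hg : IsGauge g) {y : E} (hy : ‖y‖ = 1) {v w : E} (hv : ⟪v, y⟫ = 0)
    (hw : ⟪w, y⟫ = 0) : fderiv ℝ (fderiv ℝ fun y => ‖y‖ * (g y)⁻¹) y v w =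
      (g y)⁻¹ * ⟪v, w⟫ - (g y ^ 2)⁻¹ * fderiv ℝ (fderiv ℝ g) y v w +
        2 * (g y ^ 3)⁻¹ * (fderiv ℝ g y v * fderiv ℝ g y w) := by
  have hy0 : y ≠ 0 := norm_ne_zero_iff.1 (by simp [hy])
  have hgy := (hg.pos y hy0).ne'
  have h0 : fderiv ℝ (fun y => ‖y‖ * (g y)⁻¹) =ᶠ[𝓝 y]
      fun z => (g z)⁻¹ • fderiv ℝ norm z - (‖z‖ * (g z ^ 2)⁻¹) • fderiv ℝ g z := by
    filter_upwards [isOpen_compl_singleton.mem_nhds hy0] with z hz using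
      (hg.hasFDerivAt_norm_mul_inv hz).fderiv
  have hd := (hg.differentiableAt hy0).hasFDerivAt
  have h1 : HasFDerivAt (fun y => (g y)⁻¹) (-(g y ^ 2)⁻¹ • fderiv ℝ g y) y :=
    (hasDerivAt_inv hgy).comp_hasFDerivAt y hd
  have h2 : HasFDerivAt (fun y => (g y ^ 2)⁻¹) (-((g y ^ 2) ^ 2)⁻¹ • (2 * g y) • fderiv ℝ g y) y := by
    have h3 := (hasDerivAt_inv (pow_ne_zero 2 hgy)).comp_hasFDerivAt y (hd.pow 2)
    refine h3.congr_fderiv ?_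
    ext v; simp
  have hnorm := (hasFDerivAt_norm_of_ne hy0).differentiableAt.hasFDerivAt
  have h4 := h1.smul (isGauge_norm.differentiableAt_fderiv hy0).hasFDerivAt
  have h5 := (hnorm.mul h2).smul (hg.differentiableAt_fderiv hy0).hasFDerivAt
  have h6 := (h4.sub h5).fderiv
  have h7 : fderiv ℝ (fderiv ℝ fun y => ‖y‖ * (g y)⁻¹) y = _ := h0.fderiv_eq.trans h6
  rw [h7]
  simp only [sub_apply, add_apply, smul_apply, ContinuousLinearMap.smulRight_apply, smul_eq_mul,
    Pi.mul_apply, fderiv_norm_of_ne hy0, fderiv_fderiv_norm hy0, hy, real_inner_comm v y, real_inner_comm w y,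
    hv, hw]
  field_simp
  ring

lemma tangentialC2Bound (hg : IsGauge g) {y : E} (hy : ‖y‖ = 1) {m L H : ℝ} (hm : 0 < m)
    (hmg : m ≤ g y) (hL : ‖fderiv ℝ g y‖ ≤ L)
    (hH : ∀ v w, |fderiv ℝ (fderiv ℝ g) y v w| ≤ H * ‖v‖ * ‖w‖) {c : ℝ} (h1 : m⁻¹ ≤ c)
    (h2 : (m ^ 2)⁻¹ * L ≤ c) (h3 : m⁻¹ + (m ^ 2)⁻¹ * H + 2 * (m ^ 3)⁻¹ * L ^ 2 ≤ c) :
    TangentialC2Bound (fun z => ‖z‖ * (g z)⁻¹) y c := by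
  have hy0 : y ≠ 0 := norm_ne_zero_iff.1 (by simp [hy])
  have hgy := hg.pos y hy0
  have i1 : (g y)⁻¹ ≤ m⁻¹ := inv_anti₀ hm hmg
  have i2 : (g y ^ 2)⁻¹ ≤ (m ^ 2)⁻¹ := inv_anti₀ (by positivity) (pow_le_pow_left₀ hm.le hmg 2)
  have i3 : (g y ^ 3)⁻¹ ≤ (m ^ 3)⁻¹ := inv_anti₀ (by positivity) (pow_le_pow_left₀ hm.le hmg 3)
  have hL0 : 0 ≤ L := (norm_nonneg _).trans hL
  have hD : ∀ v, |fderiv ℝ g y v| ≤ L * ‖v‖ := fun v =>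
    ((fderiv ℝ g y).le_opNorm v).trans (mul_le_mul_of_nonneg_right hL (norm_nonneg v))
  refine ⟨?_, fun v hv => ?_, fun v w hv hw => ?_⟩
  · simp only [hy, one_mul, abs_of_pos (inv_pos.2 hgy)]
    exact i1.trans h1
  · rw [(hg.hasFDerivAt_norm_mul_inv hy0).fderiv, sub_apply, smul_apply, smul_apply,
      fderiv_norm_of_ne hy0, real_inner_comm, hv, hy, one_mul, mul_zero, smul_zero, zero_sub, abs_neg,
      smul_eq_mul, abs_mul, abs_of_pos (by positivity)]
    calc (g y ^ 2)⁻¹ * |fderiv ℝ g y v| ≤ (m ^ 2)⁻¹ * (L * ‖v‖) :=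
          mul_le_mul i2 (hD v) (abs_nonneg _) (by positivity)
      _ = (m ^ 2)⁻¹ * L * ‖v‖ := by ring
      _ ≤ c * ‖v‖ := mul_le_mul_of_nonneg_right h2 (norm_nonneg v)
  · rw [hg.fderiv_fderiv_norm_mul_inv hy hv hw]
    have a1 : |(g y)⁻¹ * ⟪v, w⟫| ≤ m⁻¹ * (‖v‖ * ‖w‖) := by
      rw [abs_mul, abs_of_pos (inv_pos.2 hgy)]
      exact mul_le_mul i1 (abs_real_inner_le_norm v w) (abs_nonneg _) (by positivity)
    have a2 : |(g y ^ 2)⁻¹ * fderiv ℝ (fderiv ℝ g) y v w| ≤ (m ^ 2)⁻¹ * (H * ‖v‖ * ‖w‖) := by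
      rw [abs_mul, abs_of_pos (by positivity)]
      exact mul_le_mul i2 (hH v w) (abs_nonneg _) (by positivity)
    have a3 : |2 * (g y ^ 3)⁻¹ * (fderiv ℝ g y v * fderiv ℝ g y w)| ≤
        2 * (m ^ 3)⁻¹ * ((L * ‖v‖) * (L * ‖w‖)) := by
      rw [abs_mul, abs_mul (fderiv ℝ g y v), abs_of_pos (by positivity)]
      exact mul_le_mul (by linarith) (mul_le_mul (hD v) (hD w) (abs_nonneg _) (by positivity))
        (by positivity) (by positivity)
    have a4 := abs_add_le ((g y)⁻¹ * ⟪v, w⟫ - (g y ^ 2)⁻¹ * fderiv ℝ (fderiv ℝ g) y v w)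
      (2 * (g y ^ 3)⁻¹ * (fderiv ℝ g y v * fderiv ℝ g y w))
    have a5 := abs_sub ((g y)⁻¹ * ⟪v, w⟫) ((g y ^ 2)⁻¹ * fderiv ℝ (fderiv ℝ g) y v w)
    calc _ ≤ (m⁻¹ + (m ^ 2)⁻¹ * H + 2 * (m ^ 3)⁻¹ * L ^ 2) * (‖v‖ * ‖w‖) := by linarith
      _ ≤ c * (‖v‖ * ‖w‖) := mul_le_mul_of_nonneg_right h3 (by positivity)
      _ = c * ‖v‖ * ‖w‖ := by ring

/-- D²g ignores the direction y, so both arguments may be projected along y onto ker Dg. B bounds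
the norm of this oblique projection and C the eigenvalues. -/
lemma abs_fderiv_fderiv_le [FiniteDimensional ℝ E] (hE : Module.finrank ℝ E = n + 1)
    (hg : IsGauge g) {y : E} (hy : y ≠ 0) (hy1 : g y = 1) {κ : Fin n → ℝ} {e : Fin n → E}
    (he : IsEigenframe (fderiv ℝ g y) (fderiv ℝ (fderiv ℝ g) y) κ e) {C B : ℝ}
    (hκ : ∀ i, |κ i| ≤ C) (hC : 0 ≤ C) (hB : 1 + ‖fderiv ℝ g y‖ * ‖y‖ ≤ B) (v w : E) :
    |fderiv ℝ (fderiv ℝ g) y v w| ≤ n * C * B ^ 2 * ‖v‖ * ‖w‖ := by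
  set p := fderiv ℝ g y with hp
  have hB0 : 0 ≤ B := le_trans (by positivity) hB
  have hpy : p y = 1 := by rw [hp, hg.fderiv_self hy, hy1]
  have hproj : ∀ v : E, ‖v - p v • y‖ ≤ B * ‖v‖ := by
    intro v
    have h1 := norm_sub_le v (p v • y)
    rw [norm_smul] at h1
    have h2 := mul_le_mul_of_nonneg_right (p.le_opNorm v) (norm_nonneg y)
    have h3 := mul_le_mul_of_nonneg_right hB (norm_nonneg v)
    nlinarith
  have hker : ∀ v : E, p (v - p v • y) = 0 := fun v => by
    rw [map_sub, map_smul, hpy, smul_eq_mul, mul_one, sub_self]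
  have h1 : fderiv ℝ (fderiv ℝ g) y v w =
      fderiv ℝ (fderiv ℝ g) y (v - p v • y) (w - p w • y) := by
    simp [hg.fderiv_fderiv_self hy, hg.fderiv_fderiv_self' hy]
  rw [h1, he.apply hE (hg.fderiv_ne_zero hy) (hker v) (hker w)]
  have h2 : ∀ (i : Fin n) (v : E), |⟪e i, v - p v • y⟫| ≤ B * ‖v‖ := fun i v => by
    have := abs_real_inner_le_norm (e i) (v - p v • y)
    rw [he.orthonormal.1 i, one_mul] at this
    exact this.trans (hproj v)
  calc |∑ i, κ i * (⟪e i, v - p v • y⟫ * ⟪e i, w - p w • y⟫)|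
      ≤ ∑ i, |κ i * (⟪e i, v - p v • y⟫ * ⟪e i, w - p w • y⟫)| := Finset.abs_sum_le_sum_abs _ _
    _ ≤ ∑ _i : Fin n, C * ((B * ‖v‖) * (B * ‖w‖)) := by
        refine Finset.sum_le_sum fun i _ => ?_
        rw [abs_mul, abs_mul]
        exact mul_le_mul (hκ i) (mul_le_mul (h2 i v) (h2 i w) (abs_nonneg _) (by positivity))
          (by positivity) hC
    _ = n * C * B ^ 2 * ‖v‖ * ‖w‖ := by
        rw [Finset.sum_const, Finset.card_univ, Fintype.card_fin, nsmul_eq_mul]; ring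

end IsGauge

end RadialFunctionBounds

/-! ### Constants depending only on the initial gauge. -/

section UniformEstimates

open Filter Topology Set

variable {n : ℕ} {E : Type*} [NormedAddCommGroup E] [InnerProductSpace ℝ E] [FiniteDimensional ℝ E]
  {Γ : Set (Fin n → ℝ)} {f : (Fin n → ℝ) → ℝ}

/-- The a priori estimates at one time. -/
structure UniformEstimates (Γ : Set (Fin n → ℝ)) (f : (Fin n → ℝ) → ℝ) (I : Set ℝ)
    (X N : ℝ → E → E) (t c : ℝ) : Prop where
  radial : ∀ y, ‖y‖ = 1 → TangentialC2Bound (fun z => ‖z‖ * (radialGauge X t z)⁻¹) y c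
  curvature : ∀ ζ, ‖ζ‖ = 1 → ∀ κ ∈ Γ, ∀ w : Fin n → E, IsCurvatureFrame (X t) (N t) ζ κ w →
    HasDerivWithinAt (fun s => X s ζ) ((1 / f κ - ⟪X t ζ, N t ζ⟫ / n) • N t ζ) I t →
    (c⁻¹ ≤ ⟪X t ζ, N t ζ⟫ ∧ ⟪X t ζ, N t ζ⟫ ≤ c) ∧ (c⁻¹ ≤ f κ ∧ f κ ≤ c) ∧ ∀ i, |κ i| ≤ c

lemma IsStarshapedFlow.uniformEstimates (hE : Module.finrank ℝ E = n + 1) (hn : 0 < n)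
    (hf : IsAdmissibleCurvatureFunction Γ f) {I : Set ℝ} {X N : ℝ → E → E}
    (h : IsStarshapedFlow Γ f I X N) {t : ℝ} (ht : t ∈ I) {m M L Θ q Q H c : ℝ}
    (hb : GaugeBounds (radialGauge X t) m M L Θ) (hq : 0 < q)
    (hs : ∀ z, z ≠ 0 → gaugeSpeed I X N (t, z) ∈ Icc (1 / (n : ℝ) - Q) (1 / n - q))
    (hH : H = m⁻¹ * (n * (L * (n * (m⁻¹ * Θ))) * (1 + L * m⁻¹) ^ 2))
    (h1 : L ≤ c) (h2 : m⁻¹ ≤ c) (h3 : m⁻¹ * Q ≤ c) (h4 : L * q⁻¹ ≤ c) (h5 : n * (m⁻¹ * Θ) ≤ c)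
    (h6 : (m ^ 2)⁻¹ * L ≤ c) (h7 : m⁻¹ + (m ^ 2)⁻¹ * H + 2 * (m ^ 3)⁻¹ * L ^ 2 ≤ c) :
    UniformEstimates Γ f I X N t c := by
  have hg := h.isGauge_radialGauge hE hn ht
  have hm := hb.pos
  constructor
  · intro y hy
    have hy0 : y ≠ 0 := norm_ne_zero_iff.1 (by simp [hy])
    obtain ⟨η, hη, hyη, -⟩ := h.gaugeSpeed_eq hE hn ht hy0
    have hη0 : η ≠ 0 := norm_ne_zero_iff.1 (by simp [hη])
    have hx := h.position_ne_zero ht hη0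
    obtain ⟨κ, hκ, w, hw, hd⟩ := h.evolution t ht η hη
    obtain ⟨⟨hu, -, hxm⟩, -, hκb⟩ := h.curvature_bounds hE hn hf ht hb hq hs hη hκ hw hd
    have hupos := h.support_pos t ht η hη0
    have hL1 : ‖fderiv ℝ (radialGauge X t) (X t η)‖ ≤ L := hb.norm_fderiv _ hx
    have hL0 : 0 ≤ L := (norm_nonneg _).trans hL1
    have huL : ⟪X t η, N t η⟫⁻¹ ≤ L := by
      rw [← h.norm_fderiv_radialGauge hE hn ht hη]; exact hL1
    have hC : 0 ≤ n * (m⁻¹ * Θ) := mul_nonneg (Nat.cast_nonneg n)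
      (mul_nonneg (inv_pos.2 hm).le hb.nonneg)
    have hgy := hg.pos y hy0
    have hmg : m ≤ radialGauge X t y := by
      have := hb.lower y hy0
      rwa [hy, mul_one] at this
    refine hg.tangentialC2Bound hy hm hmg (hb.norm_fderiv y hy0) (H := H) (fun v v' => ?_) h2 h6 h7
    -- The Hessian is bounded on the level set, where its eigenvalues are κ/u, and carried to y by
    -- homogeneity of degree −1.
    have hφ : radialGauge X t (X t η) = 1 := by rw [h.radialGauge_apply ht hη0, hη]
    have h8 := hg.abs_fderiv_fderiv_le hE hx hφ (h.isEigenframe hE hn ht hη hw)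
      (C := L * (n * (m⁻¹ * Θ))) (B := 1 + L * m⁻¹) (fun i => by
        rw [Pi.smul_apply, smul_eq_mul, abs_mul, abs_of_pos (inv_pos.2 hupos)]
        exact mul_le_mul huL (hκb i) (abs_nonneg _) hL0) (by positivity)
      (by
        have := mul_le_mul hL1 hxm (norm_nonneg _) hL0
        linarith) v v'
    rw [hyη, hg.fderiv_fderiv_smul hx hgy, smul_apply, smul_apply, smul_eq_mul, abs_mul,
      abs_of_pos (inv_pos.2 hgy), hH]
    calc _ ≤ m⁻¹ * (n * (L * (n * (m⁻¹ * Θ))) * (1 + L * m⁻¹) ^ 2 * ‖v‖ * ‖v'‖) :=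
          mul_le_mul (inv_anti₀ hm hmg) h8 (abs_nonneg _) (inv_pos.2 hm).le
      _ = _ := by ring
  · intro ζ hζ κ hκ w hw hd
    obtain ⟨⟨b1, b2, -⟩, ⟨b3, b4⟩, b5⟩ := h.curvature_bounds hE hn hf ht hb hq hs hζ hκ hw hd
    have hζ0 : ζ ≠ 0 := norm_ne_zero_iff.1 (by simp [hζ])
    have hu := h.support_pos t ht ζ hζ0
    have hL : 0 < L := by
      refine lt_of_lt_of_le (inv_pos.2 hu) ?_
      rw [← h.norm_fderiv_radialGauge hE hn ht hζ]
      exact hb.norm_fderiv _ (h.position_ne_zero ht hζ0)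
    have hfκ := hf.pos κ hκ
    refine ⟨⟨(inv_anti₀ hL h1).trans b1, b2.trans h2⟩, ⟨?_, b4.trans h4⟩, fun i => (b5 i).trans h5⟩
    have hs' := hs _ (h.position_ne_zero ht hζ0)
    have hQ : 0 < Q := by linarith [hs'.1.trans hs'.2]
    have h9 : c⁻¹ ≤ (m⁻¹ * Q)⁻¹ := inv_anti₀ (by positivity) h3
    rw [mul_inv, inv_inv] at h9
    exact h9.trans b3

theorem exists_uniformEstimates (hE : Module.finrank ℝ E = n + 1) (hn : 0 < n)
    (hf : IsAdmissibleCurvatureFunction Γ f) {g : E → ℝ} (hg : IsGauge g) :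
    ∃ c : ℝ, 0 < c ∧ ∀ (τ : ℝ) (X N : ℝ → E → E), IsStarshapedFlow Γ f (Ico 0 τ) X N →
      EqOn (radialGauge X 0) g {0}ᶜ → ∀ t ∈ Ico 0 τ, UniformEstimates Γ f (Ico 0 τ) X N t c := by
  -- The initial speed bounds are read off from any one flow with initial gauge g; by
  -- `gaugeSpeed_congr` they hold for every other. If there is none, there is nothing to prove.
  by_cases hex : ∃ (τ : ℝ) (X N : ℝ → E → E), 0 < τ ∧ IsStarshapedFlow Γ f (Ico 0 τ) X N ∧
      EqOn (radialGauge X 0) g {0}ᶜ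
  · obtain ⟨τ₁, X₁, N₁, hτ₁, h₁, heq₁⟩ := hex
    obtain ⟨m, M, L₀, Θ, hb⟩ := hg.exists_gaugeBounds
    obtain ⟨q, Q, hq, hqQ⟩ := h₁.exists_gaugeSpeed_bounds hE hn hf (left_mem_Ico.2 hτ₁)
    set L := (1 + 2 * L₀ / m) * M with hL
    set H := m⁻¹ * (n * (L * (n * (m⁻¹ * Θ))) * (1 + L * m⁻¹) ^ 2) with hH
    refine ⟨|L| + |m⁻¹| + |m⁻¹ * Q| + |L * q⁻¹| + |n * (m⁻¹ * Θ)| + |(m ^ 2)⁻¹ * L| +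
      |m⁻¹ + (m ^ 2)⁻¹ * H + 2 * (m ^ 3)⁻¹ * L ^ 2| + 1, by positivity, ?_⟩
    intro τ X N h heq t ht
    have hτ : 0 < τ := ht.1.trans_lt ht.2
    have hb' := h.gaugeBounds hE hn hf (hb.congr heq) ht
    have hs : ∀ z, z ≠ 0 →
        IsStarshapedFlow.gaugeSpeed (Ico 0 τ) X N (t, z) ∈ Icc (1 / (n : ℝ) - Q) (1 / n - q) := by
      intro z hz
      refine h.gaugeSpeed_mem_Icc hE hn hf (fun y hy => ?_) ht hz
      rw [h.gaugeSpeed_congr hE hn hf h₁ (left_mem_Ico.2 hτ) (left_mem_Ico.2 hτ₁)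
        (heq.trans heq₁.symm) (ne_zero_of_mem_unit_sphere ⟨y, hy⟩)]
      exact hqQ y hy
    have a1 := abs_nonneg L
    have a2 := abs_nonneg m⁻¹
    have a3 := abs_nonneg (m⁻¹ * Q)
    have a4 := abs_nonneg (L * q⁻¹)
    have a5 := abs_nonneg (n * (m⁻¹ * Θ))
    have a6 := abs_nonneg ((m ^ 2)⁻¹ * L)
    have a7 := abs_nonneg (m⁻¹ + (m ^ 2)⁻¹ * H + 2 * (m ^ 3)⁻¹ * L ^ 2)
    refine h.uniformEstimates hE hn hf ht hb' hq hs hH ?_ ?_ ?_ ?_ ?_ ?_ ?_ <;>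
      refine (le_abs_self _).trans ?_ <;> linarith
  · refine ⟨1, one_pos, fun τ X N h heq t ht => ?_⟩
    exact absurd ⟨τ, X, N, ht.1.trans_lt ht.2, h, heq⟩ hex

end UniformEstimates

/-! ### Principal curvatures as eigenvalues of a pencil of matrices. -/

section SimultaneousDiagonalization

open Matrix

variable {n : ℕ}

lemma Matrix.IsHermitian.exists_orthogonal_diagonal {A : Matrix (Fin n) (Fin n) ℝ}
    (hA : A.IsHermitian) : ∃ U : Matrix (Fin n) (Fin n) ℝ, Uᵀ * U = 1 ∧
      Uᵀ * A * U = diagonal hA.eigenvalues := by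
  refine ⟨hA.eigenvectorUnitary, ?_, ?_⟩
  · have := (Matrix.mem_unitaryGroup_iff').1 hA.eigenvectorUnitary.2
    rwa [star_eq_conjTranspose, conjTranspose_eq_transpose_of_trivial] at this
  · have := hA.conjStarAlgAut_star_eigenvectorUnitary
    rw [Unitary.conjStarAlgAut_star_apply] at this
    rw [← conjTranspose_eq_transpose_of_trivial]
    exact this

lemma eigenvalueTuple_eq_of_charpoly {A : Matrix (Fin n) (Fin n) ℝ} {d : Fin n → ℝ}
    (hd : Monotone d) (hA : A.charpoly = (diagonal d).charpoly) : eigenvalueTuple A = d := by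
  have h1 : A.charpoly.roots = (List.ofFn d : Multiset ℝ) := by
    rw [hA, charpoly_diagonal, ← Fin.univ_val_map]
    have h2 : (∏ i, (Polynomial.X - Polynomial.C (d i))) =
        (Multiset.map (fun a => Polynomial.X - Polynomial.C a) (Multiset.map d Finset.univ.val)).prod := by
      rw [Multiset.map_map]; rfl
    rw [h2, Polynomial.roots_multiset_prod_X_sub_C]
  have h3 : A.charpoly.roots.sort (· ≤ ·) = List.ofFn d := by
    refine List.Perm.eq_of_pairwise' (Multiset.pairwise_sort _ _)
      (List.sortedLE_ofFn_iff.2 hd).pairwise ?_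
    rw [← Multiset.coe_eq_coe, Multiset.sort_eq, h1]
  funext i
  rw [eigenvalueTuple, h3]
  simp

/-- Simultaneous diagonalization of a positive definite and a symmetric matrix, with the
eigenvalues of `G⁻¹ * H` in increasing order. -/
theorem exists_simultaneous_diagonalization {G H : Matrix (Fin n) (Fin n) ℝ} (hG : G.PosDef)
    (hH : H.IsHermitian) : ∃ C : Matrix (Fin n) (Fin n) ℝ, C * G * Cᵀ = 1 ∧
      C * H * Cᵀ = diagonal (eigenvalueTuple (G⁻¹ * H)) ∧
      (G⁻¹ * H * G⁻¹ * Hᵀ).trace = ∑ i, eigenvalueTuple (G⁻¹ * H) i ^ 2 := by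
  obtain ⟨U, hU, hUG⟩ := hG.1.exists_orthogonal_diagonal
  -- S normalizes G to the identity; an orthogonal V then diagonalizes S H Sᵀ without disturbing
  -- this.
  set S := diagonal (fun i => (√(hG.1.eigenvalues i))⁻¹) * Uᵀ with hS
  have hSG : S * G * Sᵀ = 1 := by
    have h1 : S * G * Sᵀ = diagonal (fun i => (√(hG.1.eigenvalues i))⁻¹) * (Uᵀ * G * U) *
        diagonal (fun i => (√(hG.1.eigenvalues i))⁻¹) := by
      simp only [hS, transpose_mul, transpose_transpose, diagonal_transpose, Matrix.mul_assoc]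
    rw [h1, hUG, diagonal_mul_diagonal, diagonal_mul_diagonal, ← diagonal_one]
    congr 1
    funext i
    have hpos := hG.eigenvalues_pos i
    have h2 : √(hG.1.eigenvalues i) ≠ 0 := (Real.sqrt_pos.2 hpos).ne'
    have h3 := Real.mul_self_sqrt hpos.le
    field_simp
    nlinarith
  have hK : (S * H * Sᵀ).IsHermitian := by
    have := isHermitian_mul_mul_conjTranspose S hH
    rwa [conjTranspose_eq_transpose_of_trivial] at this
  obtain ⟨V, hV, hVK⟩ := hK.exists_orthogonal_diagonal
  -- The rows are permuted so that the eigenvalues increase, as `eigenvalueTuple` requires.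
  set σ := Tuple.sort hK.eigenvalues with hσ
  set κ := hK.eigenvalues ∘ σ with hκ
  set C := (Vᵀ * S).submatrix σ id with hC
  have hconj : ∀ A : Matrix (Fin n) (Fin n) ℝ,
      C * A * Cᵀ = (Vᵀ * (S * A * Sᵀ) * V).submatrix σ σ := by
    intro A
    have h1 : C * A * Cᵀ = ((Vᵀ * S) * A * (Vᵀ * S)ᵀ).submatrix σ σ := by
      rw [hC, transpose_submatrix, Matrix.submatrix_mul (Vᵀ * S * A) _ σ id σ Function.bijective_id,
        Matrix.submatrix_mul (Vᵀ * S) A σ id id Function.bijective_id, submatrix_id_id]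
    rw [h1]
    congr 1
    simp only [transpose_mul, transpose_transpose, Matrix.mul_assoc]
  have hCG : C * G * Cᵀ = 1 := by
    rw [hconj, hSG, Matrix.mul_one, hV, submatrix_one_equiv]
  have hCH : C * H * Cᵀ = diagonal κ := by
    rw [hconj, hVK, submatrix_diagonal_equiv]
  have hCu : IsUnit C.det := by
    have := congrArg det hCG
    rw [det_mul, det_mul, det_one, mul_assoc] at this
    exact IsUnit.of_mul_eq_one _ this
  have hCtu : IsUnit Cᵀ.det := by rwa [det_transpose]
  have hGinv : G⁻¹ = Cᵀ * C := by
    refine inv_eq_left_inv ?_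
    have h1 : C * (G * Cᵀ) = 1 := by rw [← Matrix.mul_assoc, hCG]
    have h2 : (G * Cᵀ) * C = 1 := mul_eq_one_comm.1 h1
    rw [Matrix.mul_assoc] at h2
    exact mul_eq_one_comm.1 h2
  have hW : G⁻¹ * H = Cᵀ * diagonal κ * Cᵀ⁻¹ := by
    rw [← hCH, hGinv, ← Matrix.mul_assoc, Matrix.mul_assoc _ Cᵀ Cᵀ⁻¹, mul_nonsing_inv _ hCtu,
      Matrix.mul_one, Matrix.mul_assoc]
  have heig : eigenvalueTuple (G⁻¹ * H) = κ := by
    refine eigenvalueTuple_eq_of_charpoly (Tuple.monotone_sort _) ?_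
    rw [hW, charpoly_mul_comm, ← Matrix.mul_assoc, nonsing_inv_mul _ hCtu, Matrix.one_mul]
  refine ⟨C, hCG, heig.symm ▸ hCH, ?_⟩
  have hHt : Hᵀ = H := by rw [← conjTranspose_eq_transpose_of_trivial, hH.eq]
  rw [heig, hHt, Matrix.mul_assoc (G⁻¹ * H), hW, trace_mul_comm]
  have h5 : Cᵀ * diagonal κ * Cᵀ⁻¹ * (Cᵀ * diagonal κ * Cᵀ⁻¹) =
      Cᵀ * (diagonal κ * diagonal κ * Cᵀ⁻¹) := by
    have h6 : Cᵀ⁻¹ * (Cᵀ * (diagonal κ * Cᵀ⁻¹)) = diagonal κ * Cᵀ⁻¹ := by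
      rw [← Matrix.mul_assoc, nonsing_inv_mul _ hCtu, Matrix.one_mul]
    simp only [Matrix.mul_assoc]
    rw [h6]
  rw [h5, trace_mul_comm, Matrix.mul_assoc, nonsing_inv_mul _ hCtu, Matrix.mul_one,
    diagonal_mul_diagonal, trace_diagonal]
  simp [sq]

end SimultaneousDiagonalization

/-! ### Homogeneous extension of maps on the sphere. -/

section SphereExtension

open Filter Topology Set

variable {n : ℕ}

open Classical in
/-- The radial projection of `ℝⁿ⁺¹ \ {0}` onto the unit sphere. -/
noncomputable def sphereProj (ζ : Ambient n) : UnitSphere n :=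
  if h : ‖ζ‖⁻¹ • ζ ∈ Metric.sphere (0 : Ambient n) 1 then ⟨‖ζ‖⁻¹ • ζ, h⟩
  else ⟨EuclideanSpace.single 0 1, by simp⟩

lemma inv_norm_smul_mem_sphere {ζ : Ambient n} (hζ : ζ ≠ 0) :
    ‖ζ‖⁻¹ • ζ ∈ Metric.sphere (0 : Ambient n) 1 := by
  simp [norm_smul, hζ]

lemma coe_sphereProj {ζ : Ambient n} (hζ : ζ ≠ 0) : (sphereProj ζ : Ambient n) = ‖ζ‖⁻¹ • ζ := by
  rw [sphereProj, dif_pos (inv_norm_smul_mem_sphere hζ)]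

lemma sphereProj_coe (ξ : UnitSphere n) : sphereProj (ξ : Ambient n) = ξ := by
  refine Subtype.ext ?_
  rw [coe_sphereProj (ne_zero_of_mem_unit_sphere ξ), norm_eq_of_mem_sphere ξ, inv_one, one_smul]

lemma sphereProj_smul {ζ : Ambient n} (hζ : ζ ≠ 0) {l : ℝ} (hl : 0 < l) :
    sphereProj (l • ζ) = sphereProj ζ := by
  refine Subtype.ext ?_
  rw [coe_sphereProj (smul_ne_zero hl.ne' hζ), coe_sphereProj hζ, norm_smul,
    Real.norm_of_nonneg hl.le, smul_smul, mul_inv, mul_right_comm, inv_mul_cancel₀ hl.ne', one_mul]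

lemma homogeneousExtension_eq (r : UnitSphere n → ℝ) {z : Ambient n} (hz : z ≠ 0) :
    homogeneousExtension r z = r (sphereProj z) := by
  rw [homogeneousExtension, dif_pos (inv_norm_smul_mem_sphere hz), sphereProj,
    dif_pos (inv_norm_smul_mem_sphere hz)]

/-- Restricting the codomain to the sphere requires a globally smooth sphere-valued map. The bump
function replaces the identity by a nowhere vanishing map h that agrees with it near ζ₀. -/
lemma contMDiffAt_sphereProj {ζ₀ : Ambient n} (hζ₀ : ζ₀ ≠ 0) :
    ContMDiffAt 𝓘(ℝ, Ambient n) (𝓡 n) ∞ (sphereProj (n := n)) ζ₀ := by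
  have hn : 0 < ‖ζ₀‖ := norm_pos_iff.2 hζ₀
  let χ : ContDiffBump ζ₀ := ⟨‖ζ₀‖ / 4, ‖ζ₀‖ / 2, by positivity, by linarith⟩
  set h : Ambient n → Ambient n := fun ζ => ζ₀ + χ ζ • (ζ - ζ₀) with hh
  have h0 : ∀ ζ, h ζ ≠ 0 := by
    intro ζ hz
    have h1 : χ ζ • (ζ - ζ₀) = -ζ₀ := by
      rw [hh] at hz
      exact (neg_eq_of_add_eq_zero_right hz).symm
    have h2 := congrArg norm h1
    rw [norm_neg, norm_smul, Real.norm_of_nonneg χ.nonneg] at h2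
    by_cases hd : dist ζ ζ₀ < ‖ζ₀‖ / 2
    · rw [dist_eq_norm] at hd
      have := mul_le_mul_of_nonneg_right (χ.le_one (x := ζ)) (norm_nonneg (ζ - ζ₀))
      linarith
    · rw [χ.zero_of_le_dist (not_lt.1 hd), zero_mul] at h2
      linarith
  have hs : ContDiff ℝ ∞ h := contDiff_const.add (χ.contDiff.smul (contDiff_id.sub contDiff_const))
  have hs' : ContDiff ℝ ∞ fun ζ => ‖h ζ‖⁻¹ • h ζ :=
    ((hs.norm ℝ h0).inv fun ζ => norm_ne_zero_iff.2 (h0 ζ)).smul hs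
  have : Fact (Module.finrank ℝ (Ambient n) = n + 1) := ⟨finrank_euclideanSpace_fin⟩
  have key := ContMDiff.codRestrict_sphere (n := n) hs'.contMDiff
    fun ζ => inv_norm_smul_mem_sphere (h0 ζ)
  refine (key ζ₀).congr_of_eventuallyEq ?_
  filter_upwards [χ.eventuallyEq_one, isOpen_compl_singleton.mem_nhds hζ₀] with ζ h1 hζ
  refine Subtype.ext ?_
  have h2 : h ζ = ζ := by
    rw [hh]
    simp only [h1, Pi.one_apply, one_smul]
    abel
  rw [coe_sphereProj hζ, Set.val_codRestrict_apply, h2]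

lemma smoothFamily_comp_sphereProj {F : Type*} [NormedAddCommGroup F] [NormedSpace ℝ F] {I : Set ℝ}
    {y : ℝ → UnitSphere n → F} (hy : ContMDiffOn (𝓘(ℝ, ℝ).prod (𝓡 n)) 𝓘(ℝ, F) ∞
      (fun p : ℝ × UnitSphere n => y p.1 p.2) (I ×ˢ univ)) :
    SmoothFamily I {0}ᶜ fun t ζ => y t (sphereProj ζ) := by
  refine contMDiffOn_iff_contDiffOn.1 ?_
  have h1 : ContMDiffOn 𝓘(ℝ, ℝ × Ambient n) (𝓡 n) ∞ (fun p : ℝ × Ambient n => sphereProj p.2)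
      (I ×ˢ {0}ᶜ) := fun p hp =>
    ((contMDiffAt_sphereProj hp.2).comp p contDiffAt_snd.contMDiffAt).contMDiffWithinAt
  have h2 : ContMDiffOn 𝓘(ℝ, ℝ × Ambient n) (𝓘(ℝ, ℝ).prod (𝓡 n)) ∞
      (fun p : ℝ × Ambient n => (p.1, sphereProj p.2)) (I ×ˢ {0}ᶜ) :=
    contDiff_fst.contMDiff.contMDiffOn.prodMk h1
  exact hy.comp h2 fun p hp => ⟨hp.1, mem_univ _⟩

lemma contDiffOn_comp_sphereProj {F : Type*} [NormedAddCommGroup F] [NormedSpace ℝ F]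
    {y : UnitSphere n → F} (hy : ContMDiff (𝓡 n) 𝓘(ℝ, F) ∞ y) :
    ContDiffOn ℝ ∞ (fun ζ => y (sphereProj ζ)) {0}ᶜ := by
  refine contMDiffOn_iff_contDiffOn.1 fun ζ hζ => ?_
  exact (hy.contMDiffAt.comp ζ (contMDiffAt_sphereProj hζ)).contMDiffWithinAt

lemma contMDiff_slice {F : Type*} [NormedAddCommGroup F] [NormedSpace ℝ F] {I : Set ℝ}
    {y : ℝ → UnitSphere n → F} (hy : ContMDiffOn (𝓘(ℝ, ℝ).prod (𝓡 n)) 𝓘(ℝ, F) ∞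
      (fun p : ℝ × UnitSphere n => y p.1 p.2) (I ×ˢ univ)) {t : ℝ} (ht : t ∈ I) :
    ContMDiff (𝓡 n) 𝓘(ℝ, F) ∞ (y t) := by
  have h1 : ContMDiff (𝓡 n) (𝓘(ℝ, ℝ).prod (𝓡 n)) ∞ fun ξ : UnitSphere n => (t, ξ) :=
    contMDiff_const.prodMk contMDiff_id
  exact contMDiffOn_univ.1 (hy.comp h1.contMDiffOn fun ξ _ => ⟨ht, mem_univ _⟩)

/-- The coordinate frame of the tangent space of the sphere, as vectors in the ambient space. -/
noncomputable def sphereFrame (ξ : UnitSphere n) (i : Fin n) : Ambient n :=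
  frameDeriv (fun η => (η : Ambient n)) ξ i

lemma mdifferentiableAt_coe_sphere (ξ : UnitSphere n) :
    MDifferentiableAt (𝓡 n) 𝓘(ℝ, Ambient n) (fun η : UnitSphere n => (η : Ambient n)) ξ := by
  have : Fact (Module.finrank ℝ (Ambient n) = n + 1) := ⟨finrank_euclideanSpace_fin⟩
  exact (contMDiff_coe_sphere (m := 1) (n := n) ξ).mdifferentiableAt one_ne_zero

lemma fderiv_comp_sphereProj_frame {y : UnitSphere n → Ambient n}
    (hy : ContMDiff (𝓡 n) 𝓘(ℝ, Ambient n) ∞ y) (ξ : UnitSphere n) (i : Fin n) :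
    fderiv ℝ (fun ζ => y (sphereProj ζ)) ξ (sphereFrame ξ i) = frameDeriv y ξ i := by
  have hξ := ne_zero_of_mem_unit_sphere ξ
  have h1 : DifferentiableAt ℝ (fun ζ => y (sphereProj ζ)) (ξ : Ambient n) :=
    ((contDiffOn_comp_sphereProj hy).contDiffAt
      (isOpen_compl_singleton.mem_nhds hξ)).differentiableAt (by simp)
  have h2 : y = (fun ζ => y (sphereProj ζ)) ∘ fun η : UnitSphere n => (η : Ambient n) := by
    funext η
    simp [sphereProj_coe]
  have h3 := mfderiv_comp ξ (I := 𝓡 n) (I' := 𝓘(ℝ, Ambient n)) (I'' := 𝓘(ℝ, Ambient n))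
    h1.mdifferentiableAt (mdifferentiableAt_coe_sphere ξ)
  rw [← h2, mfderiv_eq_fderiv] at h3
  rw [frameDeriv, h3]
  rfl

lemma inner_sphereFrame (ξ : UnitSphere n) (i : Fin n) : ⟪(ξ : Ambient n), sphereFrame ξ i⟫ = 0 := by
  have : Fact (Module.finrank ℝ (Ambient n) = n + 1) := ⟨finrank_euclideanSpace_fin⟩
  have h1 := range_mvfderiv_subtypeVal (n := n) ξ
  have h2 : sphereFrame ξ i ∈ (ℝ ∙ (ξ : Ambient n))ᗮ := by
    rw [← h1]
    exact ⟨EuclideanSpace.single i 1, rfl⟩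
  exact Submodule.mem_orthogonal_singleton_iff_inner_right.1 h2

lemma exists_eq_sum_sphereFrame (ξ : UnitSphere n) {w : Ambient n} (hw : ⟪(ξ : Ambient n), w⟫ = 0) :
    ∃ c : Fin n → ℝ, w = ∑ i, c i • sphereFrame ξ i := by
  have : Fact (Module.finrank ℝ (Ambient n) = n + 1) := ⟨finrank_euclideanSpace_fin⟩
  let L : EuclideanSpace ℝ (Fin n) →L[ℝ] Ambient n :=
    mvfderiv (𝓡 n) (fun η : UnitSphere n => (η : Ambient n)) ξ
  have h1 := range_mvfderiv_subtypeVal (n := n) ξ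
  have h2 : w ∈ (ℝ ∙ (ξ : Ambient n))ᗮ := Submodule.mem_orthogonal_singleton_iff_inner_right.2 hw
  rw [← h1] at h2
  obtain ⟨v, hv⟩ : ∃ v, L v = w := h2
  refine ⟨fun i => v i, ?_⟩
  have h3 : v = ∑ i, v i • EuclideanSpace.single i (1 : ℝ) := by
    have := (EuclideanSpace.basisFun (Fin n) ℝ).sum_repr v
    simpa using this.symm
  rw [← hv]
  conv_lhs => rw [h3, map_sum]
  simp only [map_smul]
  rfl

lemma linearIndependent_frameDeriv {y : UnitSphere n → Ambient n} {ξ : UnitSphere n}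
    (h : Function.Injective (mfderiv (𝓡 n) 𝓘(ℝ, Ambient n) y ξ)) :
    LinearIndependent ℝ (frameDeriv y ξ) := by
  let L : EuclideanSpace ℝ (Fin n) →L[ℝ] Ambient n := mfderiv (𝓡 n) 𝓘(ℝ, Ambient n) y ξ
  have h1 := (EuclideanSpace.basisFun (Fin n) ℝ).toBasis.linearIndependent
  have h2 := h1.map' (L : EuclideanSpace ℝ (Fin n) →ₗ[ℝ] Ambient n) (LinearMap.ker_eq_bot.2 h)
  have h3 : (L : EuclideanSpace ℝ (Fin n) →ₗ[ℝ] Ambient n) ∘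
      (EuclideanSpace.basisFun (Fin n) ℝ).toBasis = frameDeriv y ξ := by
    funext i
    simp only [Function.comp_apply, OrthonormalBasis.coe_toBasis, EuclideanSpace.basisFun_apply]
    rfl
  rwa [h3] at h2

end SphereExtension

/-! ### Fundamental forms in the homogeneous extension. -/

section Hypersurface

open Filter Topology Set

variable {n : ℕ}

/-- The extension of `y : 𝕊ⁿ → ℝⁿ⁺¹` to a map that is homogeneous of degree one. -/
noncomputable def coneExtension (y : UnitSphere n → Ambient n) (ζ : Ambient n) : Ambient n :=
  ‖ζ‖ • y (sphereProj ζ)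

/-- An immersion of the sphere with unit normal `ν`. -/
structure IsImmersedHypersurface (y ν : UnitSphere n → Ambient n) : Prop where
  smooth : ContMDiff (𝓡 n) 𝓘(ℝ, Ambient n) ∞ y
  normal_smooth : ContMDiff (𝓡 n) 𝓘(ℝ, Ambient n) ∞ ν
  immersion : ∀ ξ, Function.Injective (mfderiv (𝓡 n) 𝓘(ℝ, Ambient n) y ξ)
  orthogonal : ∀ ξ i, ⟪frameDeriv y ξ i, ν ξ⟫ = 0

namespace IsImmersedHypersurface

variable {y ν : UnitSphere n → Ambient n}

lemma contDiffAt (h : IsImmersedHypersurface y ν) {ζ : Ambient n} (hζ : ζ ≠ 0) :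
    ContDiffAt ℝ ∞ (fun ζ => y (sphereProj ζ)) ζ :=
  (contDiffOn_comp_sphereProj h.smooth).contDiffAt (isOpen_compl_singleton.mem_nhds hζ)

lemma differentiableAt (h : IsImmersedHypersurface y ν) {ζ : Ambient n} (hζ : ζ ≠ 0) :
    DifferentiableAt ℝ (fun ζ => y (sphereProj ζ)) ζ := (h.contDiffAt hζ).differentiableAt (by simp)

lemma differentiableAt_normal (h : IsImmersedHypersurface y ν) {ζ : Ambient n} (hζ : ζ ≠ 0) :
    DifferentiableAt ℝ (fun ζ => ν (sphereProj ζ)) ζ :=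
  ((contDiffOn_comp_sphereProj h.normal_smooth).contDiffAt
    (isOpen_compl_singleton.mem_nhds hζ)).differentiableAt (by simp)

lemma fderiv_self (h : IsImmersedHypersurface y ν) {ζ : Ambient n} (hζ : ζ ≠ 0) :
    fderiv ℝ (fun ζ => y (sphereProj ζ)) ζ ζ = 0 := by
  have h2 : HasDerivAt (fun l : ℝ => y (sphereProj (l • ζ)))
      (fderiv ℝ (fun ζ => y (sphereProj ζ)) ζ ζ) 1 :=
    HasFDerivAt.comp_hasDerivAt (1 : ℝ) (l := fun ζ => y (sphereProj ζ))
      (by simpa using (h.differentiableAt hζ).hasFDerivAt) (IsGauge.hasDerivAt_ray ζ)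
  refine h2.unique ((hasDerivAt_const (1 : ℝ) (y (sphereProj ζ))).congr_of_eventuallyEq ?_)
  filter_upwards [lt_mem_nhds (zero_lt_one' ℝ)] with l hl
  rw [sphereProj_smul hζ hl]

lemma fderiv_comp_sphereProj_smul (y : UnitSphere n → Ambient n) {ζ : Ambient n} (hζ : ζ ≠ 0)
    {l : ℝ} (hl : 0 < l) : l • fderiv ℝ (fun ζ => y (sphereProj ζ)) (l • ζ) =
      fderiv ℝ (fun ζ => y (sphereProj ζ)) ζ := by
  have h1 : (fun ζ => y (sphereProj (l • ζ))) =ᶠ[𝓝 ζ] fun ζ => y (sphereProj ζ) := by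
    filter_upwards [isOpen_compl_singleton.mem_nhds hζ] with z hz
    rw [sphereProj_smul hz hl]
  have h2 := h1.fderiv_eq (𝕜 := ℝ)
  rwa [fderiv_comp_smul (f := fun ζ => y (sphereProj ζ))] at h2

lemma inner_fderiv_normal (h : IsImmersedHypersurface y ν) {ζ : Ambient n} (hζ : ζ ≠ 0)
    (w : Ambient n) : ⟪fderiv ℝ (fun ζ => y (sphereProj ζ)) ζ w, ν (sphereProj ζ)⟫ = 0 := by
  have key : ∀ (ξ : UnitSphere n) (w : Ambient n),
      ⟪fderiv ℝ (fun ζ => y (sphereProj ζ)) ξ w, ν ξ⟫ = 0 := by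
    intro ξ w
    have hξ := ne_zero_of_mem_unit_sphere ξ
    obtain ⟨w₀, hw₀, hw⟩ := exists_smul_add_orthogonal hξ w
    obtain ⟨c, hc⟩ := exists_eq_sum_sphereFrame ξ hw₀
    rw [hw, map_add, map_smul, h.fderiv_self hξ, smul_zero, zero_add, hc, map_sum, sum_inner]
    refine Finset.sum_eq_zero fun i _ => ?_
    rw [map_smul, fderiv_comp_sphereProj_frame h.smooth, real_inner_smul_left, h.orthogonal, mul_zero]
  have hn : 0 < ‖ζ‖ := norm_pos_iff.2 hζ
  have h1 := fderiv_comp_sphereProj_smul y hζ (inv_pos.2 hn)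
  rw [← coe_sphereProj hζ] at h1
  rw [← h1, smul_apply, real_inner_smul_left, key, mul_zero]

/-- Differentiating ⟪ν, DY w⟫ = 0 in direction v gives −⟪ν, D²Y(v, w)⟫, which is symmetric. -/
lemma inner_fderiv_normal_symm (h : IsImmersedHypersurface y ν) {ζ : Ambient n} (hζ : ζ ≠ 0)
    (v w : Ambient n) :
    ⟪fderiv ℝ (fun ζ => ν (sphereProj ζ)) ζ v, fderiv ℝ (fun ζ => y (sphereProj ζ)) ζ w⟫ =
    ⟪fderiv ℝ (fun ζ => ν (sphereProj ζ)) ζ w, fderiv ℝ (fun ζ => y (sphereProj ζ)) ζ v⟫ := by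
  set Y : Ambient n → Ambient n := fun ζ => y (sphereProj ζ) with hY
  set V : Ambient n → Ambient n := fun ζ => ν (sphereProj ζ) with hV
  have hd2 : DifferentiableAt ℝ (fderiv ℝ Y) ζ :=
    ((((contDiffOn_comp_sphereProj h.smooth).fderiv_of_isOpen isOpen_compl_singleton (m := ∞)
      (by simp)).contDiffAt (isOpen_compl_singleton.mem_nhds hζ))).differentiableAt (by simp)
  have key : ∀ v w, ⟪V ζ, fderiv ℝ (fderiv ℝ Y) ζ v w⟫ + ⟪fderiv ℝ V ζ v, fderiv ℝ Y ζ w⟫ = 0 := by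
    intro v w
    have h1 : (fun z => ⟪V z, fderiv ℝ Y z w⟫) =ᶠ[𝓝 ζ] fun _ => 0 := by
      filter_upwards [isOpen_compl_singleton.mem_nhds hζ] with z hz
      rw [real_inner_comm]
      exact h.inner_fderiv_normal hz w
    have h2 := h1.fderiv_eq (𝕜 := ℝ)
    have h3 : HasFDerivAt (fun z => fderiv ℝ Y z w) _ ζ := hd2.hasFDerivAt.clm_apply (hasFDerivAt_const w ζ)
    have h4 := ((h.differentiableAt_normal hζ).hasFDerivAt.inner ℝ h3).fderiv
    have h5 := congrArg (fun L : Ambient n →L[ℝ] ℝ => L v) (h4.symm.trans h2)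
    simpa using h5
  have hsymm : fderiv ℝ (fderiv ℝ Y) ζ v w = fderiv ℝ (fderiv ℝ Y) ζ w v :=
    ((h.contDiffAt hζ).isSymmSndFDerivAt (by simp; exact WithTop.coe_le_coe.2 le_top)).eq v w
  have h1 := key v w
  have h2 := key w v
  rw [hsymm] at h1
  linarith

lemma isHermitian_secondFundamentalForm (h : IsImmersedHypersurface y ν) (ξ : UnitSphere n) :
    (secondFundamentalForm y ν ξ).IsHermitian := by
  ext i j
  simp only [secondFundamentalForm, Matrix.conjTranspose_apply, Matrix.of_apply, star_trivial]
  rw [← fderiv_comp_sphereProj_frame h.smooth, ← fderiv_comp_sphereProj_frame h.normal_smooth,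
    ← fderiv_comp_sphereProj_frame h.smooth, ← fderiv_comp_sphereProj_frame h.normal_smooth]
  exact h.inner_fderiv_normal_symm (ne_zero_of_mem_unit_sphere ξ) _ _

lemma posDef_inducedMetric (h : IsImmersedHypersurface y ν) (ξ : UnitSphere n) :
    (inducedMetric y ξ).PosDef :=
  Matrix.posDef_gram_of_linearIndependent (linearIndependent_frameDeriv (h.immersion ξ))

lemma fderiv_coneExtension (h : IsImmersedHypersurface y ν) {ζ : Ambient n} (hζ : ζ ≠ 0)
    {w : Ambient n} (hw : ⟪ζ, w⟫ = 0) :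
    fderiv ℝ (coneExtension y) ζ w = ‖ζ‖ • fderiv ℝ (fun ζ => y (sphereProj ζ)) ζ w := by
  have h1 := ((hasFDerivAt_norm_of_ne hζ).differentiableAt.hasFDerivAt.smul
    (h.differentiableAt hζ).hasFDerivAt).fderiv
  have h2 : coneExtension y =
      (norm : Ambient n → ℝ) • fun ζ : Ambient n => y (sphereProj ζ) := rfl
  rw [h2, h1]
  simp [fderiv_norm_of_ne hζ, hw]

lemma inner_fderiv_coneExtension (h : IsImmersedHypersurface y ν) {ζ : Ambient n} (hζ : ζ ≠ 0)
    {w : Ambient n} (hw : ⟪ζ, w⟫ = 0) :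
    ⟪fderiv ℝ (coneExtension y) ζ w, ν (sphereProj ζ)⟫ = 0 := by
  rw [h.fderiv_coneExtension hζ hw, real_inner_smul_left, h.inner_fderiv_normal hζ, mul_zero]

/-- The rows of the simultaneously diagonalizing matrix are the coordinates of the principal
directions in the coordinate frame of the sphere. -/
theorem exists_isCurvatureFrame (h : IsImmersedHypersurface y ν) (ξ : UnitSphere n) :
    (∃ w, IsCurvatureFrame (coneExtension y) (fun ζ => ν (sphereProj ζ)) (ξ : Ambient n)
      (principalCurvatures y ν ξ) w) ∧
    weingartenNormSq y ν ξ = ∑ i, principalCurvatures y ν ξ i ^ 2 := by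
  obtain ⟨C, hC1, hC2, hC3⟩ := exists_simultaneous_diagonalization (h.posDef_inducedMetric ξ)
    (h.isHermitian_secondFundamentalForm ξ)
  refine ⟨⟨fun i => ∑ j, C i j • sphereFrame ξ j, ?_⟩, hC3⟩
  have hξ := ne_zero_of_mem_unit_sphere ξ
  have htan : ∀ i, ⟪(ξ : Ambient n), ∑ j, C i j • sphereFrame ξ j⟫ = 0 := fun i => by
    rw [inner_sum]
    refine Finset.sum_eq_zero fun j _ => ?_
    rw [inner_smul_right, inner_sphereFrame, mul_zero]
  have hX : ∀ i, fderiv ℝ (coneExtension y) (ξ : Ambient n) (∑ j, C i j • sphereFrame ξ j) =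
      ∑ j, C i j • frameDeriv y ξ j := fun i => by
    rw [h.fderiv_coneExtension hξ (htan i), norm_eq_of_mem_sphere ξ, one_smul, map_sum]
    simp only [map_smul, fderiv_comp_sphereProj_frame h.smooth]
  have hN : ∀ i, fderiv ℝ (fun ζ => ν (sphereProj ζ)) (ξ : Ambient n)
      (∑ j, C i j • sphereFrame ξ j) = ∑ j, C i j • frameDeriv ν ξ j := fun i => by
    rw [map_sum]
    simp only [map_smul, fderiv_comp_sphereProj_frame h.normal_smooth]
  have hbil : ∀ (a b : Fin n → Ambient n) (i k : Fin n),
      ⟪∑ j, C i j • a j, ∑ j, C k j • b j⟫ =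
        (C * Matrix.of (fun i j => ⟪a i, b j⟫) * C.transpose) i k := by
    intro a b i k
    simp only [sum_inner, inner_sum, real_inner_smul_left, real_inner_smul_right, Matrix.mul_apply,
      Matrix.of_apply, Matrix.transpose_apply, Finset.sum_mul]
    exact Finset.sum_congr rfl fun _ _ => Finset.sum_congr rfl fun _ _ => by ring
  refine ⟨htan, ?_, fun i k => ?_⟩
  · rw [orthonormal_iff_ite]
    intro i k
    rw [hX, hX, hbil]
    change (C * inducedMetric y ξ * C.transpose) i k = _
    rw [hC1, Matrix.one_apply]
  · rw [hX, hN, hbil]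
    change (C * secondFundamentalForm y ν ξ * C.transpose) i k = _
    rw [hC2, Matrix.diagonal_apply]
    rfl

end IsImmersedHypersurface

end Hypersurface

/-! ### From the parametrized flow to a starshaped flow. -/

section Flow

open Filter Topology Set

variable {n : ℕ}

namespace IsImmersedHypersurface

variable {y ν : UnitSphere n → Ambient n}

lemma fderiv_coneExtension_self (h : IsImmersedHypersurface y ν) {ζ : Ambient n} (hζ : ζ ≠ 0) :
    fderiv ℝ (coneExtension y) ζ ζ = coneExtension y ζ := by
  have h1 := ((hasFDerivAt_norm_of_ne hζ).differentiableAt.hasFDerivAt.smul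
    (h.differentiableAt hζ).hasFDerivAt).fderiv
  have h2 : coneExtension y =
      (norm : Ambient n → ℝ) • fun ζ : Ambient n => y (sphereProj ζ) := rfl
  rw [h2, h1]
  have hn : ‖ζ‖ ≠ 0 := norm_ne_zero_iff.2 hζ
  have h3 : ‖ζ‖⁻¹ * ‖ζ‖ ^ 2 = ‖ζ‖ := by field_simp
  simp [fderiv_norm_of_ne hζ, h.fderiv_self hζ, h3]

/-- Pairing with ν kills the tangential part, so positivity of the support function forces the
radial part of a kernel vector to vanish; the rest vanishes since y is an immersion. -/
lemma injective_fderiv_coneExtension (h : IsImmersedHypersurface y ν) {ζ : Ambient n} (hζ : ζ ≠ 0)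
    (hu : 0 < ⟪coneExtension y ζ, ν (sphereProj ζ)⟫) :
    Function.Injective (fderiv ℝ (coneExtension y) ζ) := by
  rw [injective_iff_map_eq_zero]
  intro w hw
  have hn : 0 < ‖ζ‖ := norm_pos_iff.2 hζ
  obtain ⟨w₀, hw₀, hdec⟩ := exists_smul_add_orthogonal hζ w
  have h1 := hw
  rw [hdec, map_add, map_smul, h.fderiv_coneExtension_self hζ] at h1
  have h2 := congrArg (fun v => ⟪v, ν (sphereProj ζ)⟫) h1
  simp only [inner_add_left, real_inner_smul_left, h.inner_fderiv_coneExtension hζ hw₀, add_zero,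
    inner_zero_left] at h2
  have h3 := (mul_eq_zero.1 h2).resolve_right hu.ne'
  rw [h3, zero_smul, zero_add] at hdec h1
  have hξ : ⟪(sphereProj ζ : Ambient n), w₀⟫ = 0 := by
    rw [coe_sphereProj hζ, real_inner_smul_left, hw₀, mul_zero]
  obtain ⟨c, hc⟩ := exists_eq_sum_sphereFrame (sphereProj ζ) hξ
  have h4 := fderiv_comp_sphereProj_smul y hζ (inv_pos.2 hn)
  rw [h.fderiv_coneExtension hζ hw₀, ← h4, ← coe_sphereProj hζ, smul_apply, smul_smul,
    mul_inv_cancel₀ hn.ne', one_smul, hc, map_sum] at h1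
  simp only [map_smul, fderiv_comp_sphereProj_frame h.smooth] at h1
  have h5 := Fintype.linearIndependent_iff.1 (linearIndependent_frameDeriv
    (h.immersion (sphereProj ζ))) c h1
  rw [hdec, hc]
  exact Finset.sum_eq_zero fun i _ => by rw [h5 i, zero_smul]

end IsImmersedHypersurface

lemma coneExtension_smul (y : UnitSphere n → Ambient n) {ζ : Ambient n} (hζ : ζ ≠ 0) {l : ℝ}
    (hl : 0 < l) : coneExtension y (l • ζ) = l • coneExtension y ζ := by
  rw [coneExtension, coneExtension, sphereProj_smul hζ hl, norm_smul, Real.norm_of_nonneg hl.le,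
    smul_smul]

lemma coneExtension_coe (y : UnitSphere n → Ambient n) (ξ : UnitSphere n) :
    coneExtension y (ξ : Ambient n) = y ξ := by
  rw [coneExtension, sphereProj_coe, norm_eq_of_mem_sphere ξ, one_smul]

/-- The gauge of the starshaped hypersurface with radial function `r`. -/
noncomputable def gaugeOfRadial (r : UnitSphere n → ℝ) (z : Ambient n) : ℝ :=
  ‖z‖ * (r (sphereProj z))⁻¹

namespace IsRadialFunction

variable {r : UnitSphere n → ℝ} {M : Set (Ambient n)}

lemma isGauge (hr : IsRadialFunction r M) : IsGauge (gaugeOfRadial r) where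
  pos _ hz := mul_pos (norm_pos_iff.2 hz) (inv_pos.2 (hr.pos _))
  homogeneous z hz l hl := by
    rw [gaugeOfRadial, gaugeOfRadial, sphereProj_smul hz hl, norm_smul, Real.norm_of_nonneg hl.le,
      mul_assoc]
  smooth := (isGauge_norm.smooth).mul
    ((contDiffOn_comp_sphereProj hr.smooth).inv fun _ _ => (hr.pos _).ne')

lemma gaugeOfRadial_eq_one (hr : IsRadialFunction r M) {z : Ambient n} (hz : z ∈ M) :
    gaugeOfRadial r z = 1 := by
  rw [hr.graph] at hz
  obtain ⟨y, rfl⟩ := hz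
  have hy := hr.pos y
  simp only [gaugeOfRadial]
  rw [sphereProj_smul (ne_zero_of_mem_unit_sphere y) hy, sphereProj_coe, norm_smul,
    Real.norm_of_nonneg hy.le, norm_eq_of_mem_sphere y, mul_one, mul_inv_cancel₀ hy.ne']

lemma ne_zero (hr : IsRadialFunction r M) {z : Ambient n} (hz : z ∈ M) : z ≠ 0 := by
  rintro rfl
  have := hr.gaugeOfRadial_eq_one hz
  rw [gaugeOfRadial, norm_zero, zero_mul] at this
  exact zero_ne_one this

end IsRadialFunction

namespace IsFlowSolution

variable {Γ : Set (Fin n → ℝ)} {f : (Fin n → ℝ) → ℝ} {M₀ : Set (Ambient n)} {T : EReal}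
  {x ν : ℝ → UnitSphere n → Ambient n} {t τ : ℝ}

lemma isImmersedHypersurface (h : IsFlowSolution Γ f M₀ T x ν) (ht : t ∈ timeInterval T) :
    IsImmersedHypersurface (x t) (ν t) where
  smooth := contMDiff_slice h.smooth ht
  normal_smooth := contMDiff_slice h.normal_smooth ht
  immersion := h.immersion t ht
  orthogonal := h.normal_orthogonal t ht

lemma smoothFamily_coneExtension (h : IsFlowSolution Γ f M₀ T x ν) :
    SmoothFamily (timeInterval T) {0}ᶜ fun t => coneExtension (x t) := by
  have h1 : ContDiffOn ℝ ∞ (fun p : ℝ × Ambient n => ‖p.2‖) (timeInterval T ×ˢ {0}ᶜ) :=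
    contDiffOn_snd.norm ℝ fun p hp => hp.2
  exact h1.smul (smoothFamily_comp_sphereProj h.smooth)

lemma gaugeOfRadial_coneExtension (h : IsFlowSolution Γ f M₀ T x ν) {r : UnitSphere n → ℝ}
    (hr : IsRadialFunction r M₀) {ζ : Ambient n} (hζ : ζ ≠ 0) :
    gaugeOfRadial r (coneExtension (x 0) ζ) = ‖ζ‖ := by
  have hn : 0 < ‖ζ‖ := norm_pos_iff.2 hζ
  have hmem : x 0 (sphereProj ζ) ∈ M₀ := h.initial_range ▸ mem_range_self _
  rw [coneExtension, hr.isGauge.homogeneous _ (hr.ne_zero hmem) _ hn, hr.gaugeOfRadial_eq_one hmem,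
    mul_one]

/-- The initial gauge recovers ‖ζ‖ from the image; then injectivity of x(0,·) recovers the direction
of ζ. -/
lemma injOn_coneExtension (h : IsFlowSolution Γ f M₀ T x ν) {r : UnitSphere n → ℝ}
    (hr : IsRadialFunction r M₀) : InjOn (coneExtension (x 0)) {0}ᶜ := by
  intro ζ hζ η hη heq
  have h1 : ‖ζ‖ = ‖η‖ := by
    rw [← h.gaugeOfRadial_coneExtension hr hζ, heq, h.gaugeOfRadial_coneExtension hr hη]
  have hn : ‖η‖ ≠ 0 := norm_ne_zero_iff.2 hη
  rw [coneExtension, coneExtension, h1] at heq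
  have h2 := congrArg Subtype.val (h.initial_injective (smul_right_injective _ hn heq))
  rw [coe_sphereProj hζ, coe_sphereProj hη, h1] at h2
  exact smul_right_injective _ (inv_ne_zero hn) h2

lemma isRadialFamily (h : IsFlowSolution Γ f M₀ T x ν) (hτ : Ico 0 τ ⊆ timeInterval T)
    (hu : ∀ t ∈ Ico 0 τ, ∀ ξ, 0 < supportFunction (x t) (ν t) ξ) :
    IsRadialFamily (Ico 0 τ) fun t => coneExtension (x t) := by
  have hpos : ∀ t ∈ Ico 0 τ, ∀ ζ : Ambient n, ζ ≠ 0 →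
      0 < ⟪coneExtension (x t) ζ, ν t (sphereProj ζ)⟫ := fun t ht ζ hζ => by
    rw [coneExtension, real_inner_smul_left]
    exact mul_pos (norm_pos_iff.2 hζ) (hu t ht _)
  refine ⟨uniqueDiffOn_Ico 0 τ, fun t _ ζ hζ l hl => coneExtension_smul _ hζ hl,
    fun t ht ζ hζ h0 => ?_, h.smoothFamily_coneExtension.mono hτ, fun t ht ζ hζ => ?_⟩
  · have := hpos t ht ζ hζ
    rw [h0, inner_zero_left] at this
    exact lt_irrefl _ this
  · exact (h.isImmersedHypersurface (hτ ht)).injective_fderiv_coneExtension hζ (hpos t ht ζ hζ)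

theorem isStarshapedFlow (h : IsFlowSolution Γ f M₀ T x ν) {r : UnitSphere n → ℝ}
    (hr : IsRadialFunction r M₀) (hτ : Ico 0 τ ⊆ timeInterval T)
    (hu : ∀ t ∈ Ico 0 τ, ∀ ξ, 0 < supportFunction (x t) (ν t) ξ) :
    IsStarshapedFlow Γ f (Ico 0 τ) (fun t => coneExtension (x t)) fun t ζ => ν t (sphereProj ζ) where
  uniqueDiffOn := uniqueDiffOn_Ico 0 τ
  position_smul _ _ _ hζ _ hl := coneExtension_smul _ hζ hl
  normal_smul t _ ζ hζ l hl := by rw [sphereProj_smul hζ hl]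
  smooth_position := h.smoothFamily_coneExtension.mono hτ
  smooth_normal := (smoothFamily_comp_sphereProj h.normal_smooth).mono hτ
  norm_normal t ht _ _ := h.normal_unit t (hτ ht) _
  orthogonal t ht ζ hζ w hw := (h.isImmersedHypersurface (hτ ht)).inner_fderiv_coneExtension hζ hw
  support_pos t ht ζ hζ := by
    rw [coneExtension, real_inner_smul_left]
    exact mul_pos (norm_pos_iff.2 hζ) (hu t ht _)
  injOn t ht := (h.isRadialFamily hτ hu).injOn isPreconnected_Ico
    (left_mem_Ico.2 (ht.1.trans_lt ht.2)) (h.injOn_coneExtension hr) ht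
  evolution t ht ζ hζ := by
    obtain ⟨ξ, rfl⟩ : ∃ ξ : UnitSphere n, (ξ : Ambient n) = ζ := ⟨⟨ζ, by simpa using hζ⟩, rfl⟩
    obtain ⟨⟨w, hw⟩, -⟩ := (h.isImmersedHypersurface (hτ ht)).exists_isCurvatureFrame ξ
    refine ⟨_, h.admissible t (hτ ht) ξ, w, hw, ?_⟩
    simp only [coneExtension_coe, sphereProj_coe]
    exact (h.flow t (hτ ht) ξ).mono hτ

end IsFlowSolution

end Flow

/-! ### Positivity of the support function and the final bounds. -/

section Conclusion

open Filter Topology Set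

variable {n : ℕ} {Γ : Set (Fin n → ℝ)} {f : (Fin n → ℝ) → ℝ}

lemma exists_Ico_subset_timeInterval {T : EReal} {t : ℝ} (ht : t ∈ timeInterval T) :
    ∃ τ, t ∈ Ico 0 τ ∧ Ico 0 τ ⊆ timeInterval T := by
  obtain ⟨τ, h1, h2⟩ := EReal.lt_iff_exists_real_btwn.1 ht.2
  refine ⟨τ, ⟨ht.1, EReal.coe_lt_coe_iff.1 h1⟩, fun s hs => ⟨hs.1, ?_⟩⟩
  exact (EReal.coe_lt_coe_iff.2 hs.2).trans h2

/-- The radial function at time `t` of the hypersurfaces parametrized by `x`. -/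
noncomputable def flowRadial (x : ℝ → UnitSphere n → Ambient n) (t : ℝ) (y : UnitSphere n) : ℝ :=
  (radialGauge (fun s => coneExtension (x s)) t (y : Ambient n))⁻¹

lemma IsAdmissibleCurvatureFunction.isCompact_bounded (hf : IsAdmissibleCurvatureFunction Γ f)
    {c : ℝ} : IsCompact (closure Γ ∩ f ⁻¹' Ici c⁻¹ ∩ {κ | ∀ i, |κ i| ≤ c}) := by
  have h1 : IsClosed (closure Γ ∩ f ⁻¹' Ici c⁻¹) :=
    hf.continuous_closure.preimage_isClosed_of_isClosed isClosed_closure isClosed_Ici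
  have h2 : {κ : Fin n → ℝ | ∀ i, |κ i| ≤ c} = univ.pi fun _ => Icc (-c) c := by
    ext κ
    simp only [mem_ofPred_eq, abs_le, mem_univ_pi, mem_Icc]
  rw [h2]
  exact (isCompact_univ_pi fun _ => isCompact_Icc).inter_left h1

/-- A point of the closure outside the open cone Γ lies on its boundary, where f = 0 < 1/c. -/
lemma IsAdmissibleCurvatureFunction.bounded_subset (hf : IsAdmissibleCurvatureFunction Γ f)
    {c : ℝ} (hc : 0 < c) : closure Γ ∩ f ⁻¹' Ici c⁻¹ ∩ {κ | ∀ i, |κ i| ≤ c} ⊆ Γ := by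
  rintro κ ⟨⟨h1, h2⟩, -⟩
  by_contra h3
  have h4 := hf.zero_boundary κ ⟨h1, fun h => h3 (interior_subset h)⟩
  rw [mem_preimage, h4, mem_Ici] at h2
  exact (inv_pos.2 hc).not_ge h2

namespace IsFlowSolution

variable {M₀ : Set (Ambient n)} {T : EReal} {x ν : ℝ → UnitSphere n → Ambient n} {t τ c : ℝ}
  {r : UnitSphere n → ℝ}

lemma continuousOn_supportFunction (h : IsFlowSolution Γ f M₀ T x ν) :
    ContinuousOn (fun p : ℝ × UnitSphere n => supportFunction (x p.1) (ν p.1) p.2)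
      (timeInterval T ×ˢ univ) :=
  ContinuousOn.inner h.smooth.continuousOn h.normal_smooth.continuousOn

lemma eqOn_radialGauge (hn : 0 < n) (h : IsFlowSolution Γ f M₀ T x ν)
    (hr : IsRadialFunction r M₀) {I : Set ℝ} {N : ℝ → Ambient n → Ambient n}
    (hs : IsStarshapedFlow Γ f I (fun t => coneExtension (x t)) N) (h0 : 0 ∈ I) :
    EqOn (radialGauge (fun t => coneExtension (x t)) 0) (gaugeOfRadial r) {0}ᶜ := by
  intro z hz
  obtain ⟨ζ, hζ, rfl⟩ := hs.surjOn finrank_euclideanSpace_fin hn h0 hz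
  exact (hs.radialGauge_apply h0 hζ).trans (h.gaugeOfRadial_coneExtension hr hζ).symm

/-- The estimates along the flow, in terms of the parametrization. -/
lemma estimates (h : IsFlowSolution Γ f M₀ T x ν) (hτ : Ico 0 τ ⊆ timeInterval T) (ht : t ∈ Ico 0 τ)
    (he : UniformEstimates Γ f (Ico 0 τ) (fun t => coneExtension (x t))
      (fun t ζ => ν t (sphereProj ζ)) t c) (ξ : UnitSphere n) :
    (c⁻¹ ≤ supportFunction (x t) (ν t) ξ ∧ supportFunction (x t) (ν t) ξ ≤ c) ∧
    (c⁻¹ ≤ curvatureF f (x t) (ν t) ξ ∧ curvatureF f (x t) (ν t) ξ ≤ c) ∧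
    weingartenNormSq (x t) (ν t) ξ ≤ n * c ^ 2 ∧
    ∀ i, |principalCurvatures (x t) (ν t) ξ i| ≤ c := by
  obtain ⟨⟨w, hw⟩, hsq⟩ := (h.isImmersedHypersurface (hτ ht)).exists_isCurvatureFrame ξ
  have key := he.curvature ξ (norm_eq_of_mem_sphere ξ) _ (h.admissible t (hτ ht) ξ) w hw
  simp only [coneExtension_coe, sphereProj_coe] at key
  obtain ⟨h1, h2, h3⟩ := key ((h.flow t (hτ ht) ξ).mono hτ)
  refine ⟨h1, h2, ?_, h3⟩
  rw [hsq]
  calc ∑ i, principalCurvatures (x t) (ν t) ξ i ^ 2 ≤ ∑ _i : Fin n, c ^ 2 :=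
        Finset.sum_le_sum fun i _ => sq_le_sq' (abs_le.1 (h3 i)).1 (abs_le.1 (h3 i)).2
    _ = n * c ^ 2 := by simp

/-- The support function stays positive. -/
lemma supportFunction_pos (h : IsFlowSolution Γ f M₀ T x ν) (hr : IsRadialFunction r M₀) (hn : 0 < n)
    (hc : 0 < c) (he : ∀ (τ : ℝ) (X N : ℝ → Ambient n → Ambient n),
      IsStarshapedFlow Γ f (Ico 0 τ) X N → EqOn (radialGauge X 0) (gaugeOfRadial r) {0}ᶜ →
      ∀ t ∈ Ico 0 τ, UniformEstimates Γ f (Ico 0 τ) X N t c)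
    (ht : t ∈ timeInterval T) (ξ : UnitSphere n) : 0 < supportFunction (x t) (ν t) ξ := by
  by_contra hneg
  have hsub : Icc 0 t ⊆ timeInterval T := fun s hs =>
    ⟨hs.1, (EReal.coe_le_coe_iff.2 hs.2).trans_lt ht.2⟩
  have hcont := h.continuousOn_supportFunction.mono (prod_mono_left hsub)
  have hcl : IsCompact (Icc 0 t ×ˢ univ ∩
      (fun p : ℝ × UnitSphere n => supportFunction (x p.1) (ν p.1) p.2) ⁻¹' Iic 0) :=
    (isCompact_Icc.prod isCompact_univ).of_isClosed_subset
      (hcont.preimage_isClosed_of_isClosed (isClosed_Icc.prod isClosed_univ) isClosed_Iic)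
      inter_subset_left
  -- σ is the first time at which the support function is nonpositive somewhere, at the point η.
  obtain ⟨⟨σ, η⟩, ⟨⟨hσ, -⟩, hση⟩, hmin⟩ := hcl.exists_isMinOn
    ⟨(t, ξ), ⟨⟨ht.1, le_rfl⟩, mem_univ _⟩, not_lt.1 hneg⟩ continuous_fst.continuousOn
  replace hσ : σ ∈ Icc 0 t := hσ
  replace hση : supportFunction (x σ) (ν σ) η ≤ 0 := hση
  have hσ0 : 0 < σ := by
    refine hσ.1.lt_of_ne fun h0 => ?_
    rw [← h0] at hση
    exact (h.normal_outward η).not_ge hση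
  have hpos : ∀ s ∈ Ico 0 σ, ∀ ξ, 0 < supportFunction (x s) (ν s) ξ := by
    intro s hs ξ
    by_contra hle
    have hm : σ ≤ s := hmin (a := (s, ξ)) ⟨⟨⟨hs.1, hs.2.le.trans hσ.2⟩, mem_univ _⟩, not_lt.1 hle⟩
    exact hm.not_gt hs.2
  have hI : Ico 0 σ ⊆ timeInterval T := fun s hs => hsub ⟨hs.1, hs.2.le.trans hσ.2⟩
  have hs := h.isStarshapedFlow hr hI hpos
  -- On [0, σ) the flow is starshaped and the constant c does not depend on σ, so the bound 1/c
  -- passes to the limit and contradicts the choice of η.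
  have hlow : ∀ s ∈ Ico 0 σ, c⁻¹ ≤ supportFunction (x s) (ν s) η := fun s hsm =>
    (h.estimates hI hsm (he σ _ _ hs (h.eqOn_radialGauge hn hr hs ⟨le_rfl, hσ0⟩) s hsm) η).1.1
  have hlim : ContinuousWithinAt (fun s => supportFunction (x s) (ν s) η) (Ico 0 σ) σ :=
    ((hcont (σ, η) ⟨hσ, mem_univ _⟩).comp (f := fun s : ℝ => (s, η)) (by fun_prop)
      (t := Icc 0 t ×ˢ univ) fun s hs => ⟨hs, mem_univ _⟩).mono
      fun s hs => ⟨hs.1, hs.2.le.trans hσ.2⟩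
  have hne : (𝓝[Ico 0 σ] σ).NeBot := by
    rw [← mem_closure_iff_nhdsWithin_neBot, closure_Ico hσ0.ne]
    exact ⟨hσ0.le, le_rfl⟩
  have := ge_of_tendsto hlim (eventually_nhdsWithin_of_forall hlow)
  linarith [inv_pos.2 hc]

section Radial

variable {N : ℝ → Ambient n → Ambient n}

lemma isRadialFunction_flowRadial (hn : 0 < n)
    (hs : IsStarshapedFlow Γ f (Ico 0 τ) (fun t => coneExtension (x t)) N) (ht : t ∈ Ico 0 τ) :
    IsRadialFunction (flowRadial x t) (range (x t)) := by
  have hE : Module.finrank ℝ (Ambient n) = n + 1 := finrank_euclideanSpace_fin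
  have : Fact (Module.finrank ℝ (Ambient n) = n + 1) := ⟨hE⟩
  have hg := hs.isGauge_radialGauge hE hn ht
  have hy0 (y : UnitSphere n) : (y : Ambient n) ≠ 0 := ne_zero_of_mem_unit_sphere y
  refine ⟨fun y => ?_, fun y => inv_pos.2 (hg.pos _ (hy0 y)), Subset.antisymm ?_ ?_⟩
  · exact ((hg.contDiffAt (hy0 y)).inv (hg.pos _ (hy0 y)).ne').contMDiffAt.comp y
      (contMDiff_coe_sphere (n := n)).contMDiffAt
  · rintro _ ⟨ξ, rfl⟩
    have h1 := hs.radialGauge_apply ht (hy0 ξ)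
    simp only [coneExtension_coe, norm_eq_of_mem_sphere] at h1
    have h0 : x t ξ ≠ 0 := by simpa [coneExtension_coe] using hs.position_ne_zero ht (hy0 ξ)
    have h2 : 0 < ‖x t ξ‖⁻¹ := inv_pos.2 (norm_pos_iff.2 h0)
    refine ⟨sphereProj (x t ξ), ?_⟩
    simp only [flowRadial, coe_sphereProj h0]
    rw [hg.homogeneous _ h0 _ h2, h1, mul_one, inv_inv, smul_smul,
      mul_inv_cancel₀ (norm_ne_zero_iff.2 h0), one_smul]
  · rintro _ ⟨y, rfl⟩
    have hso := hs.surjOn hE hn ht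
    set ζ := radialInverse (coneExtension (x t)) (y : Ambient n) with hζ
    have hζ0 : ζ ≠ 0 := radialInverse_ne_zero hso (hy0 y)
    have h1 : coneExtension (x t) ζ = y := apply_radialInverse hso (hy0 y)
    refine ⟨sphereProj ζ, ?_⟩
    have h2 : flowRadial x t y = ‖ζ‖⁻¹ := rfl
    simp only [h2]
    rw [← h1, coneExtension, smul_smul, inv_mul_cancel₀ (norm_ne_zero_iff.2 hζ0), one_smul]

/-- Comparison with the stationary gauge |z| in both directions; the initial quotients are bounded
by 1/inf ρ(0,·) and sup ρ(0,·). -/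
lemma flowRadial_mem_Icc (hn : 0 < n) (hf : IsAdmissibleCurvatureFunction Γ f)
    (hs : IsStarshapedFlow Γ f (Ico 0 τ) (fun t => coneExtension (x t)) N) (ht : t ∈ Ico 0 τ)
    (y : UnitSphere n) :
    flowRadial x t y ∈ Icc (sInf (range (flowRadial x 0))) (sSup (range (flowRadial x 0))) := by
  have hE : Module.finrank ℝ (Ambient n) = n + 1 := finrank_euclideanSpace_fin
  have h0 : (0 : ℝ) ∈ Ico 0 τ := ⟨le_rfl, ht.1.trans_lt ht.2⟩
  have hr := isRadialFunction_flowRadial hn hs h0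
  have hcpt := isCompact_range hr.smooth.continuous
  have hne : (range (flowRadial x 0)).Nonempty := ⟨_, mem_range_self y⟩
  have hfl := hs.isGaugeFlow hE hn hf
  have hnm := IsGaugeFlow.isGaugeFlow_norm hE hn hf τ
  have hy := ne_zero_of_mem_unit_sphere y
  have hpos := (hfl.gauge t ht).pos _ hy
  have hval : ∀ z : Ambient n, z ≠ 0 → radialGauge (fun s => coneExtension (x s)) 0 z =
      ‖z‖ * (flowRadial x 0 (sphereProj z))⁻¹ := fun z hz => by
    rw [flowRadial, inv_inv, coe_sphereProj hz,
      (hfl.gauge 0 h0).homogeneous _ hz _ (inv_pos.2 (norm_pos_iff.2 hz)), ← mul_assoc,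
      mul_inv_cancel₀ (norm_ne_zero_iff.2 hz), one_mul]
  have ha : 0 < sInf (range (flowRadial x 0)) := by
    obtain ⟨η, hη⟩ := hcpt.sInf_mem hne
    exact hη ▸ hr.pos η
  have hb : 0 < sSup (range (flowRadial x 0)) := by
    obtain ⟨η, hη⟩ := hcpt.sSup_mem hne
    exact hη ▸ hr.pos η
  constructor
  · have h1 := hfl.le_of_le hE hf hnm (C := (sInf (range (flowRadial x 0)))⁻¹) (fun z hz => by
      rw [hval z hz, mul_comm]
      gcongr
      exact csInf_le hcpt.bddBelow (mem_range_self _)) ht hy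
    rw [norm_eq_of_mem_sphere, mul_one] at h1
    exact (le_inv_comm₀ hpos ha).1 h1
  · have h1 := hnm.le_of_le hE hf hfl (C := sSup (range (flowRadial x 0))) (fun z hz => by
      rw [hval z hz, mul_comm, mul_assoc]
      refine le_mul_of_one_le_right (norm_nonneg z) ?_
      rw [inv_mul_eq_div, one_le_div (hr.pos _)]
      exact le_csSup hcpt.bddAbove (mem_range_self _)) ht hy
    rw [norm_eq_of_mem_sphere] at h1
    rw [flowRadial, inv_le_iff_one_le_mul₀ hpos]
    exact h1

lemma hasC2Bound_flowRadial (hn : 0 < n)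
    (hs : IsStarshapedFlow Γ f (Ico 0 τ) (fun t => coneExtension (x t)) N) (ht : t ∈ Ico 0 τ)
    (he : UniformEstimates Γ f (Ico 0 τ) (fun t => coneExtension (x t)) N t c) {C : ℝ}
    (hC : c ≤ C) : HasC2Bound (flowRadial x t) C := by
  intro y
  have hg := hs.isGauge_radialGauge finrank_euclideanSpace_fin hn ht
  have hy := ne_zero_of_mem_unit_sphere y
  have h1 : homogeneousExtension (flowRadial x t) =ᶠ[𝓝 (y : Ambient n)]
      fun z => ‖z‖ * (radialGauge (fun t => coneExtension (x t)) t z)⁻¹ := by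
    filter_upwards [isOpen_compl_singleton.mem_nhds hy] with z hz
    rw [homogeneousExtension_eq _ hz, flowRadial, coe_sphereProj hz,
      hg.homogeneous _ hz _ (inv_pos.2 (norm_pos_iff.2 hz)), mul_inv, inv_inv]
  obtain ⟨h2, h3, h4⟩ := he.radial y (norm_eq_of_mem_sphere y)
  rw [h1.fderiv_eq (𝕜 := ℝ), (h1.fderiv (𝕜 := ℝ)).fderiv_eq (𝕜 := ℝ)]
  refine ⟨?_, fun v hv => (h3 v hv).trans (by gcongr), fun v w hv hw => (h4 v w hv hw).trans
    (by gcongr)⟩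
  simp only [norm_eq_of_mem_sphere, one_mul] at h2
  exact h2.trans hC

end Radial

end IsFlowSolution

end Conclusion

theorem mainTheorem5 (n : ℕ) (hn : 2 ≤ n) (Γ : Set (Fin n → ℝ)) (f : (Fin n → ℝ) → ℝ)
    (hf : IsAdmissibleCurvatureFunction Γ f) (M₀ : Set (Ambient n)) (hM₀ : IsStarshaped M₀) :
    ∃ c : ℝ, 0 < c ∧ ∃ K : Set (Fin n → ℝ), IsCompact K ∧ K ⊆ Γ ∧
      ∀ (T : EReal) (x ν : ℝ → UnitSphere n → Ambient n), IsFlowSolution Γ f M₀ T x ν →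
        (∃ ρ : ℝ → UnitSphere n → ℝ, ∀ t ∈ timeInterval T,
          IsRadialFunction (ρ t) (Set.range (x t)) ∧
          (∀ y, sInf (Set.range (ρ 0)) ≤ ρ t y ∧ ρ t y ≤ sSup (Set.range (ρ 0))) ∧
          HasC2Bound (ρ t) c) ∧
        ∀ t ∈ timeInterval T, ∀ ξ : UnitSphere n,
          (c⁻¹ ≤ supportFunction (x t) (ν t) ξ ∧ supportFunction (x t) (ν t) ξ ≤ c) ∧
          (c⁻¹ ≤ curvatureF f (x t) (ν t) ξ ∧ curvatureF f (x t) (ν t) ξ ≤ c) ∧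
          weingartenNormSq (x t) (ν t) ξ ≤ c ∧
          principalCurvatures (x t) (ν t) ξ ∈ K := by
  have hn0 : 0 < n := by omega
  obtain ⟨r, hr⟩ := hM₀
  obtain ⟨c, hc, he⟩ := exists_uniformEstimates finrank_euclideanSpace_fin hn0 hf hr.isGauge
  -- The summand n c² accommodates |A|² = Σ κᵢ² ≤ n c².
  have hC : c ≤ c + n * c ^ 2 := le_add_of_nonneg_right (by positivity)
  have hC' : (c + n * c ^ 2)⁻¹ ≤ c⁻¹ := inv_anti₀ hc hC
  refine ⟨c + n * c ^ 2, by positivity, _, hf.isCompact_bounded (c := c), hf.bounded_subset hc, ?_⟩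
  intro T x ν h
  have hpos := fun t (ht : t ∈ timeInterval T) => h.supportFunction_pos hr hn0 hc he ht
  -- The starshaped flow lives on intervals [0, τ) with real τ; the choice of τ is immaterial since
  -- c does not depend on it.
  have key : ∀ t ∈ timeInterval T, ∃ τ, t ∈ Set.Ico 0 τ ∧ Set.Ico 0 τ ⊆ timeInterval T ∧
      IsStarshapedFlow Γ f (Set.Ico 0 τ) (fun t => coneExtension (x t))
        (fun t ζ => ν t (sphereProj ζ)) ∧
      UniformEstimates Γ f (Set.Ico 0 τ) (fun t => coneExtension (x t))
        (fun t ζ => ν t (sphereProj ζ)) t c := fun t ht => by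
    obtain ⟨τ, htτ, hτ⟩ := exists_Ico_subset_timeInterval ht
    have hs := h.isStarshapedFlow hr hτ fun t ht => hpos t (hτ ht)
    exact ⟨τ, htτ, hτ, hs, he τ _ _ hs
      (h.eqOn_radialGauge hn0 hr hs ⟨le_rfl, htτ.1.trans_lt htτ.2⟩) t htτ⟩
  refine ⟨⟨flowRadial x, fun t ht => ?_⟩, fun t ht ξ => ?_⟩
  · obtain ⟨τ, htτ, -, hs, hest⟩ := key t ht
    exact ⟨IsFlowSolution.isRadialFunction_flowRadial hn0 hs htτ,
      fun y => IsFlowSolution.flowRadial_mem_Icc hn0 hf hs htτ y,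
      IsFlowSolution.hasC2Bound_flowRadial hn0 hs htτ hest hC⟩
  · obtain ⟨τ, htτ, hτ, -, hest⟩ := key t ht
    obtain ⟨⟨h1, h2⟩, ⟨h3, h4⟩, h5, h6⟩ := h.estimates hτ htτ hest ξ
    exact ⟨⟨hC'.trans h1, h2.trans hC⟩, ⟨hC'.trans h3, h4.trans hC⟩,
      h5.trans (le_add_of_nonneg_left hc.le),
      ⟨subset_closure (h.admissible t ht ξ), h3⟩, h6⟩
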